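/- **Setting.** Let $(S,h)$ be a connected smooth Riemannian manifold (Hausdorff, finite dimensional, without boundary, not assumed complete), let $C\subset S$ be a nonempty closed set, and let $\rho_C:S\to[0,\infty)$ be the distance function, $\rho_C(p)$ being the infimum of the lengths of curves in $S$ connecting $p$ to $C$. A *$C$-minimizing segment* is a unit speed geodesic $\gamma:I\to S$ on a nondegenerate interval $I\subset\mathbb R$ (open, closed or half open) with $\rho_C(\gamma(s))=s$ for all $s\in I$; all $C$-minimizing segments are taken with maximal domain. The cut locus $\mathrm{Cut}_C$ is the set of all points $\gamma(b)$ where $\gamma$ is a (maximal) $C$-minimizing segment whose domain is of the form $[a,b]$ or $(a,b]$ with $b<\infty$. For $p\in S\setminus C$ let $N_C(p)\in\mathbb N\cup\{\infty\}$ be the number of (maximal) $C$-minimizing segments on which $p$ lies. Let $M=S\times(-\infty,0)$ with the Lorentzian metric $g=h-dt^2$, time oriented by $\partial/\partial t$, and let $$\mathscr H=\{(x,-\rho_C(x)) : x\in S\setminus C\}\subset M .$$ A *future horizon* in $M$ is a subset that is achronal (no two of its points, equal or distinct, are joined by a timelike curve), closed in $M$, an embedded topological hypersurface, and future null geodesically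 ruled, that is, each of its points lies on a future directed, future inextensible null geodesic (one without future end point in $M$) contained in the subset. A *null generator* of $\mathscr H$ is such a future inextensible null geodesic contained in $\mathscr H$, extended to the past as far as it remains in $\mathscr H$; generators are counted up to reparametrization. The multiplicity $N(q)\in\mathbb N\cup\{\infty\}$ of $q\in\mathscr H$ is the number of generators containing $q$, and $\mathscr H_{\mathrm{end}}$ is the set of (past) end points of generators of $\mathscr H$. **Proposition.** 1. $\mathscr H$ is a future horizon in $M$. 2. Up to reparametrization, the null generators of $\mathscr H$ are exactly the curves $s\mapsto(\gamma(s),-\rho_C(\gamma(s)))$, $s\in I$, $s>0$, where $\gamma:I\to S$ is a (maximal) $C$-minimizing segment. (The increasing parameter $s$ runs along the generator to the past; the value $s=0$ is omitted if $0\in I$, since $(\gamma(0),0)\notin M$. An affinely parametrized generator is obtained from such a curve by an affine, orientation reversing change of parameter.) 3. $N(p,-\rho_C(p))=N_C(p)$ for every $p\in S\setminus C$. 4. $\mathscr H_{\mathrm{end}}=\{(p,-\rho_C(p)) : p\in\mathrm{Cut}_C\}$. -/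

import Mathlib

open Set Filter Topology Manifold Bundle
open scoped ContDiff ENNReal

noncomputable section

namespace Horizon

/-! ## Curves, geodesics and causality for a metric tensor on a manifold without boundary -/

section General

variable {F : Type*} [NormedAddCommGroup F] [NormedSpace ℝ F]
  {H : Type*} [TopologicalSpace H] {I : ModelWithCorners ℝ F H}
  {N : Type*} [TopologicalSpace N] [ChartedSpace H N]

/-- A field of bilinear forms on the tangent spaces of `N` (Riemannian or Lorentzian metrics are
used below). -/
abbrev TensorField (I : ModelWithCorners ℝ F H) (N : Type*) [TopologicalSpace N]
    [ChartedSpace H N] :=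
  ∀ x : N, LinearMap.BilinForm ℝ (TangentSpace I x)

variable (I) in
/-- The velocity `γ'(s)` of a curve defined on `J` (one-sided at end points of `J`). -/
def velocity (γ : ℝ → N) (J : Set ℝ) (s : ℝ) : TangentSpace I (γ s) :=
  mfderivWithin 𝓘(ℝ, ℝ) I γ J s (1 : ℝ)

/-- The components `G_y(v, w)` of the metric `g` in the chart around `x₀`. -/
def coordMetric (g : TensorField I N) (x₀ : N) (y v w : F) : ℝ :=
  g ((extChartAt I x₀).symm y)
    (mfderiv 𝓘(ℝ, F) I (extChartAt I x₀).symm y v)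
    (mfderiv 𝓘(ℝ, F) I (extChartAt I x₀).symm y w)

/-- The Christoffel symbols of the first kind of `g` in the chart around `x₀`:
`½ (∂_u G(v, w) + ∂_v G(u, w) - ∂_w G(u, v))`. -/
def christoffel (g : TensorField I N) (x₀ : N) (y u v w : F) : ℝ :=
  (1 / 2 : ℝ) *
    (fderiv ℝ (fun z ↦ coordMetric g x₀ z v w) y u
      + fderiv ℝ (fun z ↦ coordMetric g x₀ z u w) y v
      - fderiv ℝ (fun z ↦ coordMetric g x₀ z u v) y w)

/-- `γ` is an (affinely parametrized) geodesic of `g` on the nondegenerate interval `J`: it is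
`C²`, and in every chart `g(∇_{γ'} γ', w) = 0` for all vectors `w`. For nondegenerate `g` this is
`∇_{γ'} γ' = 0`. -/
structure IsGeodesicOn [I.Boundaryless] (g : TensorField I N) (γ : ℝ → N) (J : Set ℝ) : Prop where
  ordConnected : J.OrdConnected
  nontrivial : J.Nontrivial
  contMDiffOn : ContMDiffOn 𝓘(ℝ, ℝ) I 2 γ J
  equation : ∀ s ∈ J, ∀ x₀ : N, γ s ∈ (chartAt H x₀).source → ∀ w : F,
    let c : ℝ → F := fun τ ↦ extChartAt I x₀ (γ τ)
    let c' : ℝ → F := derivWithin c J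
    let c'' : ℝ → F := derivWithin c' J
    coordMetric g x₀ (c s) (c'' s) w + christoffel g x₀ (c s) (c' s) (c' s) w = 0

/-- `v` is timelike and future directed, the time orientation being given by the timelike vector
field `T` (the signature is `(-,+,…,+)`). -/
def IsFutureTimelike (g : TensorField I N) (T : ∀ x : N, TangentSpace I x) {x : N}
    (v : TangentSpace I x) : Prop :=
  g x v v < 0 ∧ g x v (T x) < 0

/-- `v` is a (nonzero) null vector which is future directed. -/
def IsFutureNull (g : TensorField I N) (T : ∀ x : N, TangentSpace I x) {x : N}
    (v : TangentSpace I x) : Prop :=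
  g x v v = 0 ∧ g x v (T x) < 0

/-- The chronology relation `p ≪ q`: there is a future directed timelike curve from `p` to `q`. -/
def Chronological (g : TensorField I N) (T : ∀ x : N, TangentSpace I x) (p q : N) : Prop :=
  ∃ γ : ℝ → N, ContMDiffOn 𝓘(ℝ, ℝ) I 1 γ (Icc 0 1) ∧ γ 0 = p ∧ γ 1 = q ∧
    ∀ s ∈ Icc (0 : ℝ) 1, IsFutureTimelike g T (velocity I γ (Icc 0 1) s)

/-- No two points of `A` are joined by a timelike curve. -/
def IsAchronal (g : TensorField I N) (T : ∀ x : N, TangentSpace I x) (A : Set N) : Prop :=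
  ∀ p ∈ A, ∀ q ∈ A, ¬ Chronological g T p q

/-- `q` is a future end point of the curve `Γ : J → N`. -/
def IsFutureEndpoint (Γ : ℝ → N) (J : Set ℝ) (q : N) : Prop :=
  ∀ U ∈ 𝓝 q, ∃ s₀ ∈ J, ∀ s ∈ J, s₀ ≤ s → Γ s ∈ U

/-- `q` is a past end point of the curve `Γ : J → N`. -/
def IsPastEndpoint (Γ : ℝ → N) (J : Set ℝ) (q : N) : Prop :=
  ∀ U ∈ 𝓝 q, ∃ s₀ ∈ J, ∀ s ∈ J, s ≤ s₀ → Γ s ∈ U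

/-- `Γ : J → N` is a future directed null geodesic which is contained in `A`. -/
structure IsNullGeodesicIn [I.Boundaryless] (g : TensorField I N) (T : ∀ x : N, TangentSpace I x)
    (A : Set N) (Γ : ℝ → N) (J : Set ℝ) : Prop where
  geodesic : IsGeodesicOn g Γ J
  futureNull : ∀ s ∈ J, IsFutureNull g T (velocity I Γ J s)
  subset : Γ '' J ⊆ A

/-- Every point of `A` lies on a future inextensible null geodesic contained in `A`. -/
def IsFutureNullRuled [I.Boundaryless] (g : TensorField I N) (T : ∀ x : N, TangentSpace I x)
    (A : Set N) : Prop :=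
  ∀ p ∈ A, ∃ (Γ : ℝ → N) (J : Set ℝ), IsNullGeodesicIn g T A Γ J ∧
    (¬ ∃ q, IsFutureEndpoint Γ J q) ∧ p ∈ Γ '' J

variable (F) in
/-- `A` is an embedded topological hypersurface of the manifold `N` (which is modelled on `F`):
locally there are topological coordinates in which `A` is a linear hyperplane. -/
def IsTopologicalHypersurface (A : Set N) : Prop :=
  ∀ p ∈ A, ∃ (e : OpenPartialHomeomorph N F) (l : F →L[ℝ] ℝ), l ≠ 0 ∧ p ∈ e.source ∧
    ∀ q ∈ e.source, q ∈ A ↔ l (e q) = 0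

/-- A future horizon: an achronal, closed, future null geodesically ruled topological
hypersurface. -/
structure IsFutureHorizon [I.Boundaryless] (g : TensorField I N) (T : ∀ x : N, TangentSpace I x)
    (A : Set N) : Prop where
  achronal : IsAchronal g T A
  closed : IsClosed A
  ruled : IsFutureNullRuled g T A
  hypersurface : IsTopologicalHypersurface F A

/-- `Γ : J → N` is a null generator of `A`: a future inextensible null geodesic contained in `A`,
followed to the past for as long as it stays in `A` (that is, with maximal domain). -/
structure IsGenerator [I.Boundaryless] (g : TensorField I N) (T : ∀ x : N, TangentSpace I x)
    (A : Set N) (Γ : ℝ → N) (J : Set ℝ) : Prop where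
  nullGeodesic : IsNullGeodesicIn g T A Γ J
  inextensible : ¬ ∃ q, IsFutureEndpoint Γ J q
  maximal : ∀ (Γ' : ℝ → N) (J' : Set ℝ), IsNullGeodesicIn g T A Γ' J' → J ⊆ J' →
    EqOn Γ' Γ J → J' = J

/-- The multiplicity `N(p)`: the number (in `ℕ ∪ {∞}`) of generators of `A` on which `p` lies,
generators being identified if they differ only by their parametrization. -/
def genMultiplicity [I.Boundaryless] (g : TensorField I N) (T : ∀ x : N, TangentSpace I x)
    (A : Set N) (p : N) : ℕ∞ :=
  {G : Set N | p ∈ G ∧ ∃ (Γ : ℝ → N) (J : Set ℝ), IsGenerator g T A Γ J ∧ G = Γ '' J}.encard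

/-- The set of end points of the generators of `A` (generators have no future end points). -/
def endpoints [I.Boundaryless] (g : TensorField I N) (T : ∀ x : N, TangentSpace I x)
    (A : Set N) : Set N :=
  {p | ∃ (Γ : ℝ → N) (J : Set ℝ), IsGenerator g T A Γ J ∧ IsPastEndpoint Γ J p}

end General

/-! ## The distance function and the cut locus of a subset of a Riemannian manifold -/

section Riemannian

variable (E : Type*) [NormedAddCommGroup E] [NormedSpace ℝ E]
  {S : Type*} [TopologicalSpace S] [ChartedSpace E S]
  [RiemannianBundle (fun x : S ↦ TangentSpace 𝓘(ℝ, E) x)]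

variable (S) in
/-- The Riemannian metric of `S` as a field of bilinear forms. -/
def riemMetric : TensorField 𝓘(ℝ, E) S :=
  fun x ↦ innerₗ (TangentSpace 𝓘(ℝ, E) x)

/-- The distance function `ρ_C`: the infimum of the lengths of curves connecting `p` to `C`
(`riemannianEDist` is the infimum of the lengths of `C¹` curves between two points; restricting to
smooth or piecewise smooth curves gives the same number). -/
def rho (C : Set S) (p : S) : ℝ :=
  (⨅ q ∈ C, riemannianEDist 𝓘(ℝ, E) p q).toReal

/-- `γ` is a `C`-minimizing segment on the nondegenerate interval `J`. -/
structure IsMinimizingSegment (C : Set S) (γ : ℝ → S) (J : Set ℝ) : Prop where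
  geodesic : IsGeodesicOn (riemMetric E S) γ J
  unitSpeed : ∀ s ∈ J, ‖velocity 𝓘(ℝ, E) γ J s‖ = 1
  rho_eq : ∀ s ∈ J, rho E C (γ s) = s

/-- A `C`-minimizing segment which is defined on its maximal domain. -/
structure IsMaximalSegment (C : Set S) (γ : ℝ → S) (J : Set ℝ) : Prop where
  segment : IsMinimizingSegment E C γ J
  maximal : ∀ (γ' : ℝ → S) (J' : Set ℝ), IsMinimizingSegment E C γ' J' → J ⊆ J' →
    EqOn γ' γ J → J' = J

/-- The cut locus `Cut_C`: the points `γ(b)` for maximal `C`-minimizing segments `γ` with domain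
of the form `[a, b]` or `(a, b]`. -/
def cutLocus (C : Set S) : Set S :=
  {p | ∃ (γ : ℝ → S) (J : Set ℝ) (b : ℝ), IsMaximalSegment E C γ J ∧ IsGreatest J b ∧ γ b = p}

/-- `N_C(p)`: the number (in `ℕ ∪ {∞}`) of maximal `C`-minimizing segments on which `p` lies.
As `ρ_C (γ s) = s`, a segment is determined by its image. -/
def numSegments (C : Set S) (p : S) : ℕ∞ :=
  {A : Set S | p ∈ A ∧ ∃ (γ : ℝ → S) (J : Set ℝ), IsMaximalSegment E C γ J ∧ A = γ '' J}.encard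

/-! ## The spacetime `S × (-∞, 0)` with the metric `h - dt²` -/

/-- The half line `(-∞, 0)`, as an open submanifold of `ℝ`. -/
abbrev NegReal : TopologicalSpace.Opens ℝ := ⟨Iio 0, isOpen_Iio⟩

/-- The manifold `M = S × (-∞, 0)`. -/
abbrev Cyl (S : Type*) := S × NegReal

/-- The model with corners of `S × (-∞, 0)`. -/
abbrev cylModel := (𝓘(ℝ, E)).prod 𝓘(ℝ, ℝ)

variable (S) in
/-- The Lorentzian metric `h - dt²` on `S × (-∞, 0)`. -/
def lorentzMetric : TensorField (cylModel E) (Cyl S) := fun q ↦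
  let dπ := (mfderiv (cylModel E) 𝓘(ℝ, E) (fun z : Cyl S ↦ z.1) q).toLinearMap
  let dt := (mfderiv (cylModel E) 𝓘(ℝ, ℝ) (fun z : Cyl S ↦ (z.2 : ℝ)) q).toLinearMap
  (riemMetric E S q.1).compl₁₂ dπ dπ - (LinearMap.mul ℝ ℝ).compl₁₂ dt dt

variable (S) in
/-- The vector field `∂/∂t`, which gives the time orientation of `S × (-∞, 0)`. -/
def timeField (q : Cyl S) : TangentSpace (cylModel E) q := ((0 : E), (1 : ℝ))

/-- The graph of `-ρ_C` over `S \ C`. -/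
def graphSet (C : Set S) : Set (Cyl S) :=
  {q | q.1 ∉ C ∧ (q.2 : ℝ) = - rho E C q.1}

end Riemannian

end Horizon

end

open Horizon

/-! The function `rho` is 1-Lipschitz for the Riemannian distance. A future timelike curve of h -
dt² covers a spatial length smaller than its gain in t, and between points (p, -ρ(p)) and (q, -ρ(q))
of the graph this gain is ρ(p) - ρ(q) ≤ d(p, q). Hence the graph is achronal
(`isAchronal_graphSet`). Continuity of ρ makes it closed and a topological hypersurface.

A geodesic of the product metric is a geodesic of S together with an affine function of time. If it
is null and lies in the graph, the substitution s = a - kτ turns its space part into a unit speed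
geodesic with ρ(γ(s)) = s, that is, a minimizing segment with positive parameters, and conversely
(`isNullGeodesicIn_graphSet_iff`, `IsLift`). What remains is to compare maximality on the two sides.
The parameter 0 has no lift, so a segment may be larger than what its lift sees;
`IsMaximalSegment.mem_of_extends` and `IsMaximalSegment.image_eq` show that this loses nothing.

Two facts about S, valid without completeness, carry the rest. Existence: every point p outside C is
the upper end of a segment (`exists_isMinimizingSegment`). The infimum defining ρ(p) can be split at
the compact frontier of a small coordinate ball, and a short minimizing geodesic leads from p to the
best frontier point. No corners: segments that meet with matching parameters form one geodesic
(`IsMinimizingSegment.join`), since at a corner the shortcut would contradict the Lipschitz bound.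
Together they show that a maximal segment has no first point outside C
(`IsMaximalSegment.exists_lt`). As a convergent geodesic can be continued to its end
(`IsGeodesicWithSpeed.extend_right`), the lift of a maximal segment has no future end point, and its
past end points are the attained upper ends, that is, the cut points.

Short minimizing geodesics are obtained in coordinates, without an exponential map: a contraction
solves the two-point problem for the geodesic equation, and a direct convexity estimate for the
energy shows that the solution is shortest. -/

noncomputable section

namespace Horizon

/-! ### The geodesic spray of a metric on an open set of a vector space -/

section Flat

variable {E : Type*} [NormedAddCommGroup E] [NormedSpace ℝ E]

instance : NormedAddCommGroup (E →L[ℝ] ℝ) := ContinuousLinearMap.toNormedAddCommGroup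

instance : NormedSpace ℝ (E →L[ℝ] ℝ) := ContinuousLinearMap.toNormedSpace

instance : NormedAddCommGroup (E →L[ℝ] E →L[ℝ] ℝ) := ContinuousLinearMap.toNormedAddCommGroup

instance : NormedSpace ℝ (E →L[ℝ] E →L[ℝ] ℝ) := ContinuousLinearMap.toNormedSpace

instance : NormedAddCommGroup (E →L[ℝ] E →L[ℝ] E →L[ℝ] ℝ) :=
  ContinuousLinearMap.toNormedAddCommGroup

instance : NormedSpace ℝ (E →L[ℝ] E →L[ℝ] E →L[ℝ] ℝ) := ContinuousLinearMap.toNormedSpace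

/-- The covector `w ↦ ∂_u G(u, w) - ½ ∂_w G(u, u)` at `y`. -/
def lowerSpray (G : E → E →L[ℝ] E →L[ℝ] ℝ) (y u : E) : E →L[ℝ] ℝ :=
  fderiv ℝ G y u u - (1 / 2 : ℝ) • ((fderiv ℝ G y).flip u).flip u

lemma lowerSpray_apply (G : E → E →L[ℝ] E →L[ℝ] ℝ) (y u w : E) :
    lowerSpray G y u w = fderiv ℝ G y u u w - (1 / 2 : ℝ) * fderiv ℝ G y w u u := by
  simp [lowerSpray]

/-- The right-hand side of the geodesic equation `c'' = spray (c, c')`. -/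
def spray (G : E → E →L[ℝ] E →L[ℝ] ℝ) (p : E × E) : E :=
  -(G p.1).inverse (lowerSpray G p.1 p.2)

/-- `G` is a `C²` Riemannian metric on the open set `U`. -/
structure IsMetricOn (G : E → E →L[ℝ] E →L[ℝ] ℝ) (U : Set E) : Prop where
  isOpen : IsOpen U
  contDiffOn : ContDiffOn ℝ 2 G U
  symm : ∀ y ∈ U, ∀ v w, G y v w = G y w v
  pos : ∀ y ∈ U, ∀ v, v ≠ 0 → 0 < G y v v

/-- Quadratic homogeneity is behind both the affine changes of parameter of geodesics and the
vanishing of the derivative of the spray at zero velocity. -/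
lemma spray_smul (G : E → E →L[ℝ] E →L[ℝ] ℝ) (y u : E) (k : ℝ) :
    spray G (y, k • u) = k ^ 2 • spray G (y, u) := by
  have : lowerSpray G y (k • u) = k ^ 2 • lowerSpray G y u := by
    ext w
    simp [lowerSpray_apply]
    ring
  simp [spray, this]

namespace IsMetricOn

variable {G : E → E →L[ℝ] E →L[ℝ] ℝ} {U : Set E}

lemma contDiffAt (hG : IsMetricOn G U) {y : E} (hy : y ∈ U) : ContDiffAt ℝ 2 G y :=
  hG.contDiffOn.contDiffAt (hG.isOpen.mem_nhds hy)

lemma differentiableAt (hG : IsMetricOn G U) {y : E} (hy : y ∈ U) : DifferentiableAt ℝ G y :=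
  (hG.contDiffAt hy).differentiableAt (by norm_num)

lemma add_sq (hG : IsMetricOn G U) {y : E} (hy : y ∈ U) (v w : E) :
    G y (v + w) (v + w) = G y v v + 2 * G y v w + G y w w := by
  simp [hG.symm y hy w v]; ring

lemma nonneg (hG : IsMetricOn G U) {y : E} (hy : y ∈ U) (v : E) : 0 ≤ G y v v := by
  rcases eq_or_ne v 0 with rfl | h
  · simp
  · exact (hG.pos y hy v h).le

lemma contDiffAt_lowerSpray (hG : IsMetricOn G U) {y : E} (hy : y ∈ U) (u : E) :
    ContDiffAt ℝ 1 (fun p : E × E ↦ lowerSpray G p.1 p.2) (y, u) := by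
  have hD : ContDiffAt ℝ 1 (fun p : E × E ↦ fderiv ℝ G p.1) (y, u) :=
    ContDiffAt.comp (y, u) (g := fderiv ℝ G) (f := Prod.fst)
      ((hG.contDiffAt hy).fderiv_right (m := 1) (by norm_num)) contDiffAt_fst
  have hu : ContDiffAt ℝ 1 (fun p : E × E ↦ p.2) (y, u) := contDiffAt_snd
  have hflip : ContDiffAt ℝ 1
      (fun p : E × E ↦ ((fderiv ℝ G p.1).flip p.2)) (y, u) :=
    ((ContinuousLinearMap.flipₗᵢ ℝ E E (E →L[ℝ] ℝ)).contDiff.contDiffAt.comp _ hD).clm_apply hu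
  have hflip2 : ContDiffAt ℝ 1
      (fun p : E × E ↦ (((fderiv ℝ G p.1).flip p.2).flip p.2)) (y, u) :=
    ((ContinuousLinearMap.flipₗᵢ ℝ E E ℝ).contDiff.contDiffAt.comp _ hflip).clm_apply hu
  exact ((hD.clm_apply hu).clm_apply hu).sub (hflip2.const_smul _)

lemma spray_zero (y : E) : spray G (y, 0) = 0 := by
  simpa using spray_smul G y 0 0

variable [FiniteDimensional ℝ E]

/-- Positive definiteness gives injectivity, and E and its dual have the same finite dimension. -/
lemma isInvertible (hG : IsMetricOn G U) {y : E} (hy : y ∈ U) : (G y).IsInvertible := by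
  have hinj : Function.Injective ((G y : E →L[ℝ] E →L[ℝ] ℝ) : E →ₗ[ℝ] (E →L[ℝ] ℝ)) := by
    rw [injective_iff_map_eq_zero]
    intro v hv
    by_contra h
    have h1 := hG.pos y hy v h
    have h2 : G y v = 0 := hv
    simp [h2] at h1
  have hdim : Module.finrank ℝ E = Module.finrank ℝ (E →L[ℝ] ℝ) := by
    rw [← (LinearMap.toContinuousLinearMap (𝕜 := ℝ) (E := E) (F' := ℝ)).finrank_eq]
    exact (Subspace.dual_finrank_eq (K := ℝ) (V := E)).symm
  refine ⟨(LinearEquiv.ofInjectiveOfFinrankEq _ hinj hdim).toContinuousLinearEquiv, ?_⟩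
  ext v w
  rfl

lemma apply_spray (hG : IsMetricOn G U) {y : E} (hy : y ∈ U) (u : E) :
    G y (spray G (y, u)) = -lowerSpray G y u := by
  have := (hG.isInvertible hy).self_comp_inverse
  have h2 := congrArg (fun L ↦ L (lowerSpray G y u)) this
  simp only [ContinuousLinearMap.comp_apply, ContinuousLinearMap.id_apply] at h2
  simp [spray, h2]

/-- Nondegeneracy lets the weak form of the geodesic equation be solved for the acceleration. -/
lemma eq_spray_iff (hG : IsMetricOn G U) {y : E} (hy : y ∈ U) (u a : E) :
    (∀ w, G y a w + lowerSpray G y u w = 0) ↔ a = spray G (y, u) := by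
  constructor
  · intro h
    by_contra hne
    have h1 := hG.pos y hy _ (sub_ne_zero.2 hne)
    have h2 : G y (a - spray G (y, u)) = 0 := by
      ext w
      simp only [map_sub, hG.apply_spray hy]
      have := h w
      simpa using this
    simp [h2] at h1
  · rintro rfl w
    simp [hG.apply_spray hy]

lemma contDiffAt_spray (hG : IsMetricOn G U) {y : E} (hy : y ∈ U) (u : E) :
    ContDiffAt ℝ 1 (spray G) (y, u) := by
  have h1 : ContDiffAt ℝ 1 (fun p : E × E ↦ (G p.1).inverse) (y, u) := by
    have : ContDiffAt ℝ 1 (fun z ↦ (G z).inverse) y :=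
      ContDiffAt.comp y ((hG.isInvertible hy).contDiffAt_map_inverse)
        ((hG.contDiffAt hy).of_le (by norm_num))
    exact ContDiffAt.comp (y, u) (g := fun z ↦ (G z).inverse) (f := Prod.fst) this contDiffAt_fst
  exact (h1.clm_apply (hG.contDiffAt_lowerSpray hy u)).neg

/-- The spray is zero along the zero section and quadratic in the velocity, so both partial
derivatives vanish at (y, 0). Consequently its Lipschitz constant is as small as desired near (y,
0), which is what the contraction for the boundary value problem needs. -/
lemma hasStrictFDerivAt_spray (hG : IsMetricOn G U) {y : E} (hy : y ∈ U) :
    HasStrictFDerivAt (spray G) (0 : E × E →L[ℝ] E) (y, 0) := by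
  have h := (hG.contDiffAt_spray hy 0).hasStrictFDerivAt one_ne_zero
  have hL := h.hasFDerivAt
  set L := fderiv ℝ (spray G) (y, 0)
  have key : L = 0 := by
    have e1 : ∀ v, L (v, 0) = 0 := by
      intro v
      have hc : HasDerivAt (fun t : ℝ ↦ ((y + t • v, 0) : E × E)) (v, 0) 0 := by
        refine HasDerivAt.prodMk ?_ (hasDerivAt_const _ _)
        simpa using ((hasDerivAt_id (0 : ℝ)).smul_const v).const_add y
      have hL' : HasFDerivAt (spray G) L ((fun t : ℝ ↦ ((y + t • v, 0) : E × E)) 0) := by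
        simpa using hL
      have := hL'.comp_hasDerivAt (0 : ℝ) hc
      have h0 : (spray G ∘ fun t : ℝ ↦ ((y + t • v, 0) : E × E)) = fun _ ↦ 0 := by
        ext t; simp [spray_zero]
      rw [h0] at this
      exact this.unique (hasDerivAt_const _ _)
    have e2 : ∀ w, L (0, w) = 0 := by
      intro w
      have hc : HasDerivAt (fun t : ℝ ↦ ((y, t • w) : E × E)) (0, w) 0 := by
        refine HasDerivAt.prodMk (hasDerivAt_const _ _) ?_
        simpa using ((hasDerivAt_id (0 : ℝ)).smul_const w)
      have hL' : HasFDerivAt (spray G) L ((fun t : ℝ ↦ ((y, t • w) : E × E)) 0) := by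
        simpa using hL
      have := hL'.comp_hasDerivAt (0 : ℝ) hc
      have h0 : (spray G ∘ fun t : ℝ ↦ ((y, t • w) : E × E)) = fun t ↦ t ^ 2 • spray G (y, w) := by
        ext t; simp [spray_smul]
      rw [h0] at this
      have h3 : HasDerivAt (fun t : ℝ ↦ t ^ 2 • spray G (y, w)) 0 0 := by
        simpa using (hasDerivAt_pow 2 (0 : ℝ)).smul_const (spray G (y, w))
      exact this.unique h3
    ext p
    · simpa using e1 _
    · simpa using e2 _
  rwa [key] at h

end IsMetricOn

end Flat

/-! ### Two-point boundary value problem by contraction -/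

section BoundaryValue

variable {E : Type*} [NormedAddCommGroup E] [NormedSpace ℝ E] [CompleteSpace E]

/-- The solution `c` of `c'' = w`, `c 0 = x`, `c 1 = x + v`, together with its derivative
(`.2`). -/
def greenCurve (x v : E) (w : C(Icc (0 : ℝ) 1, E)) (t : ℝ) : E × E :=
  let W : ℝ → E := fun t ↦ w (projIcc 0 1 zero_le_one t)
  let P : ℝ → E := fun t ↦ ∫ s in (0 : ℝ)..t, W s
  let Q : ℝ → E := fun t ↦ ∫ s in (0 : ℝ)..t, P s
  (x + t • v + Q t - t • Q 1, v + P t - Q 1)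

set_option linter.unusedSectionVars false

variable (x v : E) (w w' : C(Icc (0 : ℝ) 1, E))

lemma continuous_extend : Continuous fun t ↦ w (projIcc 0 1 zero_le_one t) :=
  w.continuous.comp continuous_projIcc

lemma hasDerivAt_primitive {f : ℝ → E} (hf : Continuous f) (t : ℝ) :
    HasDerivAt (fun t ↦ ∫ s in (0 : ℝ)..t, f s) (f t) t :=
  intervalIntegral.integral_hasDerivAt_right (hf.intervalIntegrable _ _)
    hf.stronglyMeasurable.stronglyMeasurableAtFilter hf.continuousAt

lemma continuous_primitive {f : ℝ → E} (hf : Continuous f) :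
    Continuous fun t ↦ ∫ s in (0 : ℝ)..t, f s :=
  continuous_iff_continuousAt.2 fun t ↦ (hasDerivAt_primitive hf t).continuousAt

lemma hasDerivAt_greenCurve_fst (t : ℝ) :
    HasDerivAt (fun t ↦ (greenCurve x v w t).1) (greenCurve x v w t).2 t := by
  have h1 := hasDerivAt_primitive (continuous_primitive (continuous_extend w)) t
  have h2 : HasDerivAt (fun t : ℝ ↦ t • v) v t := by
    simpa using (hasDerivAt_id t).smul_const v
  have h3 : ∀ z : E, HasDerivAt (fun t : ℝ ↦ t • z) z t := fun z ↦ by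
    simpa using (hasDerivAt_id t).smul_const z
  exact ((h2.const_add x).add h1).sub (h3 _)

lemma hasDerivAt_greenCurve_snd (t : ℝ) :
    HasDerivAt (fun t ↦ (greenCurve x v w t).2) (w (projIcc 0 1 zero_le_one t)) t :=
  ((hasDerivAt_primitive (continuous_extend w) t).const_add v).sub_const _

lemma greenCurve_zero : (greenCurve x v w 0).1 = x := by simp [greenCurve]

lemma greenCurve_one : (greenCurve x v w 1).1 = x + v := by simp [greenCurve]

lemma continuous_greenCurve : Continuous (greenCurve x v w) :=
  continuous_iff_continuousAt.2 fun t ↦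
    (hasDerivAt_greenCurve_fst x v w t).continuousAt.prodMk
      (hasDerivAt_greenCurve_snd x v w t).continuousAt

/-- Each integration over a part of [0, 1] does not increase the sup norm, and position and velocity
each contain two such integrals; hence the factor 2. -/
lemma norm_greenCurve_sub_le {t : ℝ} (ht : t ∈ Icc (0 : ℝ) 1) :
    ‖greenCurve x v w t - greenCurve x v w' t‖ ≤ 2 * ‖w - w'‖ := by
  set D := ‖w - w'‖
  have hW : ∀ s : ℝ, ‖w (projIcc 0 1 zero_le_one s) - w' (projIcc 0 1 zero_le_one s)‖ ≤ D :=
    fun s ↦ (w - w').norm_coe_le_norm _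
  have hint : ∀ {f g : ℝ → E}, Continuous f → Continuous g →
      (∀ s ∈ Icc (0 : ℝ) 1, ‖f s - g s‖ ≤ D) → ∀ t ∈ Icc (0 : ℝ) 1,
      ‖(∫ s in (0 : ℝ)..t, f s) - ∫ s in (0 : ℝ)..t, g s‖ ≤ D := by
    intro f g hf hg h t ht
    rw [← intervalIntegral.integral_sub (hf.intervalIntegrable _ _) (hg.intervalIntegrable _ _)]
    refine (intervalIntegral.norm_integral_le_of_norm_le_const (C := D) fun s hs ↦ ?_).trans ?_
    · rw [uIoc_of_le ht.1] at hs
      exact h s ⟨hs.1.le, hs.2.trans ht.2⟩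
    · rw [sub_zero, abs_of_nonneg ht.1]
      exact mul_le_of_le_one_right (norm_nonneg _) ht.2
  have hP := hint (continuous_extend w) (continuous_extend w') (fun s _ ↦ hW s)
  have hQ := hint (continuous_primitive (continuous_extend w))
    (continuous_primitive (continuous_extend w')) hP
  have h1 : (1 : ℝ) ∈ Icc (0 : ℝ) 1 := by simp
  have hD : 0 ≤ D := norm_nonneg _
  set P : ℝ → E := fun t ↦ ∫ s in (0 : ℝ)..t, w (projIcc 0 1 zero_le_one s)
  set P' : ℝ → E := fun t ↦ ∫ s in (0 : ℝ)..t, w' (projIcc 0 1 zero_le_one s)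
  set Q : ℝ → E := fun t ↦ ∫ s in (0 : ℝ)..t, P s
  set Q' : ℝ → E := fun t ↦ ∫ s in (0 : ℝ)..t, P' s
  have hQ1 : ‖Q 1 - Q' 1‖ ≤ D := hQ 1 (by simp)
  rw [Prod.norm_def, max_le_iff]
  constructor
  · have e : (greenCurve x v w t - greenCurve x v w' t).1 = (Q t - Q' t) - t • (Q 1 - Q' 1) := by
      change (x + t • v + Q t - t • Q 1) - (x + t • v + Q' t - t • Q' 1) = _
      module
    rw [e]
    refine (norm_sub_le _ _).trans ?_
    rw [norm_smul, Real.norm_eq_abs, abs_of_nonneg ht.1]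
    nlinarith [hQ t ht, ht.1, ht.2]
  · have e : (greenCurve x v w t - greenCurve x v w' t).2 = (P t - P' t) - (Q 1 - Q' 1) := by
      change (v + P t - Q 1) - (v + P' t - Q' 1) = _
      module
    rw [e]
    refine (norm_sub_le _ _).trans ?_
    linarith [hP t ht]

/-- Solvability of the boundary value problem `c'' = B (c, c')`, `c 0 = x`, `c 1 = y` for
nearby points. -/
theorem exists_boundary_value_solution {B : E × E → E} {x : E}
    (hB : HasStrictFDerivAt B (0 : E × E →L[ℝ] E) (x, 0)) (h0 : B (x, 0) = 0) :
    ∀ᶠ y in 𝓝 x, ∃ c c₁ c₂ : ℝ → E, (∀ t, HasDerivAt c (c₁ t) t) ∧ (∀ t, HasDerivAt c₁ (c₂ t) t) ∧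
      c 0 = x ∧ c 1 = y ∧ ∀ t ∈ Icc (0 : ℝ) 1, c₂ t = B (c t, c₁ t) ∧
        ‖c t - x‖ ≤ 2 * ‖y - x‖ ∧ ‖c₁ t‖ ≤ 2 * ‖y - x‖ := by
  -- With constant 1/8, w ↦ B(c, c') contracts by 2 · 1/8 = 1/4, and its values have norm at most
  -- 1/8 · 2‖v‖ ≤ ‖v‖/2.
  obtain ⟨s, hs, hL⟩ := hB.exists_lipschitzOnWith_of_nnnorm_lt (1 / 8) (by simp)
  obtain ⟨r, hr, hrs⟩ := Metric.nhds_basis_closedBall.mem_iff.1 hs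
  have hnear : ∀ᶠ y in 𝓝 x, ‖y - x‖ < r / 2 := by
    filter_upwards [Metric.ball_mem_nhds x (half_pos hr)] with y hy
    rwa [mem_ball_iff_norm] at hy
  filter_upwards [hnear] with y hy
  set v := y - x
  -- For accelerations of norm at most ‖v‖/2 the curve and its velocity stay within ‖v‖ + 2 · ‖v‖/2
  -- = 2‖v‖ < r of (x, 0).
  let K : Set C(Icc (0 : ℝ) 1, E) := Metric.closedBall 0 (‖v‖ / 2)
  have hbase : ∀ t ∈ Icc (0 : ℝ) 1, ‖greenCurve x v 0 t - (x, 0)‖ ≤ ‖v‖ := by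
    intro t ht
    have : greenCurve x v 0 t - (x, 0) = (t • v, v) := by simp [greenCurve]
    rw [this, Prod.norm_def, max_le_iff]
    refine ⟨?_, le_rfl⟩
    rw [norm_smul, Real.norm_eq_abs, abs_of_nonneg ht.1]
    exact mul_le_of_le_one_left (norm_nonneg _) ht.2
  have hest : ∀ w ∈ K, ∀ t ∈ Icc (0 : ℝ) 1, ‖greenCurve x v w t - (x, 0)‖ ≤ 2 * ‖v‖ := by
    intro w hw t ht
    have h1 := norm_greenCurve_sub_le x v w 0 ht
    have h2 : ‖w‖ ≤ ‖v‖ / 2 := by simpa [K] using hw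
    rw [sub_zero] at h1
    have h3 := norm_sub_le_norm_sub_add_norm_sub (greenCurve x v w t) (greenCurve x v 0 t) (x, 0)
    linarith [hbase t ht]
  have hmem : ∀ w ∈ K, ∀ t ∈ Icc (0 : ℝ) 1, greenCurve x v w t ∈ s := by
    intro w hw t ht
    apply hrs
    rw [mem_closedBall_iff_norm]
    linarith [hest w hw t ht]
  have hx : ((x, 0) : E × E) ∈ s := hrs (by simp [hr.le])
  let T : K → K := fun w ↦ ⟨⟨fun t ↦ B (greenCurve x v w.1 t), by
      rw [← continuousOn_univ]
      exact hL.continuousOn.comp ((continuous_greenCurve x v w.1).comp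
        continuous_subtype_val).continuousOn fun t _ ↦ hmem w.1 w.2 t t.2⟩, by
    simp only [K, mem_closedBall_zero_iff]
    refine (ContinuousMap.norm_le _ (by positivity)).2 fun t ↦ ?_
    have h1 := hL.norm_sub_le (hmem w.1 w.2 t t.2) hx
    rw [h0, sub_zero] at h1
    have h2 := hest w.1 w.2 t t.2
    simp only [ContinuousMap.coe_mk]
    refine h1.trans ?_
    norm_num
    linarith [norm_nonneg v]⟩
  have hT : ContractingWith (1 / 4) T := by
    refine ⟨by norm_num, LipschitzWith.of_dist_le_mul fun w w' ↦ ?_⟩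
    rw [Subtype.dist_eq, Subtype.dist_eq]
    refine (ContinuousMap.dist_le (by positivity)).2 fun t ↦ ?_
    have h1 := hL.norm_sub_le (hmem w.1 w.2 t t.2) (hmem w'.1 w'.2 t t.2)
    have h2 := norm_greenCurve_sub_le x v w.1 w'.1 t.2
    rw [dist_eq_norm, dist_eq_norm]
    refine h1.trans ?_
    norm_num
    linarith
  have : Nonempty K := ⟨⟨0, by simp [K]; positivity⟩⟩
  have : CompleteSpace K := Metric.isClosed_closedBall.completeSpace_coe
  set w := ContractingWith.fixedPoint T hT
  have hw : T w = w := hT.fixedPoint_isFixedPt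
  refine ⟨fun t ↦ (greenCurve x v w.1 t).1, fun t ↦ (greenCurve x v w.1 t).2, _,
    hasDerivAt_greenCurve_fst x v w.1, hasDerivAt_greenCurve_snd x v w.1,
    greenCurve_zero x v w.1, ?_, fun t ht ↦ ⟨?_, ?_, ?_⟩⟩
  · simp [greenCurve_one, v]
  · have : w.1 (projIcc 0 1 zero_le_one t) = (T w).1 (projIcc 0 1 zero_le_one t) := by rw [hw]
    rw [this]
    simp [T, projIcc_of_mem _ ht]
  · exact (norm_fst_le (greenCurve x v w.1 t - (x, 0))).trans (hest w.1 w.2 t ht)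
  · simpa using (norm_snd_le (greenCurve x v w.1 t - (x, 0))).trans (hest w.1 w.2 t ht)

end BoundaryValue

/-! ### Uniform bounds for the metric and the energy density -/

section Energy

variable {E : Type*} [NormedAddCommGroup E] [NormedSpace ℝ E]

/-- Uniform bounds for the metric `G` on the set `V`: a lower bound, a Lipschitz bound and a second
order Taylor bound. -/
structure HasMetricBounds (G : E → E →L[ℝ] E →L[ℝ] ℝ) (V : Set E) (l M : ℝ) : Prop where
  lower : ∀ y ∈ V, ∀ v, l * ‖v‖ ^ 2 ≤ G y v v
  lipschitz : ∀ y ∈ V, ∀ z ∈ V, ∀ v w, |G z v w - G y v w| ≤ M * ‖z - y‖ * ‖v‖ * ‖w‖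
  taylor : ∀ y ∈ V, ∀ z ∈ V, ∀ v,
    |G z v v - G y v v - fderiv ℝ G y (z - y) v v| ≤ M * ‖z - y‖ ^ 2 * ‖v‖ ^ 2

lemma abs_apply_apply_le (T : E →L[ℝ] E →L[ℝ] ℝ) (v w : E) : |T v w| ≤ ‖T‖ * ‖v‖ * ‖w‖ :=
  T.le_opNorm₂ v w

/-- The quadratic form attains a positive minimum on the compact unit sphere; homogeneity does the
rest. -/
lemma IsMetricOn.exists_lower_bound [FiniteDimensional ℝ E] {G : E → E →L[ℝ] E →L[ℝ] ℝ} {U : Set E}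
    (hG : IsMetricOn G U) {x : E} (hx : x ∈ U) : ∃ m > 0, ∀ v, m * ‖v‖ ^ 2 ≤ G x v v := by
  rcases subsingleton_or_nontrivial E with hE | hE
  · exact ⟨1, one_pos, fun v ↦ by simp [Subsingleton.elim v 0]⟩
  obtain ⟨v₀, hv₀, hmin⟩ := (isCompact_sphere (0 : E) 1).exists_isMinOn
    (NormedSpace.sphere_nonempty.2 zero_le_one) (f := fun v ↦ G x v v) (by fun_prop)
  have h0 : v₀ ≠ 0 := by
    rintro rfl
    simp at hv₀
  refine ⟨G x v₀ v₀, hG.pos x hx v₀ h0, fun v ↦ ?_⟩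
  rcases eq_or_ne v 0 with rfl | hv
  · simp
  have h1 := hmin (a := ‖v‖⁻¹ • v) (by simp [norm_smul, hv])
  have hn : 0 < ‖v‖ := norm_pos_iff.2 hv
  simp only [map_smul, smul_eq_mul, smul_apply, Set.mem_ofPred_eq] at h1
  calc G x v₀ v₀ * ‖v‖ ^ 2 ≤ (‖v‖⁻¹ * (‖v‖⁻¹ * G x v v)) * ‖v‖ ^ 2 := by gcongr
    _ = G x v v := by field_simp

/-- As G is C², both G and its derivative are locally Lipschitz. The Taylor bound is the mean value
inequality on a segment, with the Lipschitz bound of the derivative. -/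
lemma IsMetricOn.exists_bounds [FiniteDimensional ℝ E] {G : E → E →L[ℝ] E →L[ℝ] ℝ} {U : Set E}
    (hG : IsMetricOn G U) {x : E} (hx : x ∈ U) :
    ∃ R > 0, ∃ l > 0, ∃ M ≥ 0, Metric.ball x R ⊆ U ∧ HasMetricBounds G (Metric.ball x R) l M := by
  obtain ⟨m, hm, hlow⟩ := hG.exists_lower_bound hx
  obtain ⟨K₁, s₁, hs₁, hL₁⟩ :=
    (((hG.contDiffAt hx).of_le (by norm_num : (1 : WithTop ℕ∞) ≤ 2)).hasStrictFDerivAt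
      one_ne_zero).exists_lipschitzOnWith
  obtain ⟨K₂, s₂, hs₂, hL₂⟩ :=
    (((hG.contDiffAt hx).fderiv_right (m := 1) (by norm_num)).hasStrictFDerivAt
      one_ne_zero).exists_lipschitzOnWith
  obtain ⟨r, hr, hrs⟩ := Metric.nhds_basis_ball.mem_iff.1
    (inter_mem (inter_mem hs₁ hs₂) (hG.isOpen.mem_nhds hx))
  set M : ℝ := max K₁ K₂
  have hM : 0 ≤ M := le_max_of_le_left K₁.2
  -- On this ball G changes by at most M R ≤ m/2, so half of the lower bound at x survives. The
  -- summand 1 avoids division by zero.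
  set R := min r (m / 2 / (M + 1))
  have hR : 0 < R := lt_min hr (by positivity)
  have hsub : Metric.ball x R ⊆ (s₁ ∩ s₂) ∩ U := (Metric.ball_subset_ball (min_le_left _ _)).trans
      hrs
  have hlip : ∀ y ∈ Metric.ball x R, ∀ z ∈ Metric.ball x R, ∀ v w,
      |G z v w - G y v w| ≤ M * ‖z - y‖ * ‖v‖ * ‖w‖ := by
    intro y hy z hz v w
    have h1 := hL₁.norm_sub_le (hsub hz).1.1 (hsub hy).1.1
    have h2 := abs_apply_apply_le (G z - G y) v w
    simp only [sub_apply] at h2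
    refine h2.trans ?_
    gcongr
    exact h1.trans (by gcongr; exact le_max_left _ _)
  refine ⟨R, hR, m / 2, by positivity, M, hM, fun y hy ↦ (hsub hy).2, ⟨?_, hlip, ?_⟩⟩
  · intro y hy v
    have h1 := hlip x (Metric.mem_ball_self hR) y hy v v
    have h2 : ‖y - x‖ ≤ m / 2 / (M + 1) := by
      rw [Metric.mem_ball, dist_eq_norm] at hy
      exact hy.le.trans (min_le_right _ _)
    have h3 : M * ‖y - x‖ ≤ m / 2 := by
      calc M * ‖y - x‖ ≤ (M + 1) * (m / 2 / (M + 1)) := by gcongr; linarith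
        _ = m / 2 := by field_simp
    have h4 : M * ‖y - x‖ * ‖v‖ * ‖v‖ ≤ m / 2 * ‖v‖ ^ 2 := by
      rw [mul_assoc, ← sq]
      gcongr
    have h5 := neg_abs_le (G y v v - G x v v)
    linarith [hlow v]
  · intro y hy z hz v
    have hseg : segment ℝ y z ⊆ Metric.ball x R := (convex_ball x R).segment_subset hy hz
    have h1 : ‖G z - G y - fderiv ℝ G y (z - y)‖ ≤ M * ‖z - y‖ * ‖z - y‖ := by
      refine (convex_segment y z).norm_image_sub_le_of_norm_hasFDerivWithin_le'
        (f' := fderiv ℝ G)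
        (fun w hw ↦ (hG.differentiableAt (hsub (hseg hw)).2).hasFDerivAt.hasFDerivWithinAt)
        (fun w hw ↦ ?_) (left_mem_segment ℝ y z) (right_mem_segment ℝ y z)
      have h2 := hL₂.norm_sub_le (hsub (hseg hw)).1.2 (hsub hy).1.2
      refine h2.trans ?_
      have h3 : ‖w - y‖ ≤ ‖z - y‖ := by
        rw [← dist_eq_norm, ← dist_eq_norm]
        obtain ⟨a, b, ha, hb, hab, rfl⟩ := hw
        rw [dist_eq_norm, dist_eq_norm]
        have : a • y + b • z - y = b • (z - y) := by
          rw [← eq_sub_iff_add_eq] at hab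
          rw [hab]; module
        rw [this, norm_smul, Real.norm_eq_abs, abs_of_nonneg hb]
        exact mul_le_of_le_one_left (norm_nonneg _) (by linarith)
      gcongr
      exact le_max_right _ _
    have h2 := abs_apply_apply_le (G z - G y - fderiv ℝ G y (z - y)) v v
    simp only [sub_apply] at h2
    refine h2.trans ?_
    calc _ ≤ M * ‖z - y‖ * ‖z - y‖ * ‖v‖ * ‖v‖ := by gcongr
      _ = _ := by ring

/-- The pointwise estimate behind the convexity of the energy near a short geodesic. -/
lemma HasMetricBounds.energy_density_ge {G : E → E →L[ℝ] E →L[ℝ] ℝ} {U V : Set E} {l M : ℝ}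
    (hG : IsMetricOn G U) (hVU : V ⊆ U) (hV : HasMetricBounds G V l M) (hl : 0 ≤ l) (hM : 0 ≤ M)
    {y z u e : E} {k A d : ℝ} (hy : y ∈ V) (hz : z ∈ V) (hk : 0 < k) (hA : ‖z - y‖ ≤ A)
    (hd : ‖u‖ ≤ d) :
    k * fderiv ℝ G y (z - y) u u + 2 * G y u e + l * (2 * A * ‖e‖ - A ^ 2 * k)
      - M * A ^ 2 * d ^ 2 * k - 2 * M * A * d * ‖e‖ + k * G y u u
      ≤ G z (k • u + e) (k • u + e) / k := by
  have hA0 : 0 ≤ A := (norm_nonneg _).trans hA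
  have hd0 : 0 ≤ d := (norm_nonneg _).trans hd
  have e1 : G z (k • u + e) (k • u + e) / k = k * G z u u + 2 * G z u e + G z e e / k := by
    rw [hG.add_sq (hVU hz)]
    simp only [map_smul, smul_eq_mul, smul_apply]
    field_simp
  -- Here (‖e‖ - A k)² ≥ 0 replaces the quadratic term by one linear in ‖e‖, whose integral is known
  -- later.
  have e2 : l * (2 * A * ‖e‖ - A ^ 2 * k) ≤ G z e e / k := by
    rw [le_div_iff₀ hk]
    refine le_trans ?_ (hV.lower z hz e)
    nlinarith [mul_nonneg hl (sq_nonneg (‖e‖ - A * k))]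
  have e3 : k * (G z u u - G y u u - fderiv ℝ G y (z - y) u u) ≥ - (M * A ^ 2 * d ^ 2 * k) := by
    have h1 := (abs_le.1 (hV.taylor y hy z hz u)).1
    have h2 : M * ‖z - y‖ ^ 2 * ‖u‖ ^ 2 ≤ M * A ^ 2 * d ^ 2 := by gcongr
    nlinarith
  have e4 : G z u e - G y u e ≥ - (M * A * d * ‖e‖) := by
    have h1 := (abs_le.1 (hV.lipschitz y hy z hz u e)).1
    have h2 : M * ‖z - y‖ * ‖u‖ * ‖e‖ ≤ M * A * d * ‖e‖ := by gcongr
    linarith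
  rw [e1]
  linarith

end Energy

/-! ### Short geodesics minimize energy and length -/

section Minimality

set_option linter.unusedSectionVars false

variable {E : Type*} [NormedAddCommGroup E] [NormedSpace ℝ E] [FiniteDimensional ℝ E]
  {G : E → E →L[ℝ] E →L[ℝ] ℝ} {U V : Set E} {l M d : ℝ}

/-- `c` is a solution of the geodesic equation on `[0, 1]`, with velocity `c₁`. -/
structure IsFlatGeodesic (G : E → E →L[ℝ] E →L[ℝ] ℝ) (c c₁ : ℝ → E) : Prop where
  hasDerivAt : ∀ t ∈ Icc (0 : ℝ) 1, HasDerivAt c (c₁ t) t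
  hasDerivAt_velocity : ∀ t ∈ Icc (0 : ℝ) 1, HasDerivAt c₁ (spray G (c t, c₁ t)) t

lemma IsMetricOn.hasDerivAt_apply (hG : IsMetricOn G U) {f a b : ℝ → E} {f' a' b' : E} {t : ℝ}
    (hf : HasDerivAt f f' t) (ha : HasDerivAt a a' t) (hb : HasDerivAt b b' t) (hU : f t ∈ U) :
    HasDerivAt (fun s ↦ G (f s) (a s) (b s))
      (fderiv ℝ G (f t) f' (a t) (b t) + G (f t) a' (b t) + G (f t) (a t) b') t := by
  have h1 : HasDerivAt (fun s ↦ G (f s)) (fderiv ℝ G (f t) f') t :=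
    (hG.differentiableAt hU).hasFDerivAt.comp_hasDerivAt t hf
  simpa using (h1.clm_apply ha).clm_apply hb

/-- In the derivative of G(c', c'), the term 2 G(c'', c') equals -DG(c')(c', c') by the geodesic
equation and cancels the derivative of the coefficients. -/
lemma IsFlatGeodesic.speed_const {c c₁ : ℝ → E} (hc : IsFlatGeodesic G c c₁)
    (hG : IsMetricOn G U) (hU : ∀ t ∈ Icc (0 : ℝ) 1, c t ∈ U) :
    ∀ t ∈ Icc (0 : ℝ) 1, G (c t) (c₁ t) (c₁ t) = G (c 0) (c₁ 0) (c₁ 0) := by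
  have key : ∀ t ∈ Icc (0 : ℝ) 1, HasDerivAt (fun s ↦ G (c s) (c₁ s) (c₁ s)) 0 t := by
    intro t ht
    have h := hG.hasDerivAt_apply (hc.hasDerivAt t ht) (hc.hasDerivAt_velocity t ht)
      (hc.hasDerivAt_velocity t ht) (hU t ht)
    convert h using 1
    rw [hG.symm _ (hU t ht) (c₁ t), hG.apply_spray (hU t ht)]
    simp [lowerSpray_apply]
    ring
  exact constant_of_has_deriv_right_zero (fun t ht ↦ (key t ht).continuousAt.continuousWithinAt)
    fun t ht ↦ (key t (Ico_subset_Icc_self ht)).hasDerivWithinAt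

/-- A short geodesic minimizes the energy, also with respect to a weight (which corresponds to a
reparametrization of the competitor). -/
theorem IsFlatGeodesic.energy_le {c c₁ : ℝ → E} (hc : IsFlatGeodesic G c c₁)
    (hG : IsMetricOn G U) (hVU : V ⊆ U) (hV : HasMetricBounds G V l M) (hl : 0 ≤ l) (hM : 0 ≤ M)
    (hcV : ∀ t ∈ Icc (0 : ℝ) 1, c t ∈ V) (hd : ∀ t ∈ Icc (0 : ℝ) 1, ‖c₁ t‖ ≤ d)
    (hsmall : M * d ^ 2 + 2 * M * d ≤ l)
    {σ σ₁ : ℝ → E} (hσ : ∀ t ∈ Icc (0 : ℝ) 1, HasDerivAt σ (σ₁ t) t)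
    (hσ₁ : ContinuousOn σ₁ (Icc 0 1)) (hσV : ∀ t ∈ Icc (0 : ℝ) 1, σ t ∈ V)
    (h0 : σ 0 = c 0) (h1 : σ 1 = c 1)
    {h k : ℝ → ℝ} (hh0 : h 0 = 0) (hh1 : h 1 = 1) (hh : MapsTo h (Icc 0 1) (Icc 0 1))
    (hhc : ContinuousOn h (Icc 0 1)) (hk : ∀ t ∈ Ioo (0 : ℝ) 1, HasDerivAt h (k t) t)
    (hkc : ContinuousOn k (Icc 0 1)) (hkpos : ∀ t ∈ Icc (0 : ℝ) 1, 0 < k t) :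
    G (c 0) (c₁ 0) (c₁ 0) ≤ ∫ t in (0 : ℝ)..1, G (σ t) (σ₁ t) (σ₁ t) / k t := by
  set C : ℝ → E := fun t ↦ c (h t)
  set C₁ : ℝ → E := fun t ↦ c₁ (h t)
  set η : ℝ → E := fun t ↦ σ t - C t
  set η₁ : ℝ → E := fun t ↦ σ₁ t - k t • C₁ t
  have hcC : ContinuousOn C (Icc 0 1) :=
    ContinuousOn.comp (g := c) (t := Icc 0 1)
      (fun t ht ↦ (hc.hasDerivAt t ht).continuousAt.continuousWithinAt) hhc hh
  have hcC₁ : ContinuousOn C₁ (Icc 0 1) :=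
    ContinuousOn.comp (g := c₁) (t := Icc 0 1)
      (fun t ht ↦ (hc.hasDerivAt_velocity t ht).continuousAt.continuousWithinAt) hhc hh
  have hσc : ContinuousOn σ (Icc 0 1) := fun t ht ↦ (hσ t ht).continuousAt.continuousWithinAt
  have hηc : ContinuousOn η (Icc 0 1) := hσc.sub hcC
  have hη₁c : ContinuousOn η₁ (Icc 0 1) := hσ₁.sub (hkc.smul hcC₁)
  have hIoo : ∀ t ∈ Ioo (0 : ℝ) 1, t ∈ Icc (0 : ℝ) 1 := fun t ht ↦ Ioo_subset_Icc_self ht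
  have hC : ∀ t ∈ Ioo (0 : ℝ) 1, HasDerivAt C (k t • C₁ t) t := fun t ht ↦
    (hc.hasDerivAt _ (hh (hIoo t ht))).scomp t (hk t ht)
  have hC₁ : ∀ t ∈ Ioo (0 : ℝ) 1, HasDerivAt C₁ (k t • spray G (C t, C₁ t)) t := fun t ht ↦
    (hc.hasDerivAt_velocity _ (hh (hIoo t ht))).scomp t (hk t ht)
  have hη : ∀ t ∈ Ioo (0 : ℝ) 1, HasDerivAt η (η₁ t) t := fun t ht ↦
    (hσ t (hIoo t ht)).sub (hC t ht)
  have hCV : ∀ t ∈ Icc (0 : ℝ) 1, C t ∈ V := fun t ht ↦ hcV _ (hh ht)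
  have hη0 : η 0 = 0 := by simp [η, C, hh0, h0]
  have hη1 : η 1 = 0 := by simp [η, C, hh1, h1]
  have hGc : ∀ {f : ℝ → E}, ContinuousOn f (Icc 0 1) → (∀ t ∈ Icc (0 : ℝ) 1, f t ∈ V) →
      ContinuousOn (fun t ↦ G (f t)) (Icc 0 1) := fun hf hfV ↦
    hG.contDiffOn.continuousOn.comp hf fun t ht ↦ hVU (hfV t ht)
  have hDGc : ContinuousOn (fun t ↦ fderiv ℝ G (C t)) (Icc 0 1) :=
    (hG.contDiffOn.continuousOn_fderiv_of_isOpen hG.isOpen (by norm_num)).comp hcC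
      fun t ht ↦ hVU (hCV t ht)
  have hint : ∀ {f : ℝ → ℝ}, ContinuousOn f (Icc 0 1) →
      IntervalIntegrable f MeasureTheory.volume 0 1 := fun hf ↦
    ContinuousOn.intervalIntegrable (by rwa [uIcc_of_le zero_le_one])
  -- the length of `η`
  set A := ∫ t in (0 : ℝ)..1, ‖η₁ t‖
  have hηA : ∀ t ∈ Icc (0 : ℝ) 1, ‖η t‖ ≤ A := by
    intro t ht
    have e1 : ∫ s in (0 : ℝ)..t, η₁ s = η t - η 0 :=
      intervalIntegral.integral_eq_sub_of_hasDerivAt_of_le ht.1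
        (hηc.mono (Icc_subset_Icc_right ht.2))
        (fun s hs ↦ hη s ⟨hs.1, hs.2.trans_le ht.2⟩)
        (ContinuousOn.intervalIntegrable
          (by rw [uIcc_of_le ht.1]; exact hη₁c.mono (Icc_subset_Icc_right ht.2)))
    rw [hη0, sub_zero] at e1
    rw [← e1]
    refine (intervalIntegral.norm_integral_le_integral_norm ht.1).trans ?_
    exact intervalIntegral.integral_mono_interval le_rfl ht.1 ht.2
      (Eventually.of_forall fun s ↦ norm_nonneg _) (hint hη₁c.norm)
  -- the first variation
  set F : ℝ → ℝ := fun t ↦ k t * fderiv ℝ G (C t) (η t) (C₁ t) (C₁ t) + 2 * G (C t) (C₁ t) (η₁ t)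
  have hFc : ContinuousOn F (Icc 0 1) :=
    (hkc.mul (((hDGc.clm_apply hηc).clm_apply hcC₁).clm_apply hcC₁)).add
      ((((hGc hcC hCV).clm_apply hcC₁).clm_apply hη₁c).const_smul (2 : ℝ))
  -- By the geodesic equation F is the derivative of 2 G(C)(C₁, η), and η vanishes at both ends.
  have hF : ∫ t in (0 : ℝ)..1, F t = 0 := by
    have e : ∫ t in (0 : ℝ)..1, F t
        = 2 * G (C 1) (C₁ 1) (η 1) - 2 * G (C 0) (C₁ 0) (η 0) := by
      refine intervalIntegral.integral_eq_sub_of_hasDerivAt_of_le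
        (f := fun t ↦ 2 * G (C t) (C₁ t) (η t)) zero_le_one
        ((((hGc hcC hCV).clm_apply hcC₁).clm_apply hηc).const_smul (2 : ℝ)) (fun t ht ↦ ?_) (hint
            hFc)
      have hU := hVU (hCV t (hIoo t ht))
      have := (hG.hasDerivAt_apply (hC t ht) (hC₁ t ht) (hη t ht) hU).const_mul 2
      refine this.congr_deriv ?_
      simp only [F, map_smul, smul_apply, smul_eq_mul, hG.apply_spray hU, neg_apply,
        lowerSpray_apply]
      ring
    rw [e, hη0, hη1]
    simp
  have hk1 : ∫ t in (0 : ℝ)..1, k t = 1 := by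
    rw [intervalIntegral.integral_eq_sub_of_hasDerivAt_of_le zero_le_one hhc hk (hint hkc), hh0,
        hh1,
      sub_zero]
  have hspeed := hc.speed_const hG fun t ht ↦ hVU (hcV t ht)
  set E₀ := G (c 0) (c₁ 0) (c₁ 0)
  -- The pointwise lower bound of `energy_density_ge`. As ‖η₁‖ integrates to A and k to 1, its
  -- integral is E₀ + A² (l - M d² - 2 M d), and the bracket is nonnegative by `hsmall`.
  set L : ℝ → ℝ := fun t ↦ F t + ((2 * l * A - 2 * M * A * d) * ‖η₁ t‖
    + (E₀ - l * A ^ 2 - M * A ^ 2 * d ^ 2) * k t)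
  have hLc : ContinuousOn L (Icc 0 1) :=
    hFc.add ((hη₁c.norm.const_smul (2 * l * A - 2 * M * A * d)).add (hkc.const_smul (E₀ - l * A ^ 2
        - M * A ^ 2 * d ^ 2)))
  have hLint : ∫ t in (0 : ℝ)..1, L t = E₀ + A ^ 2 * (l - (M * d ^ 2 + 2 * M * d)) := by
    have i1 : IntervalIntegrable (fun t ↦ (2 * l * A - 2 * M * A * d) * ‖η₁ t‖)
        MeasureTheory.volume 0 1 := hint (hη₁c.norm.const_smul (2 * l * A - 2 * M * A * d))
    have i2 : IntervalIntegrable (fun t ↦ (E₀ - l * A ^ 2 - M * A ^ 2 * d ^ 2) * k t)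
        MeasureTheory.volume 0 1 := hint (hkc.const_smul (E₀ - l * A ^ 2 - M * A ^ 2 * d ^ 2))
    simp only [L]
    rw [intervalIntegral.integral_add (hint hFc) (i1.add i2), intervalIntegral.integral_add i1 i2,
      intervalIntegral.integral_const_mul, intervalIntegral.integral_const_mul, hF, hk1]
    change 0 + ((2 * l * A - 2 * M * A * d) * A + _) = _
    ring
  have hRc : ContinuousOn (fun t ↦ G (σ t) (σ₁ t) (σ₁ t) / k t) (Icc 0 1) :=
    (((hGc hσc hσV).clm_apply hσ₁).clm_apply hσ₁).div hkc fun t ht ↦ (hkpos t ht).ne'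
  have hmain : ∫ t in (0 : ℝ)..1, L t ≤ ∫ t in (0 : ℝ)..1, G (σ t) (σ₁ t) (σ₁ t) / k t := by
    refine intervalIntegral.integral_mono_on zero_le_one (hint hLc) (hint hRc) fun t ht ↦ ?_
    have h2 := hV.energy_density_ge hG hVU hl hM (hCV t ht) (hσV t ht) (hkpos t ht) (hηA t ht)
      (hd _ (hh ht)) (e := η₁ t) (u := C₁ t)
    have e2 : k t • C₁ t + η₁ t = σ₁ t := by simp [η₁]
    rw [e2, hspeed _ (hh ht)] at h2
    simp only [L, F]
    change k t * fderiv ℝ G (C t) (σ t - C t) (C₁ t) (C₁ t) + _ + _ ≤ _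
    linarith
  rw [hLint] at hmain
  nlinarith [mul_nonneg (sq_nonneg A) (sub_nonneg.2 hsmall)]

/-- A short geodesic minimizes the length. -/
theorem IsFlatGeodesic.length_le {c c₁ : ℝ → E} (hc : IsFlatGeodesic G c c₁)
    (hG : IsMetricOn G U) (hVU : V ⊆ U) (hV : HasMetricBounds G V l M) (hl : 0 ≤ l) (hM : 0 ≤ M)
    (hcV : ∀ t ∈ Icc (0 : ℝ) 1, c t ∈ V) (hd : ∀ t ∈ Icc (0 : ℝ) 1, ‖c₁ t‖ ≤ d)
    (hsmall : M * d ^ 2 + 2 * M * d ≤ l)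
    {σ σ₁ : ℝ → E} (hσ : ∀ t ∈ Icc (0 : ℝ) 1, HasDerivAt σ (σ₁ t) t)
    (hσ₁ : ContinuousOn σ₁ (Icc 0 1)) (hσV : ∀ t ∈ Icc (0 : ℝ) 1, σ t ∈ V)
    (h0 : σ 0 = c 0) (h1 : σ 1 = c 1) :
    √(G (c 0) (c₁ 0) (c₁ 0)) ≤ ∫ t in (0 : ℝ)..1, √(G (σ t) (σ₁ t) (σ₁ t)) := by
  set f : ℝ → ℝ := fun t ↦ √(G (σ t) (σ₁ t) (σ₁ t))
  have hσc : ContinuousOn σ (Icc 0 1) := fun t ht ↦ (hσ t ht).continuousAt.continuousWithinAt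
  have hfc : ContinuousOn f (Icc 0 1) :=
    (((hG.contDiffOn.continuousOn.comp hσc fun t ht ↦ hVU (hσV t ht)).clm_apply hσ₁).clm_apply
      hσ₁).sqrt
  have hint : ∀ {f : ℝ → ℝ}, ContinuousOn f (Icc 0 1) →
      ∀ t ∈ Icc (0 : ℝ) 1, IntervalIntegrable f MeasureTheory.volume 0 t := fun hf t ht ↦
    ContinuousOn.intervalIntegrable
      (by rw [uIcc_of_le ht.1]; exact hf.mono (Icc_subset_Icc_right ht.2))
  have hone : (1 : ℝ) ∈ Icc (0 : ℝ) 1 := by simp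
  set L := ∫ t in (0 : ℝ)..1, f t
  have hL : 0 ≤ L := intervalIntegral.integral_nonneg zero_le_one fun t _ ↦ Real.sqrt_nonneg _
  have key : ∀ ε > 0, G (c 0) (c₁ 0) (c₁ 0) ≤ (L + ε) * (L + ε) := by
    intro ε hε
    -- This weight makes the energy comparable to the squared length: f²/k ≤ (L + ε) f integrates to
    -- (L + ε) L. The ε keeps the weight positive where the competitor stands still.
    set k : ℝ → ℝ := fun t ↦ (f t + ε) / (L + ε)
    have hkc : ContinuousOn k (Icc 0 1) := (hfc.add continuousOn_const).div_const _
    have hkpos : ∀ t, 0 < k t := fun t ↦ div_pos (by positivity) (by positivity)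
    set h : ℝ → ℝ := fun t ↦ ∫ s in (0 : ℝ)..t, k s
    have hh1 : h 1 = 1 := by
      simp only [h, k]
      rw [intervalIntegral.integral_div, intervalIntegral.integral_add (hint hfc 1 hone)
        (intervalIntegrable_const)]
      simp only [intervalIntegral.integral_const, sub_zero, smul_eq_mul, one_mul]
      exact div_self (by positivity)
    have hh : MapsTo h (Icc 0 1) (Icc 0 1) := by
      intro t ht
      refine ⟨intervalIntegral.integral_nonneg ht.1 fun s _ ↦ (hkpos s).le, ?_⟩
      rw [← hh1]
      exact intervalIntegral.integral_mono_interval le_rfl ht.1 ht.2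
        (Eventually.of_forall fun s ↦ (hkpos s).le) (hint hkc 1 hone)
    have hhc : ContinuousOn h (Icc 0 1) := by
      have := intervalIntegral.continuousOn_primitive_interval (μ := MeasureTheory.volume)
        (f := k) (a := 0) (b := 1) ?_
      · rwa [uIcc_of_le zero_le_one] at this
      · rw [uIcc_of_le zero_le_one]
        exact hkc.integrableOn_Icc
    have hk : ∀ t ∈ Ioo (0 : ℝ) 1, HasDerivAt h (k t) t := by
      intro t ht
      have hmem : Icc (0 : ℝ) 1 ∈ 𝓝 t := Icc_mem_nhds ht.1 ht.2
      exact intervalIntegral.integral_hasDerivAt_right (hint hkc t (Ioo_subset_Icc_self ht))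
        (hkc.stronglyMeasurableAtFilter_nhdsWithin measurableSet_Icc t |>.filter_mono
          (nhdsWithin_eq_nhds.2 hmem).ge) (hkc.continuousAt hmem)
    have hen := hc.energy_le hG hVU hV hl hM hcV hd hsmall hσ hσ₁ hσV h0 h1
      (by simp [h]) hh1 hh hhc hk hkc fun t _ ↦ hkpos t
    refine hen.trans ?_
    have e : ∫ t in (0 : ℝ)..1, (L + ε) * f t = (L + ε) * L := intervalIntegral.integral_const_mul
        _ _
    have hle : ∫ t in (0 : ℝ)..1, G (σ t) (σ₁ t) (σ₁ t) / k t ≤ ∫ t in (0 : ℝ)..1, (L + ε) * f t :=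
        by
      refine intervalIntegral.integral_mono_on zero_le_one
        (hint ?_ 1 hone) (hint (hfc.const_smul (L + ε)) 1 hone) fun t ht ↦ ?_
      · exact (((hG.contDiffOn.continuousOn.comp hσc fun t ht ↦ hVU (hσV t ht)).clm_apply
          hσ₁).clm_apply hσ₁).div hkc fun t _ ↦ (hkpos t).ne'
      · have hsq : f t ^ 2 = G (σ t) (σ₁ t) (σ₁ t) := Real.sq_sqrt (hG.nonneg (hVU (hσV t ht)) _)
        have hf0 : 0 ≤ f t := Real.sqrt_nonneg _
        rw [← hsq, div_le_iff₀ (hkpos t)]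
        have : (L + ε) * f t * k t = f t * (f t + ε) := by
          simp only [k]
          field_simp
        rw [this]
        nlinarith
    rw [e] at hle
    refine hle.trans ?_
    gcongr
    linarith
  refine le_of_forall_pos_le_add fun ε hε ↦ ?_
  rw [Real.sqrt_le_iff]
  exact ⟨by positivity, by rw [sq]; exact key ε hε⟩

/-- Near a point, all points are joined to it by short geodesics which minimize the length among
the curves in a fixed ball. -/
theorem IsMetricOn.exists_minimizing_geodesic {x : E} (hG : IsMetricOn G U) (hx : x ∈ U) :
    ∃ R > 0, Metric.ball x R ⊆ U ∧ ∀ ε > 0, ∀ᶠ y in 𝓝 x, ∃ c c₁ : ℝ → E, IsFlatGeodesic G c c₁ ∧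
      c 0 = x ∧ c 1 = y ∧ (∀ t ∈ Icc (0 : ℝ) 1, c t ∈ Metric.ball x R) ∧
      √(G x (c₁ 0) (c₁ 0)) < ε ∧
      ∀ σ σ₁ : ℝ → E, (∀ t ∈ Icc (0 : ℝ) 1, HasDerivAt σ (σ₁ t) t) → ContinuousOn σ₁ (Icc 0 1) →
        (∀ t ∈ Icc (0 : ℝ) 1, σ t ∈ Metric.ball x R) → σ 0 = x → σ 1 = y →
        √(G x (c₁ 0) (c₁ 0)) ≤ ∫ t in (0 : ℝ)..1, √(G (σ t) (σ₁ t) (σ₁ t)) := by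
  obtain ⟨R, hR, l, hl, M, hM, hRU, hV⟩ := hG.exists_bounds hx
  refine ⟨R, hR, hRU, fun ε hε ↦ ?_⟩
  have hcont : ∀ f : E → ℝ, Continuous f → ∀ b, f x < b → ∀ᶠ y in 𝓝 x, f y < b :=
    fun f hf b hb ↦ hf.continuousAt.eventually_lt continuousAt_const hb
  filter_upwards [exists_boundary_value_solution (hG.hasStrictFDerivAt_spray hx)
      (IsMetricOn.spray_zero x),
    hcont (fun y ↦ 2 * ‖y - x‖) (by fun_prop) R (by simpa),
    hcont (fun y ↦ M * (2 * ‖y - x‖) ^ 2 + 2 * M * (2 * ‖y - x‖)) (by fun_prop) l (by simpa),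
    hcont (fun y ↦ √(‖G x‖ * (2 * ‖y - x‖) * (2 * ‖y - x‖))) (by fun_prop) ε (by simpa)]
    with y ⟨c, c₁, c₂, hc, hc₁, h0, h1, h⟩ hyR hyl hyε
  have hgeo : IsFlatGeodesic G c c₁ := ⟨fun t _ ↦ hc t, fun t ht ↦ (h t ht).1 ▸ hc₁ t⟩
  have hcV : ∀ t ∈ Icc (0 : ℝ) 1, c t ∈ Metric.ball x R := fun t ht ↦ by
    rw [mem_ball_iff_norm]
    exact (h t ht).2.1.trans_lt hyR
  refine ⟨c, c₁, hgeo, h0, h1, hcV, ?_, fun σ σ₁ hσ hσ₁ hσV hσ0 hσ1 ↦ ?_⟩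
  · refine (Real.sqrt_le_sqrt ?_).trans_lt hyε
    have h2 := (h 0 (by simp)).2.2
    refine (le_abs_self _).trans ((abs_apply_apply_le _ _ _).trans ?_)
    gcongr
  · have := hgeo.length_le hG hRU hV hl.le hM hcV (fun t ht ↦ (h t ht).2.2) hyl.le hσ hσ₁ hσV
      (hσ0.trans h0.symm) (hσ1.trans h1.symm)
    rwa [h0] at this

/-- The error M‖y - x‖‖v‖² is absorbed by the lower bound at x. This controls distances near x by
the metric frozen at x. -/
lemma IsMetricOn.eventually_apply_le {x : E} (hG : IsMetricOn G U) (hx : x ∈ U) {b : ℝ}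
    (hb : 1 < b) : ∀ᶠ y in 𝓝 x, ∀ v, G y v v ≤ b * G x v v := by
  obtain ⟨R, hR, l, hl, M, hM, hRU, hV⟩ := hG.exists_bounds hx
  have h1 : ∀ᶠ y in 𝓝 x, M * ‖y - x‖ < (b - 1) * l :=
    ContinuousAt.eventually_lt (by fun_prop) continuousAt_const
      (by simpa using mul_pos (sub_pos.2 hb) hl)
  filter_upwards [Metric.ball_mem_nhds x hR, h1] with y hy h1 v
  have h2 := (abs_le.1 (hV.lipschitz x (Metric.mem_ball_self hR) y hy v v)).2
  have h3 := hV.lower x (Metric.mem_ball_self hR) v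
  nlinarith [mul_le_mul_of_nonneg_right h1.le (sq_nonneg ‖v‖),
    mul_le_mul_of_nonneg_left h3 (sub_pos.2 hb).le]

lemma IsMetricOn.eventually_le_apply {x : E} (hG : IsMetricOn G U) (hx : x ∈ U) :
    ∃ l > 0, ∀ᶠ y in 𝓝 x, ∀ v, l * ‖v‖ ^ 2 ≤ G y v v := by
  obtain ⟨R, hR, l, hl, M, hM, hRU, hV⟩ := hG.exists_bounds hx
  exact ⟨l, hl, by filter_upwards [Metric.ball_mem_nhds x hR] with y hy using hV.lower y hy⟩

/-- Strict convexity of the unit ball of an inner product. -/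
lemma IsMetricOn.eq_of_two_le {x u v : E} (hG : IsMetricOn G U) (hx : x ∈ U) (hu : G x u u = 1)
    (hv : G x v v = 1) (h : 4 ≤ G x (u + v) (u + v)) : u = v := by
  by_contra hne
  have h1 := hG.pos x hx _ (sub_ne_zero.2 hne)
  rw [hG.add_sq hx] at h
  -- Parallelogram law: G(u - v, u - v) = 4 - G(u + v, u + v) ≤ 0.
  have h2 := hG.add_sq hx u (-v)
  rw [← sub_eq_add_neg] at h2
  simp only [map_neg, neg_apply, neg_neg] at h2
  linarith

end Minimality

/-! ### Transformation of the spray under a change of coordinates -/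

section ChangeOfVariables

variable {E : Type*} [NormedAddCommGroup E] [NormedSpace ℝ E] [FiniteDimensional ℝ E]

/-- The transformation law of the geodesic spray. -/
lemma spray_transform {G₀ G₁ : E → E →L[ℝ] E →L[ℝ] ℝ} {U₀ U₁ : Set E} (h₀ : IsMetricOn G₀ U₀)
    (h₁ : IsMetricOn G₁ U₁) {ψ : E → E} {y : E} (hy : y ∈ U₀) (hψy : ψ y ∈ U₁)
    (hψ : ContDiffAt ℝ 2 ψ y) (hsurj : Function.Surjective (fderiv ℝ ψ y))
    (hG : ∀ᶠ z in 𝓝 y, ∀ v w, G₀ z v w = G₁ (ψ z) (fderiv ℝ ψ z v) (fderiv ℝ ψ z w)) (u : E) :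
    spray G₁ (ψ y, fderiv ℝ ψ y u)
      = fderiv ℝ ψ y (spray G₀ (y, u)) + fderiv ℝ (fderiv ℝ ψ) y u u := by
  have hdψ : HasFDerivAt ψ (fderiv ℝ ψ y) y := (hψ.differentiableAt (by norm_num)).hasFDerivAt
  have hd2ψ : HasFDerivAt (fderiv ℝ ψ) (fderiv ℝ (fderiv ℝ ψ) y) y :=
    ((hψ.fderiv_right (m := 1) (by norm_num)).differentiableAt (by norm_num)).hasFDerivAt
  have hsymm : ∀ v w, fderiv ℝ (fderiv ℝ ψ) y v w = fderiv ℝ (fderiv ℝ ψ) y w v := fun v w ↦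
    (hψ.isSymmSndFDerivAt (by simp)) v w
  -- The pullback relation G₀ = ψ*G₁ is differentiated along the line y + t a.
  have key : ∀ a v w, fderiv ℝ G₀ y a v w
      = fderiv ℝ G₁ (ψ y) (fderiv ℝ ψ y a) (fderiv ℝ ψ y v) (fderiv ℝ ψ y w)
        + G₁ (ψ y) (fderiv ℝ (fderiv ℝ ψ) y a v) (fderiv ℝ ψ y w)
        + G₁ (ψ y) (fderiv ℝ ψ y v) (fderiv ℝ (fderiv ℝ ψ) y a w) := by
    intro a v w
    set f : ℝ → E := fun t ↦ y + t • a
    have f0 : f 0 = y := by simp [f]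
    have hf : HasDerivAt f a 0 :=
      (((hasDerivAt_id (0 : ℝ)).smul_const a).const_add y).congr_deriv (one_smul _ _)
    have e1 := h₀.hasDerivAt_apply hf (hasDerivAt_const (0 : ℝ) v) (hasDerivAt_const (0 : ℝ) w)
      (by rwa [f0])
    have hψf : HasDerivAt (fun t ↦ ψ (f t)) (fderiv ℝ ψ y a) 0 := by
      refine HasFDerivAt.comp_hasDerivAt (f := f) 0 ?_ hf
      rwa [f0]
    have hDf : ∀ v, HasDerivAt (fun t ↦ fderiv ℝ ψ (f t) v) (fderiv ℝ (fderiv ℝ ψ) y a v) 0 := by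
      intro v
      have : HasDerivAt (fun t ↦ fderiv ℝ ψ (f t)) (fderiv ℝ (fderiv ℝ ψ) y a) 0 := by
        refine HasFDerivAt.comp_hasDerivAt (f := f) 0 ?_ hf
        rwa [f0]
      simpa using this.clm_apply (hasDerivAt_const (0 : ℝ) v)
    have e2 := h₁.hasDerivAt_apply hψf (hDf v) (hDf w) (by simpa only [f0] using hψy)
    have e3 := e2.congr_of_eventuallyEq (f₁ := fun t ↦ G₀ (f t) v w) (by
      have : Tendsto f (𝓝 0) (𝓝 y) := by simpa only [f0] using hf.continuousAt.tendsto
      filter_upwards [this.eventually hG] with t ht using ht v w)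
    have := e1.unique e3
    simpa [f0] using this
  symm
  rw [← h₁.eq_spray_iff hψy]
  intro w'
  obtain ⟨w, rfl⟩ := hsurj w'
  have e1 := (h₀.eq_spray_iff hy u _).2 rfl w
  rw [lowerSpray_apply] at e1 ⊢
  -- The terms with D²ψ(u, w) cancel by the symmetry of second derivatives; only G₁(D²ψ(u, u), Dψ w)
  -- is left.
  rw [key u u w, key w u u, hG.self_of_nhds, hsymm w u,
    h₁.symm _ hψy (fderiv ℝ (fderiv ℝ ψ) y u w) (fderiv ℝ ψ y u)] at e1
  rw [map_add, add_apply]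
  linarith

end ChangeOfVariables

/-! ### The Riemannian metric in charts -/

section Charts

set_option linter.unusedSectionVars false

variable {E : Type*} [NormedAddCommGroup E] [NormedSpace ℝ E] [FiniteDimensional ℝ E]
  {S : Type*} [TopologicalSpace S] 
  [ChartedSpace E S] 
  [RiemannianBundle (fun x : S ↦ TangentSpace 𝓘(ℝ, E) x)]

variable (E) in
/-- The metric in the chart around `x₀` -/
def chartMetric (x₀ : S) (y : E) : E →L[ℝ] E →L[ℝ] ℝ :=
  LinearMap.toContinuousBilinearMap
    (E := E) (F := E) (G := ℝ) (𝕜 := ℝ)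
    ((riemMetric E S ((extChartAt 𝓘(ℝ, E) x₀).symm y)).compl₁₂
      (mfderiv 𝓘(ℝ, E) 𝓘(ℝ, E) (extChartAt 𝓘(ℝ, E) x₀).symm y).toLinearMap
      (mfderiv 𝓘(ℝ, E) 𝓘(ℝ, E) (extChartAt 𝓘(ℝ, E) x₀).symm y).toLinearMap)

lemma chartMetric_apply (x₀ : S) (y v w : E) :
    chartMetric E x₀ y v w = coordMetric (riemMetric E S) x₀ y v w := rfl

variable [IsManifold 𝓘(ℝ, E) ∞ S] [IsContMDiffRiemannianBundle 𝓘(ℝ, E) ∞ E (fun x : S ↦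
    TangentSpace 𝓘(ℝ, E) x)]

/-- The tangent map of the inverse chart, applied to constant vector fields, gives C² sections along
the inverse chart, and inner products of C² sections are C². -/
lemma contDiffOn_coordMetric (x₀ : S) (v w : E) : ContDiffOn ℝ 2 
  (fun y ↦ coordMetric (riemMetric E S) x₀ y v w) (extChartAt 𝓘(ℝ, E) x₀).target := by
  rw [← contMDiffOn_iff_contDiffOn]
  have hφ : ContMDiffOn 𝓘(ℝ, E) 𝓘(ℝ, E) ∞ (extChartAt 𝓘(ℝ, E) x₀).symm (extChartAt 𝓘(ℝ, E)
      x₀).target := contMDiffOn_extChartAt_symm x₀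
  have hsec : ∀ v : E, ContMDiffOn 𝓘(ℝ, E) (𝓘(ℝ, E).prod 𝓘(ℝ, E)) 2 
     (fun y : E ↦ (⟨(extChartAt 𝓘(ℝ, E) x₀).symm y, mfderiv 𝓘(ℝ, E) 𝓘(ℝ, E) (extChartAt 𝓘(ℝ, E)
         x₀).symm y v⟩ : TangentBundle 𝓘(ℝ, E) S))
     (extChartAt 𝓘(ℝ, E) x₀).target := by
    intro v
    have h1 := hφ.contMDiffOn_tangentMapWithin (m := 2) (by norm_num; exact ENat.LEInfty.out)
      (isOpen_extChartAt_target x₀).uniqueMDiffOn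
    have h2 : ContMDiff 𝓘(ℝ, E) (𝓘(ℝ, E).prod 𝓘(ℝ, E)) 2
        (fun y : E ↦ (⟨y, v⟩ : TangentBundle 𝓘(ℝ, E) E)) :=
      contMDiff_vectorSpace_iff_contDiff (V := fun _ ↦ v) |>.2 contDiff_const
    refine (h1.comp h2.contMDiffOn (fun y hy ↦ hy)).congr fun y hy ↦ ?_
    simp only [Function.comp, tangentMapWithin]
    rw [mfderivWithin_of_isOpen (isOpen_extChartAt_target x₀) hy]
  exact ContMDiffOn.inner_bundle (F := E) (E := fun x : S ↦ TangentSpace 𝓘(ℝ, E) x)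
    (b := (extChartAt 𝓘(ℝ, E) x₀).symm) (IB := 𝓘(ℝ, E)) (hsec v) (hsec w)

lemma isMetricOn_chartMetric (x₀ : S) :
    IsMetricOn (chartMetric E x₀) (extChartAt 𝓘(ℝ, E) x₀).target where
  isOpen := isOpen_extChartAt_target x₀
  contDiffOn := by
    rw [contDiffOn_clm_apply]
    intro v
    rw [contDiffOn_clm_apply]
    exact contDiffOn_coordMetric x₀ v
  symm y _ v w := by
    simp only [chartMetric_apply, coordMetric, riemMetric]
    exact real_inner_comm (F := TangentSpace 𝓘(ℝ, E) ((extChartAt 𝓘(ℝ, E) x₀).symm y)) _ _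
  pos y hy v hv := by
    simp only [chartMetric_apply, coordMetric, riemMetric]
    have h := isInvertible_mfderivWithin_extChartAt_symm (I := 𝓘(ℝ, E)) hy
    rw [modelWithCornersSelf_coe, range_id, mfderivWithin_univ] at h
    have hne : mfderiv 𝓘(ℝ, E) 𝓘(ℝ, E) (extChartAt 𝓘(ℝ, E) x₀).symm y v ≠ 0 := by
      obtain ⟨e, he⟩ := h
      rw [← he]
      exact fun h0 ↦ hv (e.map_eq_zero_iff.1 h0)
    exact real_inner_self_pos.2 hne

lemma chartMetric_eq (x₀ : S) (y v w : E) : chartMetric E x₀ y v w =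
    riemMetric E S ((extChartAt 𝓘(ℝ, E) x₀).symm y)
      (mfderiv 𝓘(ℝ, E) 𝓘(ℝ, E) (extChartAt 𝓘(ℝ, E) x₀).symm y v)
      (mfderiv 𝓘(ℝ, E) 𝓘(ℝ, E) (extChartAt 𝓘(ℝ, E) x₀).symm y w) := rfl

lemma contMDiffAt_extChartAt_symm (x₀ : S) {y : E} (hy : y ∈ (extChartAt 𝓘(ℝ, E) x₀).target) :
    ContMDiffAt 𝓘(ℝ, E) 𝓘(ℝ, E) ∞ (extChartAt 𝓘(ℝ, E) x₀).symm y :=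
  (contMDiffOn_extChartAt_symm x₀).contMDiffAt ((isOpen_extChartAt_target x₀).mem_nhds hy)

/-- The change of charts. -/
def transition (x₀ x₁ : S) (y : E) : E := extChartAt 𝓘(ℝ, E) x₁ ((extChartAt 𝓘(ℝ, E) x₀).symm y)

variable {x₀ x₁ : S} {y : E} 

lemma contDiffAt_transition (hy : y ∈ (extChartAt 𝓘(ℝ, E) x₀).target)
    (hy' : (extChartAt 𝓘(ℝ, E) x₀).symm y ∈ (chartAt E x₁).source) :
    ContDiffAt ℝ ∞ (transition x₀ x₁ : E → E) y := by
  rw [← contMDiffAt_iff_contDiffAt]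
  exact (contMDiffAt_extChartAt' hy').comp y (contMDiffAt_extChartAt_symm x₀ hy)

lemma eventually_mem_chart (hy : y ∈ (extChartAt 𝓘(ℝ, E) x₀).target)
    (hy' : (extChartAt 𝓘(ℝ, E) x₀).symm y ∈ (chartAt E x₁).source) :
    ∀ᶠ z in 𝓝 y, z ∈ (extChartAt 𝓘(ℝ, E) x₀).target ∧
      (extChartAt 𝓘(ℝ, E) x₀).symm z ∈ (chartAt E x₁).source :=
  ((isOpen_extChartAt_target x₀).eventually_mem hy).and
    ((contMDiffAt_extChartAt_symm x₀ hy).continuousAt.eventually_mem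
      ((chartAt E x₁).open_source.mem_nhds hy'))

/-- Both sides are pullbacks of the metric of S at one point; near y the inverse chart at x₀ is the
inverse chart at x₁ after the transition map, so the chain rule applies. -/
lemma chartMetric_transition (hy : y ∈ (extChartAt 𝓘(ℝ, E) x₀).target)
    (hy' : (extChartAt 𝓘(ℝ, E) x₀).symm y ∈ (chartAt E x₁).source) (v w : E) :
    chartMetric E x₀ y v w = chartMetric E x₁ (transition x₀ x₁ y)
      (fderiv ℝ (transition x₀ x₁) y v) (fderiv ℝ (transition x₀ x₁) y w) := by
  have hsrc : (extChartAt 𝓘(ℝ, E) x₀).symm y ∈ (extChartAt 𝓘(ℝ, E) x₁).source := by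
    rwa [extChartAt_source]
  have hp : (extChartAt 𝓘(ℝ, E) x₁).symm (transition x₀ x₁ y)
      = (extChartAt 𝓘(ℝ, E) x₀).symm y := (extChartAt 𝓘(ℝ, E) x₁).left_inv hsrc
  have hT : transition x₀ x₁ y ∈ (extChartAt 𝓘(ℝ, E) x₁).target :=
    (extChartAt 𝓘(ℝ, E) x₁).map_source hsrc
  have hD : ∀ v : E, (mfderiv 𝓘(ℝ, E) 𝓘(ℝ, E) (extChartAt 𝓘(ℝ, E) x₀).symm y v : E)
      = mfderiv 𝓘(ℝ, E) 𝓘(ℝ, E) (extChartAt 𝓘(ℝ, E) x₁).symm (transition x₀ x₁ y)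
        (fderiv ℝ (E := E) (F := E) (transition x₀ x₁) y v) := by
    intro v
    have h1 : HasMFDerivAt 𝓘(ℝ, E) 𝓘(ℝ, E) (transition x₀ x₁ : E → E) y
        (fderiv ℝ (E := E) (F := E) (transition x₀ x₁) y) :=
      ((contDiffAt_transition hy hy').differentiableAt (by simp)).hasFDerivAt.hasMFDerivAt
    have h2 := ((contMDiffAt_extChartAt_symm x₁ hT).mdifferentiableAt (by simp)).hasMFDerivAt
    have h3 := h2.comp y h1
    have h4 : (extChartAt 𝓘(ℝ, E) x₀).symm =ᶠ[𝓝 y]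
        (extChartAt 𝓘(ℝ, E) x₁).symm ∘ transition x₀ x₁ := by
      filter_upwards [eventually_mem_chart hy hy'] with z hz
      exact ((extChartAt 𝓘(ℝ, E) x₁).left_inv (by rw [extChartAt_source]; exact hz.2)).symm
    have h5 := (h3.congr_of_eventuallyEq h4).mfderiv
    exact congrArg (fun L : E →L[ℝ] E ↦ L v) h5
  rw [chartMetric_eq, chartMetric_eq]
  have aux : ∀ p q : S, p = q → ∀ a b : E, riemMetric E S p a b = riemMetric E S q a b := by
    rintro p _ rfl a b
    rfl
  have e1 := hD v
  have e2 := hD w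
  exact (congrArg₂ (fun a b : E ↦ riemMetric E S ((extChartAt 𝓘(ℝ, E) x₀).symm y) a b) e1 e2).trans
    (aux _ _ hp.symm _ _)

/-- A vector in the kernel would have length zero for a positive definite metric; injectivity gives
surjectivity in finite dimension. -/
lemma surjective_fderiv_transition (hy : y ∈ (extChartAt 𝓘(ℝ, E) x₀).target)
    (hy' : (extChartAt 𝓘(ℝ, E) x₀).symm y ∈ (chartAt E x₁).source) :
    Function.Surjective (fderiv ℝ (transition x₀ x₁ : E → E) y) := by
  refine LinearMap.surjective_of_injective (f := (fderiv ℝ (transition x₀ x₁ : E → E)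
      y).toLinearMap)
    ?_
  rw [injective_iff_map_eq_zero]
  intro v hv
  by_contra hne
  have h1 := (isMetricOn_chartMetric x₀).pos y hy v hne
  have h2 : fderiv ℝ (transition x₀ x₁ : E → E) y v = 0 := hv
  rw [chartMetric_transition hy hy', h2] at h1
  simp at h1

end Charts

/-! ### Geodesics as local solutions of a first order system -/

section Curves

variable {E : Type*} [NormedAddCommGroup E] [NormedSpace ℝ E]

lemma uniqueDiffOn_of_ordConnected {J : Set ℝ} (hJ : J.OrdConnected) (hn : J.Nontrivial) :
    UniqueDiffOn ℝ J := by
  obtain ⟨a, ha, b, hb, hab⟩ := hn.exists_lt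
  refine uniqueDiffOn_convex hJ.convex ⟨(a + b) / 2, ?_⟩
  rw [mem_interior_iff_mem_nhds]
  exact mem_of_superset (Icc_mem_nhds (by linarith) (by linarith)) (hJ.out ha hb)

lemma contDiffOn_two_of_hasDerivWithinAt {c c₁ c₂ : ℝ → E} {J : Set ℝ} (hJ : UniqueDiffOn ℝ J)
    (h : ∀ t ∈ J, HasDerivWithinAt c (c₁ t) J t) (h₁ : ∀ t ∈ J, HasDerivWithinAt c₁ (c₂ t) J t)
    (h₂ : ContinuousOn c₂ J) : ContDiffOn ℝ 2 c J := by
  have e1 : EqOn (derivWithin c J) c₁ J := fun t ht ↦ (h t ht).derivWithin (hJ t ht)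
  have e2 : EqOn (derivWithin c₁ J) c₂ J := fun t ht ↦ (h₁ t ht).derivWithin (hJ t ht)
  have hc₁ : ContDiffOn ℝ 1 c₁ J := by
    rw [contDiffOn_one_iff_derivWithin hJ]
    exact ⟨fun t ht ↦ (h₁ t ht).differentiableWithinAt, h₂.congr e2⟩
  rw [show (2 : WithTop ℕ∞) = 1 + 1 by norm_num, contDiffOn_succ_iff_derivWithin hJ]
  exact ⟨fun t ht ↦ (h t ht).differentiableWithinAt, by simp, hc₁.congr e1⟩

variable [FiniteDimensional ℝ E]
  {S : Type*} [TopologicalSpace S] [ChartedSpace E S]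
  [RiemannianBundle (fun x : S ↦ TangentSpace 𝓘(ℝ, E) x)]

set_option linter.unusedSectionVars false

variable (E) in
/-- Near `s`, the curve `γ : J → S` solves, in the chart around `x₀`, the first order system
`c' = c₁`, `c₁' = spray (c, c₁)`, with constant squared speed `k`. -/
def IsSprayCurveAt (k : ℝ) (x₀ : S) (γ : ℝ → S) (J : Set ℝ) (s : ℝ) : Prop :=
  ∃ c₁ : ℝ → E, ∀ᶠ τ in 𝓝[J] s, γ τ ∈ (chartAt E x₀).source ∧
    HasDerivWithinAt (fun τ ↦ extChartAt 𝓘(ℝ, E) x₀ (γ τ)) (c₁ τ) J τ ∧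
    HasDerivWithinAt c₁ (spray (chartMetric E x₀) (extChartAt 𝓘(ℝ, E) x₀ (γ τ), c₁ τ)) J τ ∧
    chartMetric E x₀ (extChartAt 𝓘(ℝ, E) x₀ (γ τ)) (c₁ τ) (c₁ τ) = k

variable [IsManifold 𝓘(ℝ, E) ∞ S]
  [IsContMDiffRiemannianBundle 𝓘(ℝ, E) ∞ E (fun x : S ↦ TangentSpace 𝓘(ℝ, E) x)]
  {γ : ℝ → S} {J : Set ℝ} {s k : ℝ} {x₀ x₁ : S}

lemma extChartAt_mem_target {p : S} (hp : p ∈ (chartAt E x₀).source) :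
    extChartAt 𝓘(ℝ, E) x₀ p ∈ (extChartAt 𝓘(ℝ, E) x₀).target :=
  (extChartAt 𝓘(ℝ, E) x₀).map_source (by rwa [extChartAt_source])

lemma extChartAt_symm_apply {p : S} (hp : p ∈ (chartAt E x₀).source) :
    (extChartAt 𝓘(ℝ, E) x₀).symm (extChartAt 𝓘(ℝ, E) x₀ p) = p :=
  (extChartAt 𝓘(ℝ, E) x₀).left_inv (by rwa [extChartAt_source])

lemma transition_extChartAt {p : S} (hp : p ∈ (chartAt E x₀).source) :
    transition x₀ x₁ (extChartAt 𝓘(ℝ, E) x₀ p) = extChartAt 𝓘(ℝ, E) x₁ p := by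
  rw [transition, extChartAt_symm_apply hp]

lemma IsSprayCurveAt.continuousWithinAt (h : IsSprayCurveAt E k x₀ γ J s) (hs : s ∈ J) :
    ContinuousWithinAt γ J s := by
  obtain ⟨c₁, h⟩ := h
  obtain ⟨h1, h2, -⟩ := h.self_of_nhdsWithin hs
  have h3 := (contMDiffAt_extChartAt_symm x₀ (extChartAt_mem_target h1)).continuousAt
  refine (ContinuousAt.comp_continuousWithinAt (f := fun τ ↦ extChartAt 𝓘(ℝ, E) x₀ (γ τ)) h3
    h2.continuousWithinAt).congr_of_eventuallyEq ?_ (extChartAt_symm_apply h1).symm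
  filter_upwards [h] with τ hτ
  exact (extChartAt_symm_apply hτ.1).symm

lemma IsSprayCurveAt.congr {γ' : ℝ → S} {J' : Set ℝ} (h : IsSprayCurveAt E k x₀ γ J s)
    (hJ : 𝓝[J'] s ≤ 𝓝[J] s) (hJ' : J' ⊆ J) (hγ : EqOn γ' γ J') : IsSprayCurveAt E k x₀ γ' J' s := by
  obtain ⟨c₁, h⟩ := h
  refine ⟨c₁, ?_⟩
  filter_upwards [h.filter_mono hJ, self_mem_nhdsWithin] with τ ⟨h1, h2, h3, h4⟩ hτ
  rw [hγ hτ]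
  refine ⟨h1, (h2.mono hJ').congr (fun t ht ↦ ?_) ?_, h3.mono hJ', h4⟩
  · rw [hγ ht]
  · rw [hγ hτ]

lemma IsSprayCurveAt.mono {J' : Set ℝ} (h : IsSprayCurveAt E k x₀ γ J s) (hJ' : J' ⊆ J) :
    IsSprayCurveAt E k x₀ γ J' s :=
  h.congr (nhdsWithin_mono _ hJ') hJ' fun _ _ ↦ rfl

/-- Being a spray curve is a local property. -/
lemma IsSprayCurveAt.of_inter {V : Set ℝ} (hV : IsOpen V) (hs : s ∈ V)
    (h : IsSprayCurveAt E k x₀ γ (J ∩ V) s) : IsSprayCurveAt E k x₀ γ J s := by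
  obtain ⟨c₁, h⟩ := h
  refine ⟨c₁, ?_⟩
  rw [nhdsWithin_inter_of_mem' (mem_nhdsWithin_of_mem_nhds (hV.mem_nhds hs))] at h
  filter_upwards [h, mem_nhdsWithin_of_mem_nhds (hV.mem_nhds hs)] with τ ⟨h1, h2, h3, h4⟩ hτ
  have := hV.mem_nhds hτ
  exact ⟨h1, (hasDerivWithinAt_inter this).1 h2, (hasDerivWithinAt_inter this).1 h3, h4⟩

/-- The geodesic equation does not depend on the chart. -/
lemma IsSprayCurveAt.change_chart (h : IsSprayCurveAt E k x₀ γ J s) (hs : s ∈ J)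
    (hx₁ : γ s ∈ (chartAt E x₁).source) : IsSprayCurveAt E k x₁ γ J s := by
  have hcont := h.continuousWithinAt hs
  obtain ⟨c₁, h⟩ := h
  refine ⟨fun τ ↦ fderiv ℝ (transition x₀ x₁) (extChartAt 𝓘(ℝ, E) x₀ (γ τ)) (c₁ τ), ?_⟩
  filter_upwards [eventually_eventually_nhdsWithin.2 h, h,
    hcont.eventually_mem ((chartAt E x₁).open_source.mem_nhds hx₁), self_mem_nhdsWithin]
    with τ h' ⟨h1, h2, h3, h4⟩ hτ₁ hτJ
  set y := extChartAt 𝓘(ℝ, E) x₀ (γ τ)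
  have hy : y ∈ (extChartAt 𝓘(ℝ, E) x₀).target := extChartAt_mem_target h1
  have hy' : (extChartAt 𝓘(ℝ, E) x₀).symm y ∈ (chartAt E x₁).source := by
    rwa [extChartAt_symm_apply h1]
  have hψ : ContDiffAt ℝ 2 (transition x₀ x₁ : E → E) y :=
    (contDiffAt_transition hy hy').of_le (by exact ENat.LEInfty.out)
  have hd : HasFDerivAt (transition x₀ x₁ : E → E) (fderiv ℝ (transition x₀ x₁ : E → E) y) y :=
    (hψ.differentiableAt (by norm_num)).hasFDerivAt
  have hd2 : HasFDerivAt (fderiv ℝ (transition x₀ x₁ : E → E))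
      (fderiv ℝ (fderiv ℝ (transition x₀ x₁ : E → E)) y) y :=
    ((hψ.fderiv_right (m := 1) (by norm_num)).differentiableAt (by norm_num)).hasFDerivAt
  refine ⟨hτ₁, ?_, ?_, ?_⟩
  · refine (hd.comp_hasDerivWithinAt τ h2).congr_of_eventuallyEq ?_ (transition_extChartAt h1).symm
    filter_upwards [h'] with t ht
    exact (transition_extChartAt ht.1).symm
  -- The product rule for Dψ(c) c₁ yields exactly the two terms of the transformation law of the
  -- spray.
  · have e := spray_transform (isMetricOn_chartMetric x₀) (isMetricOn_chartMetric x₁) hy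
      (by rw [transition_extChartAt h1]; exact extChartAt_mem_target hτ₁) hψ
      (surjective_fderiv_transition hy hy')
      (by filter_upwards [eventually_mem_chart hy hy'] with z hz using
        chartMetric_transition hz.1 hz.2) (c₁ τ)
    rw [transition_extChartAt h1] at e
    rw [e, add_comm]
    exact (hd2.comp_hasDerivWithinAt τ h2).clm_apply h3
  · rw [← h4, chartMetric_transition hy hy', transition_extChartAt h1]

lemma christoffel_eq_lowerSpray {y : E} (hy : y ∈ (extChartAt 𝓘(ℝ, E) x₀).target) (u w : E) :
    christoffel (riemMetric E S) x₀ y u u w = lowerSpray (chartMetric E x₀) y u w := by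
  have h : ∀ a v w, fderiv ℝ (fun z ↦ coordMetric (riemMetric E S) x₀ z v w) y a
      = fderiv ℝ (chartMetric E x₀) y a v w := by
    intro a v w
    have hd := ((isMetricOn_chartMetric x₀).differentiableAt hy).hasFDerivAt
    have h1 := ((hd.clm_apply (hasFDerivAt_const v y)).clm_apply (hasFDerivAt_const w y))
    have h2 := congrArg (fun L ↦ L a) h1.fderiv
    simp only [ContinuousLinearMap.flip_apply, add_apply, zero_apply, map_zero, zero_add,
      ContinuousLinearMap.comp_apply] at h2
    refine Eq.trans ?_ (h2.trans (by simp))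
    rfl
  rw [christoffel, h, h, lowerSpray_apply]
  ring

/-- The speed in a chart. -/
lemma sq_norm_velocity {u : E} (hs : UniqueDiffWithinAt ℝ J s) (hsJ : s ∈ J)
    (hsrc : ∀ᶠ τ in 𝓝[J] s, γ τ ∈ (chartAt E x₀).source)
    (hc : HasDerivWithinAt (fun τ ↦ extChartAt 𝓘(ℝ, E) x₀ (γ τ)) u J s) :
    ‖velocity 𝓘(ℝ, E) γ J s‖ ^ 2 = chartMetric E x₀ (extChartAt 𝓘(ℝ, E) x₀ (γ s)) u u := by
  have h1 := hsrc.self_of_nhdsWithin hsJ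
  have h2 := ((contMDiffAt_extChartAt_symm x₀ (extChartAt_mem_target h1)).mdifferentiableAt
    (by simp)).hasMFDerivAt
  have h3 : HasMFDerivWithinAt 𝓘(ℝ, ℝ) 𝓘(ℝ, E) (fun τ ↦ extChartAt 𝓘(ℝ, E) x₀ (γ τ)) J s
    (ContinuousLinearMap.toSpanSingleton ℝ u) := hc.hasFDerivWithinAt.hasMFDerivWithinAt
  have h4 := (h2.comp_hasMFDerivWithinAt s h3).congr_of_eventuallyEq (f₁ := γ)
    (by filter_upwards [hsrc] with τ hτ using (extChartAt_symm_apply hτ).symm)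
    (extChartAt_symm_apply h1).symm
  have h5 := h4.mfderivWithin hs.uniqueMDiffWithinAt
  have h6 : velocity 𝓘(ℝ, E) γ J s = (mfderiv 𝓘(ℝ, E) 𝓘(ℝ, E) (extChartAt 𝓘(ℝ, E) x₀).symm
      (extChartAt 𝓘(ℝ, E) x₀ (γ s)) u : E) := by
    have := DFunLike.congr_fun h5 (1 : ℝ)
    refine this.trans ?_
    change mfderiv 𝓘(ℝ, E) 𝓘(ℝ, E) (extChartAt 𝓘(ℝ, E) x₀).symm
      (extChartAt 𝓘(ℝ, E) x₀ (γ s)) (ContinuousLinearMap.toSpanSingleton ℝ u 1) = _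
    simp
  have aux : ∀ p q : S, p = q → ∀ a : E, riemMetric E S p a a = riemMetric E S q a a := by
    rintro p _ rfl a
    rfl
  rw [chartMetric_eq]
  refine Eq.trans ?_ (aux _ _ (extChartAt_symm_apply h1).symm _)
  rw [h6]
  exact (real_inner_self_eq_norm_sq (F := TangentSpace 𝓘(ℝ, E) (γ s)) _).symm

/-- Positive definiteness solves the tested equation for c''. The speed is carried along because it
later bounds velocities. -/
lemma IsGeodesicOn.isSprayCurveAt (h : IsGeodesicOn (riemMetric E S) γ J)
    (hk : ∀ τ ∈ J, ‖velocity 𝓘(ℝ, E) γ J τ‖ ^ 2 = k) (hs : s ∈ J) (hx₀ : γ s ∈ (chartAt E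
        x₀).source) : IsSprayCurveAt E k x₀ γ J s := by
  have hJ := uniqueDiffOn_of_ordConnected h.ordConnected h.nontrivial
  set c : ℝ → E := fun τ ↦ extChartAt 𝓘(ℝ, E) x₀ (γ τ)
  refine ⟨derivWithin c J, ?_⟩
  filter_upwards [(h.contMDiffOn.continuousOn s hs).eventually_mem
    ((chartAt E x₀).open_source.mem_nhds hx₀), self_mem_nhdsWithin] with τ hτ hτJ
  have hsrc := (h.contMDiffOn.continuousOn τ hτJ).eventually_mem
    ((chartAt E x₀).open_source.mem_nhds hτ)
  have hc : ContDiffWithinAt ℝ 2 c J τ := by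
    rw [← contMDiffWithinAt_iff_contDiffWithinAt]
    exact (((contMDiffWithinAt_iff_target_of_mem_source (n := 2) hτ).1 (h.contMDiffOn τ hτJ))).2
  have hc₁ : ContDiffWithinAt ℝ 1 (derivWithin c J) J τ :=
    hc.derivWithin hJ (by norm_num) hτJ
  have hd := (hc.differentiableWithinAt (by norm_num)).hasDerivWithinAt
  refine ⟨hτ, hd, ?_, by rw [← hk τ hτJ, sq_norm_velocity (hJ τ hτJ) hτJ hsrc hd]⟩
  have hy := extChartAt_mem_target hτ
  have e : derivWithin (derivWithin c J) J τ = spray (chartMetric E x₀) (c τ, derivWithin c J τ) :=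
      by
    rw [← (isMetricOn_chartMetric x₀).eq_spray_iff hy]
    intro w
    rw [← christoffel_eq_lowerSpray hy]
    exact h.equation τ hτJ x₀ hτ w
  rw [← e]
  exact (hc₁.differentiableWithinAt (by norm_num)).hasDerivWithinAt

lemma contMDiffWithinAt_of_chart {n : WithTop ℕ∞} [hn : ENat.LEInfty n] (hs : s ∈ J)
    (hsrc : ∀ᶠ τ in 𝓝[J] s, γ τ ∈ (chartAt E x₀).source)
    (hc : ContDiffWithinAt ℝ n (fun τ ↦ extChartAt 𝓘(ℝ, E) x₀ (γ τ)) J s) :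
    ContMDiffWithinAt 𝓘(ℝ, ℝ) 𝓘(ℝ, E) n γ J s := by
  have h1 := hsrc.self_of_nhdsWithin hs
  have h3 := (contMDiffAt_extChartAt_symm x₀ (extChartAt_mem_target h1)).of_le hn.out
  refine (ContMDiffAt.comp_contMDiffWithinAt s (f := fun τ ↦ extChartAt 𝓘(ℝ, E) x₀ (γ τ)) h3
    hc.contMDiffWithinAt).congr_of_eventuallyEq ?_ (extChartAt_symm_apply h1).symm
  filter_upwards [hsrc] with τ hτ
  exact (extChartAt_symm_apply hτ).symm

lemma IsSprayCurveAt.contMDiffWithinAt (h : IsSprayCurveAt E k x₀ γ J s) (hs : s ∈ J)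
    (hJ : UniqueDiffOn ℝ J) : ContMDiffWithinAt 𝓘(ℝ, ℝ) 𝓘(ℝ, E) 2 γ J s := by
  obtain ⟨c₁, h⟩ := h
  refine contMDiffWithinAt_of_chart (x₀ := x₀) hs (h.mono fun _ h ↦ h.1) ?_
  obtain ⟨V, hV, hsV, hVJ⟩ := mem_nhdsWithin.1 h
  have hVJ' : ∀ τ ∈ J ∩ V, _ := fun τ hτ ↦ hVJ ⟨hτ.2, hτ.1⟩
  have hc : ContDiffOn ℝ 2 (fun τ ↦ extChartAt 𝓘(ℝ, E) x₀ (γ τ)) (J ∩ V) := by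
    refine contDiffOn_two_of_hasDerivWithinAt (hJ.inter hV)
      (fun t ht ↦ (hVJ' t ht).2.1.mono inter_subset_left)
      (fun t ht ↦ (hVJ' t ht).2.2.1.mono inter_subset_left) fun t ht ↦ ?_
    have h1 := hVJ' t ht
    exact ((isMetricOn_chartMetric x₀).contDiffAt_spray (extChartAt_mem_target h1.1)
      (c₁ t)).continuousAt.comp_continuousWithinAt
      (f := fun τ ↦ (extChartAt 𝓘(ℝ, E) x₀ (γ τ), c₁ τ))
      ((h1.2.1.continuousWithinAt.prodMk h1.2.2.1.continuousWithinAt).mono inter_subset_left)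
  exact (hc s ⟨hs, hsV⟩).mono_of_mem_nhdsWithin
    (inter_mem self_mem_nhdsWithin (mem_nhdsWithin_of_mem_nhds (hV.mem_nhds hsV)))

/-- A curve which satisfies the geodesic equation, near each of its points, in some chart is a
geodesic. -/
lemma isGeodesicOn_of_isSprayCurveAt (hJ : J.OrdConnected) (hn : J.Nontrivial)
    (h : ∀ s ∈ J, ∃ x₀ : S, IsSprayCurveAt E k x₀ γ J s) : IsGeodesicOn (riemMetric E S) γ J where
  ordConnected := hJ
  nontrivial := hn
  contMDiffOn s hs := by
    obtain ⟨x₀, h⟩ := h s hs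
    exact h.contMDiffWithinAt hs (uniqueDiffOn_of_ordConnected hJ hn)
  equation s hs x₀ hx₀ w := by
    have hU := uniqueDiffOn_of_ordConnected hJ hn
    obtain ⟨x₁, h⟩ := h s hs
    obtain ⟨c₁, h⟩ := h.change_chart hs hx₀
    intro c c' c''
    have e1 : c' =ᶠ[𝓝[J] s] c₁ := by
      filter_upwards [h, self_mem_nhdsWithin] with τ hτ hτJ
      exact hτ.2.1.derivWithin (hU τ hτJ)
    obtain ⟨h1, h2, h3, -⟩ := h.self_of_nhdsWithin hs
    have e2 : c' s = c₁ s := e1.self_of_nhdsWithin hs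
    have e3 : c'' s = spray (chartMetric E x₀) (c s, c' s) := by
      rw [e2]
      exact (h3.congr_of_eventuallyEq e1 e2).derivWithin (hU s hs)
    have hy := extChartAt_mem_target h1
    rw [christoffel_eq_lowerSpray hy, ← chartMetric_apply]
    exact ((isMetricOn_chartMetric x₀).eq_spray_iff hy _ _).2 e3 w

lemma IsSprayCurveAt.sq_norm_velocity (h : IsSprayCurveAt E k x₀ γ J s) (hJ : UniqueDiffOn ℝ J)
    (hs : s ∈ J) : ‖velocity 𝓘(ℝ, E) γ J s‖ ^ 2 = k := by
  obtain ⟨c₁, h⟩ := h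
  obtain ⟨-, h2, -, h4⟩ := h.self_of_nhdsWithin hs
  rw [Horizon.sq_norm_velocity (hJ s hs) hs (h.mono fun _ h ↦ h.1) h2, h4]

variable (E) in
/-- `γ` is a geodesic on `J` with squared speed `k`. -/
structure IsGeodesicWithSpeed (k : ℝ) (γ : ℝ → S) (J : Set ℝ) : Prop where
  ordConnected : J.OrdConnected
  nontrivial : J.Nontrivial
  isSprayCurveAt : ∀ s ∈ J, ∀ x₀ : S, γ s ∈ (chartAt E x₀).source → IsSprayCurveAt E k x₀ γ J s

lemma isGeodesicWithSpeed_of_exists (hJ : J.OrdConnected) (hn : J.Nontrivial)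
    (h : ∀ s ∈ J, ∃ x₀ : S, IsSprayCurveAt E k x₀ γ J s) : IsGeodesicWithSpeed E k γ J :=
  ⟨hJ, hn, fun s hs _ hx₀ ↦ (h s hs).elim fun _ h ↦ h.change_chart hs hx₀⟩

/-- The local first order notion is the one that restricts, glues and reparametrizes easily; this
equivalence passes between it and the definition of a geodesic. -/
lemma isGeodesicWithSpeed_iff : IsGeodesicWithSpeed E k γ J ↔
    IsGeodesicOn (riemMetric E S) γ J ∧ ∀ s ∈ J, ‖velocity 𝓘(ℝ, E) γ J s‖ ^ 2 = k := by
  constructor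
  · intro h
    have h' : ∀ s ∈ J, IsSprayCurveAt E k (γ s) γ J s := fun s hs ↦
      h.isSprayCurveAt s hs (γ s) (mem_chart_source E (γ s))
    exact ⟨isGeodesicOn_of_isSprayCurveAt h.ordConnected h.nontrivial fun s hs ↦ ⟨γ s, h' s hs⟩,
      fun s hs ↦ (h' s hs).sq_norm_velocity
        (uniqueDiffOn_of_ordConnected h.ordConnected h.nontrivial) hs⟩
  · rintro ⟨h, hk⟩
    exact ⟨h.ordConnected, h.nontrivial, fun s hs x₀ hx₀ ↦ h.isSprayCurveAt hk hs hx₀⟩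

namespace IsGeodesicWithSpeed

lemma uniqueDiffOn (h : IsGeodesicWithSpeed E k γ J) : UniqueDiffOn ℝ J :=
  uniqueDiffOn_of_ordConnected h.ordConnected h.nontrivial

lemma exists_isSprayCurveAt (h : IsGeodesicWithSpeed E k γ J) (hs : s ∈ J) :
    ∃ x₀, IsSprayCurveAt E k x₀ γ J s :=
  ⟨γ s, h.isSprayCurveAt s hs (γ s) (mem_chart_source E (γ s))⟩

lemma continuousOn (h : IsGeodesicWithSpeed E k γ J) : ContinuousOn γ J := fun s hs ↦
  (h.isSprayCurveAt s hs (γ s) (mem_chart_source E (γ s))).continuousWithinAt hs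

lemma contMDiffOn (h : IsGeodesicWithSpeed E k γ J) : ContMDiffOn 𝓘(ℝ, ℝ) 𝓘(ℝ, E) 2 γ J :=
  (isGeodesicWithSpeed_iff.1 h).1.contMDiffOn

lemma mono (h : IsGeodesicWithSpeed E k γ J) {γ' : ℝ → S} {J' : Set ℝ} (hJ' : J' ⊆ J)
    (hc : J'.OrdConnected) (hn : J'.Nontrivial) (hγ : EqOn γ' γ J') :
    IsGeodesicWithSpeed E k γ' J' :=
  isGeodesicWithSpeed_of_exists hc hn fun _ hs ↦
    (h.exists_isSprayCurveAt (hJ' hs)).imp fun _ hx ↦ hx.congr (nhdsWithin_mono _ hJ') hJ' hγ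

/-- Affine change of the parameter. -/
lemma comp_affine (h : IsGeodesicWithSpeed E k γ J) (a : ℝ) {b : ℝ} (hb : b ≠ 0) :
    IsGeodesicWithSpeed E (b ^ 2 * k) (fun τ ↦ γ (a + b * τ)) {τ | a + b * τ ∈ J} := by
  have hd : ∀ τ : ℝ, ∀ A : Set ℝ, HasDerivWithinAt (fun τ ↦ a + b * τ) b A τ := fun τ A ↦ by
    simpa using (((hasDerivAt_id τ).const_mul b).const_add a).hasDerivWithinAt
  have hinv : ∀ s, a + b * ((s - a) / b) = s := fun s ↦ by field_simp; ring
  refine isGeodesicWithSpeed_of_exists ⟨fun τ₁ h₁ τ₂ h₂ τ hτ ↦ ?_⟩ ?_ fun τ hτ ↦ ?_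
  · have hu : a + b * τ ∈ uIcc (a + b * τ₁) (a + b * τ₂) := by
      rw [mem_uIcc]
      rcases hb.lt_or_gt with hb | hb
      · exact Or.inr ⟨by nlinarith [hτ.2], by nlinarith [hτ.1]⟩
      · exact Or.inl ⟨by nlinarith [hτ.1], by nlinarith [hτ.2]⟩
    exact h.ordConnected.uIcc_subset h₁ h₂ hu
  · obtain ⟨s₁, hs₁, s₂, hs₂, hne⟩ := h.nontrivial
    refine ⟨(s₁ - a) / b, by simpa [hinv] using hs₁, (s₂ - a) / b, by simpa [hinv] using hs₂, ?_⟩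
    intro he
    exact hne (by rw [← hinv s₁, he, hinv])
  · obtain ⟨x₀, c₁, hc⟩ := h.exists_isSprayCurveAt hτ
    refine ⟨x₀, fun τ ↦ b • c₁ (a + b * τ), ?_⟩
    have ht : Tendsto (fun τ ↦ a + b * τ) (𝓝[{τ | a + b * τ ∈ J}] τ) (𝓝[J] (a + b * τ)) :=
      (hd τ _).continuousWithinAt.tendsto_nhdsWithin fun _ h ↦ h
    filter_upwards [ht.eventually hc] with t ⟨h1, h2, h3, h4⟩
    refine ⟨h1, ?_, ?_, ?_⟩
    · exact HasDerivWithinAt.scomp t h2 (hd t _) fun _ h ↦ h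
    · rw [spray_smul, sq, mul_smul]
      exact (HasDerivWithinAt.scomp t h3 (hd t _) fun _ h ↦ h).const_smul b
    · rw [← h4]
      simp only [map_smul, smul_apply, smul_eq_mul]
      ring

end IsGeodesicWithSpeed

/-- Two spray curves with the same velocity at the common end point fit together. -/
lemma IsSprayCurveAt.join {m : ℝ} (hm : m ∈ J) (hL : IsSprayCurveAt E k x₀ γ (J ∩ Iic m) m)
    (hR : IsSprayCurveAt E k x₀ γ (J ∩ Ici m) m)
    (huv : ∀ u v : E,
      HasDerivWithinAt (fun τ ↦ extChartAt 𝓘(ℝ, E) x₀ (γ τ)) u (J ∩ Iic m) m →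
      HasDerivWithinAt (fun τ ↦ extChartAt 𝓘(ℝ, E) x₀ (γ τ)) v (J ∩ Ici m) m →
      chartMetric E x₀ (extChartAt 𝓘(ℝ, E) x₀ (γ m)) u u = k →
      chartMetric E x₀ (extChartAt 𝓘(ℝ, E) x₀ (γ m)) v v = k → u = v) :
    IsSprayCurveAt E k x₀ γ J m := by
  obtain ⟨cL, hcL⟩ := hL
  obtain ⟨cR, hcR⟩ := hR
  obtain ⟨l1, l2, l3, l4⟩ := hcL.self_of_nhdsWithin ⟨hm, self_mem_Iic⟩
  obtain ⟨r1, r2, r3, r4⟩ := hcR.self_of_nhdsWithin ⟨hm, self_mem_Ici⟩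
  -- Once the one-sided velocities agree, the one-sided accelerations do too, both being the spray
  -- at the same point and velocity.
  have hLR : cL m = cR m := huv _ _ l2 r2 l4 r4
  set c₁ : ℝ → E := fun τ ↦ if τ ≤ m then cL τ else cR τ
  have hcover : J = J ∩ Iic m ∪ J ∩ Ici m := by rw [← inter_union_distrib_left]; simp
  have eL : ∀ τ ≤ m, c₁ τ = cL τ := fun τ hτ ↦ if_pos hτ
  have eR : ∀ τ, m ≤ τ → c₁ τ = cR τ := fun τ hτ ↦ by
    rcases hτ.eq_or_lt with rfl | h
    · rw [eL _ le_rfl, hLR]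
    · exact if_neg h.not_ge
  refine ⟨c₁, ?_⟩
  rw [hcover, nhdsWithin_union, ← hcover, eventually_sup]
  constructor
  · filter_upwards [hcL, self_mem_nhdsWithin] with τ ⟨h1, h2, h3, h4⟩ hτ
    rcases eq_or_lt_of_le (show τ ≤ m from hτ.2) with rfl | hlt
    · rw [eL τ le_rfl]
      refine ⟨h1, ?_, ?_, h4⟩
      · have := h2.union (hLR ▸ r2)
        rwa [← hcover] at this
      · have := (h3.congr (fun t ht ↦ eL t ht.2) (eL τ le_rfl)).union
          ((hLR ▸ r3).congr (fun t ht ↦ eR t ht.2) (eR τ le_rfl))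
        rwa [← hcover] at this
    · rw [eL τ hlt.le]
      have hI : Iic m ∈ 𝓝 τ := Iic_mem_nhds hlt
      exact ⟨h1, (hasDerivWithinAt_inter hI).1 h2, (hasDerivWithinAt_inter hI).1
        (h3.congr (fun t ht ↦ eL t ht.2) (eL τ hlt.le)), h4⟩
  · filter_upwards [hcR, self_mem_nhdsWithin] with τ ⟨h1, h2, h3, h4⟩ hτ
    rcases eq_or_lt_of_le (show m ≤ τ from hτ.2) with rfl | hlt
    · rw [eL m le_rfl]
      refine ⟨h1, ?_, ?_, l4⟩
      · have := l2.union (hLR ▸ h2)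
        rwa [← hcover] at this
      · have := (l3.congr (fun t ht ↦ eL t ht.2) (eL m le_rfl)).union
          ((hLR ▸ h3).congr (fun t ht ↦ eR t ht.2) (eR m le_rfl))
        rwa [← hcover] at this
    · rw [eR τ hlt.le]
      have hI : Ici m ∈ 𝓝 τ := Ici_mem_nhds hlt
      exact ⟨h1, (hasDerivWithinAt_inter hI).1 h2, (hasDerivWithinAt_inter hI).1
        (h3.congr (fun t ht ↦ eR t ht.2) (eR τ hlt.le)), h4⟩

end Curves

/-! ### Extension of convergent geodesics to their end points -/

section Extension

set_option linter.unusedSectionVars false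

variable {E : Type*} [NormedAddCommGroup E] [NormedSpace ℝ E] [FiniteDimensional ℝ E]

lemma IsMetricOn.continuousAt_apply_self {G : E → E →L[ℝ] E →L[ℝ] ℝ} {U : Set E}
    (hG : IsMetricOn G U) {y : E} (hy : y ∈ U) (v : E) :
    ContinuousAt (fun p : E × E ↦ G p.1 p.2 p.2) (y, v) := by
  have h : ContinuousAt (fun p : E × E ↦ G p.1) (y, v) :=
    ContinuousAt.comp (g := G) (f := Prod.fst) (hG.contDiffAt hy).continuousAt continuousAt_fst
  exact (h.clm_apply continuousAt_snd).clm_apply continuousAt_snd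

/-- A solution of `c' = c₁`, `c₁' = B (c, c₁)` on `(a, b)` with bounded velocity which converges
in the domain of `B` extends to `(a, b]`. -/
lemma exists_extension_of_bounded {B : E × E → E} {U : Set E} (hU : IsOpen U)
    (hB : ContinuousOn B (U ×ˢ univ)) {c c₁ : ℝ → E} {a b K : ℝ} {x : E} (hab : a < b) (hx : x ∈ U)
    (hc : ∀ t ∈ Ioo a b, HasDerivAt c (c₁ t) t)
    (hc₁ : ∀ t ∈ Ioo a b, HasDerivAt c₁ (B (c t, c₁ t)) t) (hK : ∀ t ∈ Ioo a b, ‖c₁ t‖ ≤ K)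
    (hlim : Tendsto c (𝓝[<] b) (𝓝 x)) (hcb : c b = x) :
    ∃ a' ∈ Ico a b, ∃ g : ℝ → E, EqOn g c₁ (Ioo a' b) ∧ Continuous g ∧
      HasDerivWithinAt c (g b) (Iic b) b ∧ HasDerivWithinAt g (B (c b, g b)) (Iic b) b := by
  obtain ⟨r, hr, hrU⟩ := Metric.nhds_basis_closedBall.mem_iff.1 (hU.mem_nhds hx)
  have hcomp : IsCompact (Metric.closedBall x r ×ˢ Metric.closedBall (0 : E) K) :=
    (isCompact_closedBall x r).prod (isCompact_closedBall _ _)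
  obtain ⟨D, hD⟩ := hcomp.exists_bound_of_continuousOn
    (hB.mono (prod_mono hrU (subset_univ _)))
  have hev : ∀ᶠ t in 𝓝[<] b, c t ∈ Metric.closedBall x r :=
    hlim.eventually (Metric.closedBall_mem_nhds x hr)
  obtain ⟨a₀, ha₀, hsub⟩ := (mem_nhdsLT_iff_exists_Ioo_subset).1 hev
  set a' := max a a₀
  have ha' : a' < b := max_lt hab ha₀
  have hI : ∀ t ∈ Ioo a' b, t ∈ Ioo a b := fun t ht ↦ ⟨(le_max_left _ _).trans_lt ht.1, ht.2⟩
  have hbound : ∀ t ∈ Ioo a' b, ‖B (c t, c₁ t)‖ ≤ D := fun t ht ↦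
    hD _ ⟨hsub ⟨(le_max_right _ _).trans_lt ht.1, ht.2⟩, by simpa using hK t (hI t ht)⟩
  have hD0 : 0 ≤ D := (norm_nonneg _).trans (hbound ((a' + b) / 2) ⟨by linarith, by linarith⟩)
  -- A bounded acceleration makes the velocity Lipschitz, so it extends continuously to b. The
  -- one-sided derivatives at b then exist because the derivatives have limits there.
  have hLip : LipschitzOnWith ⟨D, hD0⟩ c₁ (Ioo a' b) :=
    (convex_Ioo a' b).lipschitzOnWith_of_nnnorm_hasDerivWithin_le
      (fun t ht ↦ (hc₁ t (hI t ht)).hasDerivWithinAt) fun t ht ↦ hbound t ht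
  obtain ⟨g, hg, hgc⟩ := hLip.extend_finite_dimension
  have hgcont : Continuous g := hg.continuous
  have hmem : Ioo a' b ∈ 𝓝[<] b := Ioo_mem_nhdsLT ha'
  have hgd : ∀ t ∈ Ioo a' b, HasDerivAt g (B (c t, c₁ t)) t := fun t ht ↦
    (hc₁ t (hI t ht)).congr_of_eventuallyEq
      (by filter_upwards [isOpen_Ioo.mem_nhds ht] with s hs using (hgc hs).symm)
  have hgb : Tendsto g (𝓝[<] b) (𝓝 (g b)) := hgcont.continuousAt.tendsto.mono_left
      nhdsWithin_le_nhds
  refine ⟨a', ⟨le_max_left _ _, ha'⟩, g, fun t ht ↦ (hgc ht).symm, hgcont, ?_, ?_⟩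
  · refine hasDerivWithinAt_Iic_of_tendsto_deriv (s := Ioo a' b)
      (fun t ht ↦ (hc t (hI t ht)).differentiableAt.differentiableWithinAt) ?_ hmem ?_
    · rw [ContinuousWithinAt, hcb]
      exact hlim.mono_left (nhdsWithin_mono _ fun t ht ↦ ht.2)
    · refine hgb.congr' ?_
      filter_upwards [hmem] with t ht
      rw [(hc t (hI t ht)).deriv, hgc ht]
  · refine hasDerivWithinAt_Iic_of_tendsto_deriv (s := Ioo a' b)
      (fun t ht ↦ (hgd t ht).differentiableAt.differentiableWithinAt)
      hgcont.continuousAt.continuousWithinAt hmem ?_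
    have h1 : ContinuousAt B (c b, g b) := by
      rw [hcb]
      exact hB.continuousAt (prod_mem_nhds (hU.mem_nhds hx) univ_mem)
    have h2 : Tendsto (fun t ↦ B (c t, g t)) (𝓝[<] b) (𝓝 (B (c b, g b))) :=
      h1.tendsto.comp ((hcb.symm ▸ hlim).prodMk_nhds hgb)
    refine h2.congr' ?_
    filter_upwards [hmem] with t ht
    rw [(hgd t ht).deriv, hgc ht]

variable {S : Type*} [TopologicalSpace S] [ChartedSpace E S]
  [RiemannianBundle (fun x : S ↦ TangentSpace 𝓘(ℝ, E) x)] [IsManifold 𝓘(ℝ, E) ∞ S]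
  [IsContMDiffRiemannianBundle 𝓘(ℝ, E) ∞ E (fun x : S ↦ TangentSpace 𝓘(ℝ, E) x)]
  {γ : ℝ → S} {J : Set ℝ} {k : ℝ}

namespace IsGeodesicWithSpeed

/-- A geodesic which converges at the upper end of its domain extends to the closed end. -/
theorem extend_right (h : IsGeodesicWithSpeed E k γ J) {b : ℝ} (hb : ∀ s ∈ J, s < b)
    (hbJ : b ∈ closure J) {x : S} (hx : Tendsto γ (𝓝[J] b) (𝓝 x)) :
    IsGeodesicWithSpeed E k (Function.update γ b x) (insert b J) := by
  have hne : b ∉ J := fun h ↦ (hb b h).false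
  obtain ⟨a, ha⟩ : J.Nonempty := h.nontrivial.nonempty
  have hIco : ∀ s ∈ J, Ico s b ⊆ J := by
    intro s hs t ht
    obtain ⟨u, hu, hu'⟩ := mem_closure_iff.1 hbJ (Ioi t) isOpen_Ioi ht.2
    exact h.ordConnected.out hs hu' ⟨ht.1, le_of_lt hu⟩
  have hnhds : 𝓝[J] b = 𝓝[<] b := by
    apply le_antisymm
    · exact nhdsWithin_mono _ fun s hs ↦ hb s hs
    · exact nhdsWithin_le_iff.2 (mem_of_superset (Ico_mem_nhdsLT (hb a ha)) (hIco a ha))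
  have hord : (insert b J).OrdConnected := by
    refine ⟨fun s hs t ht u hu ↦ ?_⟩
    rcases eq_or_lt_of_le (show u ≤ b from hu.2.trans (by
      rcases ht with rfl | ht; exacts [le_rfl, (hb _ ht).le])) with rfl | hub
    · exact mem_insert _ _
    · rcases hs with rfl | hs
      · exact absurd hu.1 hub.not_ge
      · exact mem_insert_of_mem _ (hIco s hs ⟨hu.1, hub⟩)
  have hupd : EqOn (Function.update γ b x) γ J := fun s hs ↦
    Function.update_of_ne (hb s hs).ne _ _
  refine isGeodesicWithSpeed_of_exists hord (h.nontrivial.mono (subset_insert _ _)) fun s hs ↦ ?_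
  rcases hs with hsb | hs
  swap
  · obtain ⟨x₀, hx₀⟩ := h.exists_isSprayCurveAt hs
    refine ⟨x₀, IsSprayCurveAt.of_inter isOpen_Iio (hb s hs) ?_⟩
    have hsub : insert b J ∩ Iio b ⊆ J := by
      rintro t ⟨rfl | ht, ht'⟩
      · exact absurd ht' self_notMem_Iio
      · exact ht
    exact hx₀.congr (nhdsWithin_mono _ hsub) hsub (hupd.mono hsub)
  rw [hsb]
  refine ⟨x, ?_⟩
  set γ' := Function.update γ b x
  have hγb : γ' b = x := Function.update_self _ _ _
  set φ := extChartAt 𝓘(ℝ, E) x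
  set c : ℝ → E := fun τ ↦ φ (γ' τ)
  set G := chartMetric E x
  have hφx : φ x ∈ φ.target := mem_extChartAt_target x
  have hG : IsMetricOn G φ.target := isMetricOn_chartMetric x
  have hcb : c b = φ x := by simp only [c, hγb]
  have hγ'lim : Tendsto γ' (𝓝[<] b) (𝓝 x) := by
    rw [← hnhds]
    exact hx.congr' (by filter_upwards [self_mem_nhdsWithin] with s hs using (hupd hs).symm)
  have hclim : Tendsto c (𝓝[<] b) (𝓝 (φ x)) :=
    (continuousAt_extChartAt (I := 𝓘(ℝ, E)) x).tendsto.comp hγ'lim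
  obtain ⟨l, hl, hlow⟩ := hG.eventually_le_apply hφx
  have hev : ∀ᶠ t in 𝓝[<] b, t ∈ Ico a b ∧ γ' t ∈ (chartAt E x).source ∧
      ∀ v, l * ‖v‖ ^ 2 ≤ G (c t) v v :=
    Filter.Eventually.and (Ico_mem_nhdsLT (hb a ha)) ((hγ'lim.eventually_mem
      ((chartAt E x).open_source.mem_nhds (mem_chart_source E x))).and (hclim.eventually hlow))
  obtain ⟨a₀, ha₀, hsub⟩ := (mem_nhdsLT_iff_exists_Ioo_subset).1 hev
  have hJnhds : ∀ t ∈ Ioo a₀ b, J ∈ 𝓝 t := fun t ht ↦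
    mem_of_superset (isOpen_Ioo.mem_nhds ht) fun u hu ↦ hIco a ha (hsub hu).1
  have hpt : ∀ t ∈ Ioo a₀ b, HasDerivAt c (deriv c t) t ∧
      HasDerivAt (deriv c) (spray G (c t, deriv c t)) t ∧ G (c t) (deriv c t) (deriv c t) = k := by
    intro t ht
    have hJt := hJnhds t ht
    have htJ := mem_of_mem_nhds hJt
    have hcγ : ∀ u ∈ J, c u = φ (γ u) := fun u hu ↦ congrArg φ (hupd hu)
    obtain ⟨c₁, h1⟩ := h.isSprayCurveAt t htJ x (by rw [← hupd htJ]; exact (hsub ht).2.1)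
    rw [nhdsWithin_eq_nhds.2 hJt] at h1
    have hev2 : ∀ᶠ τ in 𝓝 t, HasDerivAt c (c₁ τ) τ := by
      filter_upwards [h1, eventually_eventually_nhds.2 hJt] with τ hτ hJτ
      exact (hτ.2.1.hasDerivAt hJτ).congr_of_eventuallyEq
        (by filter_upwards [hJτ] with u hu using hcγ u hu)
    have hev3 : deriv c =ᶠ[𝓝 t] c₁ := hev2.mono fun τ hτ ↦ hτ.deriv
    obtain ⟨-, -, h3, h4⟩ := h1.self_of_nhds
    rw [hev3.self_of_nhds, hcγ t htJ]
    exact ⟨hev2.self_of_nhds, (h3.hasDerivAt hJt).congr_of_eventuallyEq hev3, h4⟩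
  -- The velocity bound √(k / l) comes from l‖c'‖² ≤ G(c', c') = k.
  obtain ⟨a', ⟨ha', hab⟩, g, hgc, hgcont, hd1, hd2⟩ := exists_extension_of_bounded
    (B := spray G) (c := c) (c₁ := deriv c) (a := a₀) (b := b) (K := √(k / l)) hG.isOpen
    (fun p hp ↦ (hG.contDiffAt_spray hp.1 p.2).continuousAt.continuousWithinAt) ha₀ hφx
    (fun t ht ↦ (hpt t ht).1) (fun t ht ↦ (hpt t ht).2.1) (fun t ht ↦ by
      refine Real.le_sqrt_of_sq_le ?_
      rw [le_div_iff₀ hl, mul_comm, ← (hpt t ht).2.2]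
      exact (hsub ht).2.2 _) hclim hcb
  have hle : insert b J ⊆ Iic b := insert_subset self_mem_Iic fun s hs ↦ (hb s hs).le
  have hbnhds : ∀ᶠ t in 𝓝[insert b J] b, t ∈ Ioo a' b ∨ t = b := by
    filter_upwards [self_mem_nhdsWithin, mem_nhdsWithin_of_mem_nhds (Ioi_mem_nhds hab)] with t ht
        ht'
    rcases ht with rfl | ht
    · exact Or.inr rfl
    · exact Or.inl ⟨ht', hb t ht⟩
  refine ⟨g, ?_⟩
  filter_upwards [hbnhds] with t ht
  rcases ht with ht | rfl
  · have hta : t ∈ Ioo a₀ b := ⟨ha'.trans_lt ht.1, ht.2⟩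
    obtain ⟨e1, e2, e3⟩ := hpt t hta
    have hgt : g t = deriv c t := hgc ht
    have heq : g =ᶠ[𝓝 t] deriv c := by
      filter_upwards [isOpen_Ioo.mem_nhds ht] with u hu using hgc hu
    rw [hgt]
    exact ⟨(hsub hta).2.1, e1.hasDerivWithinAt, (e2.congr_of_eventuallyEq heq).hasDerivWithinAt, e3⟩
  · refine ⟨by rw [hγb]; exact mem_chart_source E x, hd1.mono hle, hd2.mono hle, ?_⟩
    -- The constant speed passes to the limit at the new end point.
    have hlim : Tendsto (fun τ ↦ G (c τ) (g τ) (g τ)) (𝓝[<] t) (𝓝 (G (c t) (g t) (g t))) := by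
      have hct : c t ∈ φ.target := by rw [hcb]; exact hφx
      have h1 : Tendsto (fun p : E × E ↦ G p.1 p.2 p.2) (𝓝 (c t, g t)) (𝓝 (G (c t) (g t) (g t))) :=
        hG.continuousAt_apply_self hct (g t)
      have h2 : Tendsto g (𝓝[<] t) (𝓝 (g t)) :=
        hgcont.continuousAt.tendsto.mono_left nhdsWithin_le_nhds
      have h3 : Tendsto c (𝓝[<] t) (𝓝 (c t)) := by rw [hcb]; exact hclim
      exact Tendsto.comp (f := fun τ ↦ (c τ, g τ)) h1 (h3.prodMk_nhds h2)
    refine tendsto_nhds_unique hlim (tendsto_const_nhds.congr' ?_)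
    filter_upwards [Ioo_mem_nhdsLT hab] with τ hτ
    rw [hgc hτ, (hpt τ ⟨ha'.trans_lt hτ.1, hτ.2⟩).2.2]

/-- A geodesic which converges at the lower end of its domain extends to the closed end. -/
theorem extend_left (h : IsGeodesicWithSpeed E k γ J) {a : ℝ} (ha : ∀ s ∈ J, a < s)
    (haJ : a ∈ closure J) {x : S} (hx : Tendsto γ (𝓝[J] a) (𝓝 x)) :
    IsGeodesicWithSpeed E k (Function.update γ a x) (insert a J) := by
  -- Reversing the parameter reduces the claim to the upper end.
  have h1 := h.comp_affine 0 (b := -1) (by norm_num)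
  simp only [zero_add, neg_mul, one_mul, neg_sq, one_pow] at h1
  have hset : {τ | -τ ∈ J} = -J := rfl
  rw [hset] at h1
  have hcl : -a ∈ closure (-J) := by
    rw [← neg_closure]
    simpa using haJ
  have ht : Tendsto (fun τ : ℝ ↦ -τ) (𝓝[-J] (-a)) (𝓝[J] a) := by
    have := (continuous_neg (G := ℝ)).continuousWithinAt.tendsto_nhdsWithin
      (s := -J) (t := J) (x := -a) fun τ hτ ↦ by simpa using hτ
    simpa using this
  have h2 := h1.extend_right (b := -a) (fun s hs ↦ by
    have := ha (-s) hs
    linarith) hcl (hx.comp ht)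
  have h3 := h2.comp_affine 0 (b := -1) (by norm_num)
  simp only [zero_add, neg_mul, one_mul, neg_sq, one_pow] at h3
  have hset2 : {τ | -τ ∈ insert (-a) (-J)} = insert a J := by
    ext τ
    simp
  rw [hset2] at h3
  refine h3.mono Subset.rfl h3.ordConnected h3.nontrivial fun τ _ ↦ ?_
  by_cases hτ : τ = a
  · subst hτ
    simp
  · simp [hτ]

end IsGeodesicWithSpeed

end Extension

/-! ### The distance function of C -/

section Distance

set_option linter.unusedSectionVars false

/-- The first parameter at which the curve is outside V works: it is a limit of parameters whose
points lie in V. -/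
lemma exists_mem_frontier {X : Type*} [TopologicalSpace X] {σ : ℝ → X} {V : Set X} (hV : IsOpen V)
    (hσ : Continuous σ) (h0 : σ 0 ∈ V) (h1 : σ 1 ∉ V) :
    ∃ t ∈ Icc (0 : ℝ) 1, σ t ∈ frontier V := by
  have hK : IsCompact (Icc (0 : ℝ) 1 ∩ σ ⁻¹' Vᶜ) :=
    isCompact_Icc.inter_right (hV.isClosed_compl.preimage hσ)
  obtain ⟨t, ⟨ht, htV⟩, hmin⟩ := hK.exists_isLeast ⟨1, by simp, h1⟩
  have ht0 : 0 < t := ht.1.lt_of_ne (by rintro rfl; exact htV h0)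
  refine ⟨t, ht, ?_, by rwa [hV.interior_eq]⟩
  refine mem_closure_of_tendsto (b := 𝓝[<] t) (hσ.continuousAt.tendsto.mono_left
      nhdsWithin_le_nhds) ?_
  filter_upwards [Ioo_mem_nhdsLT ht0] with s hs
  by_contra hsV
  exact (hmin ⟨⟨hs.1.le, hs.2.le.trans ht.2⟩, hsV⟩).not_gt hs.2

variable {E : Type*} [NormedAddCommGroup E] [NormedSpace ℝ E] [FiniteDimensional ℝ E]
  {S : Type*} [TopologicalSpace S] [T2Space S] [ConnectedSpace S] [ChartedSpace E S]
  [RiemannianBundle (fun x : S ↦ TangentSpace 𝓘(ℝ, E) x)] [IsManifold 𝓘(ℝ, E) ∞ S]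
  [IsContMDiffRiemannianBundle 𝓘(ℝ, E) ∞ E (fun x : S ↦ TangentSpace 𝓘(ℝ, E) x)]

variable (E S) in
lemma isContinuousRiemannianBundle :
    IsContinuousRiemannianBundle E (fun x : S ↦ TangentSpace 𝓘(ℝ, E) x) := by
  obtain ⟨g, hg, h⟩ := IsContMDiffRiemannianBundle.exists_contMDiff (IB := 𝓘(ℝ, E)) (n := ∞) (F :=
      E)
    (E := fun x : S ↦ TangentSpace 𝓘(ℝ, E) x)
  exact ⟨g, hg.continuous, h⟩


lemma eventually_dist_lt (x : S) {c : ℝ≥0∞} (hc : 0 < c) : ∀ᶠ y in 𝓝 x, riemannianEDist 𝓘(ℝ, E) x y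
    < c := by
  have := isContinuousRiemannianBundle E S
  have : IsManifold 𝓘(ℝ, E) 1 S := inferInstance
  exact eventually_riemannianEDist_lt 𝓘(ℝ, E) x hc

lemma exists_dist_ball_subset {x : S} {s : Set S} (hs : s ∈ 𝓝 x) :
    ∃ c > (0 : ℝ≥0∞), {y | riemannianEDist 𝓘(ℝ, E) x y < c} ⊆ s := by
  have := isContinuousRiemannianBundle E S
  have : IsManifold 𝓘(ℝ, E) 1 S := inferInstance
  have := ChartedSpace.locallyCompactSpace E S
  exact setOfPred_riemannianEDist_lt_subset_nhds' 𝓘(ℝ, E) hs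

-- The points at finite distance from x form a nonempty set that is open and closed, and S is
-- connected.
variable (E) in
lemma dist_ne_top (x y : S) : riemannianEDist 𝓘(ℝ, E) x y ≠ ⊤ := by
  have hclopen : IsClopen {z : S | riemannianEDist 𝓘(ℝ, E) x z < ⊤} := by
    have key : ∀ z w : S, riemannianEDist 𝓘(ℝ, E) z w < 1 → (riemannianEDist 𝓘(ℝ, E) x z < ⊤ ↔
        riemannianEDist 𝓘(ℝ, E) x w < ⊤) := by
      intro z w h
      constructor <;> intro h'
      · exact riemannianEDist_triangle.trans_lt (ENNReal.add_lt_top.2 ⟨h', h.trans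
            ENNReal.one_lt_top⟩)
      · rw [riemannianEDist_comm] at h
        exact riemannianEDist_triangle.trans_lt (ENNReal.add_lt_top.2 ⟨h', h.trans
            ENNReal.one_lt_top⟩)
    constructor
    · rw [← isOpen_compl_iff, isOpen_iff_mem_nhds]
      intro z hz
      filter_upwards [eventually_dist_lt (E := E) z one_pos] with w hw
      exact fun h ↦ hz ((key z w hw).2 h)
    · rw [isOpen_iff_mem_nhds]
      intro z hz
      filter_upwards [eventually_dist_lt (E := E) z one_pos] with w hw
      exact (key z w hw).1 hz
  have huniv := hclopen.eq_univ ⟨x, by simp [riemannianEDist_self]⟩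
  have : y ∈ {z : S | riemannianEDist 𝓘(ℝ, E) x z < ⊤} := huniv ▸ mem_univ y
  exact this.ne

variable {C : Set S}

lemma iInf_dist_ne_top (hne : C.Nonempty) (p : S) : (⨅ q ∈ C, riemannianEDist 𝓘(ℝ, E) p q) ≠ ⊤ := by
  obtain ⟨q, hq⟩ := hne
  exact ((iInf₂_le q hq).trans_lt (dist_ne_top E p q).lt_top).ne

lemma ofReal_rho (hne : C.Nonempty) (p : S) : ENNReal.ofReal (rho E C p) = ⨅ q ∈ C, riemannianEDist
    𝓘(ℝ, E) p q :=
  ENNReal.ofReal_toReal (iInf_dist_ne_top hne p)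

lemma rho_nonneg (p : S) : 0 ≤ rho E C p := ENNReal.toReal_nonneg

lemma rho_le_dist_add (hne : C.Nonempty) (p q : S) :
    rho E C p ≤ (riemannianEDist 𝓘(ℝ, E) p q).toReal + rho E C q := by
  rw [rho, rho, ← ENNReal.toReal_add (dist_ne_top E p q) (iInf_dist_ne_top hne q)]
  refine ENNReal.toReal_mono (ENNReal.add_ne_top.2 ⟨dist_ne_top E p q, iInf_dist_ne_top hne q⟩) ?_
  rw [ENNReal.add_iInf]
  refine le_iInf fun r ↦ ?_
  by_cases hr : r ∈ C
  · simp only [hr, iInf_pos]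
    exact (iInf₂_le r hr).trans riemannianEDist_triangle
  · simp [hr]

lemma abs_rho_sub_le (hne : C.Nonempty) (p q : S) :
    |rho E C p - rho E C q| ≤ (riemannianEDist 𝓘(ℝ, E) p q).toReal := by
  rw [abs_le]
  have h1 := rho_le_dist_add (E := E) hne p q
  have h2 := rho_le_dist_add (E := E) hne q p
  rw [riemannianEDist_comm] at h2
  constructor <;> linarith

lemma continuous_of_abs_sub_le_dist {f : S → ℝ} (h : ∀ p q, |f p - f q| ≤ (riemannianEDist 𝓘(ℝ, E)
    p q).toReal) :
    Continuous f := by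
  rw [continuous_iff_continuousAt]
  intro p
  rw [ContinuousAt, Metric.tendsto_nhds]
  intro ε hε
  filter_upwards [eventually_dist_lt (E := E) p (ENNReal.ofReal_pos.2 hε)] with q hq
  rw [dist_comm, Real.dist_eq]
  refine (h p q).trans_lt ?_
  rwa [← ENNReal.toReal_ofReal hε.le, ENNReal.toReal_lt_toReal (dist_ne_top E p q)
    ENNReal.ofReal_ne_top]

lemma continuous_rho (hne : C.Nonempty) : Continuous (rho E C) :=
  continuous_of_abs_sub_le_dist (abs_rho_sub_le hne)

lemma continuous_toReal_dist (p : S) : Continuous fun q ↦ (riemannianEDist 𝓘(ℝ, E) p q).toReal := by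
  refine continuous_of_abs_sub_le_dist (E := E) fun q r ↦ ?_
  have h : ∀ a b : S, (riemannianEDist 𝓘(ℝ, E) p a).toReal ≤ (riemannianEDist 𝓘(ℝ, E) p b).toReal +
      (riemannianEDist 𝓘(ℝ, E) b a).toReal := by
    intro a b
    rw [← ENNReal.toReal_add (dist_ne_top E p b) (dist_ne_top E b a)]
    exact ENNReal.toReal_mono (ENNReal.add_ne_top.2 ⟨dist_ne_top E p b, dist_ne_top E b a⟩)
      riemannianEDist_triangle
  have h1 := h q r
  have h2 := h r q
  rw [riemannianEDist_comm (x := r)] at h1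
  rw [abs_le]
  constructor <;> linarith

lemma rho_eq_zero {p : S} (hp : p ∈ C) : rho E C p = 0 := by
  have : (⨅ q ∈ C, riemannianEDist 𝓘(ℝ, E) p q) = 0 :=
    le_antisymm ((iInf₂_le p hp).trans riemannianEDist_self.le) bot_le
  simp [rho, this]

/-- Some ball for the Riemannian distance fits into the open complement of C. -/
lemma rho_pos (hC : IsClosed C) (hne : C.Nonempty) {p : S} (hp : p ∉ C) : 0 < rho E C p := by
  obtain ⟨c, hc, hsub⟩ := exists_dist_ball_subset (E := E) (hC.isOpen_compl.mem_nhds hp)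
  refine ENNReal.toReal_pos (fun h ↦ ?_) (iInf_dist_ne_top hne p)
  have : (⨅ q ∈ C, riemannianEDist 𝓘(ℝ, E) p q) < c := by rwa [h]
  simp only [iInf_lt_iff] at this
  obtain ⟨q, hq, hlt⟩ := this
  exact hsub hlt hq

lemma rho_pos_iff (hC : IsClosed C) (hne : C.Nonempty) {p : S} : 0 < rho E C p ↔ p ∉ C :=
  ⟨fun h hp ↦ h.ne' (rho_eq_zero hp), rho_pos hC hne⟩

/-- A curve of length less than r that leaves V is cut where it meets the frontier; the two pieces
bound the two distances. -/
lemma exists_frontier_dist_add_lt {V : Set S} (hV : IsOpen V) {p q : S} (hp : p ∈ V) (hq : q ∉ V)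
    {r : ℝ≥0∞} (hr : riemannianEDist 𝓘(ℝ, E) p q < r) : ∃ z ∈ frontier V, riemannianEDist 𝓘(ℝ, E) p
        z + riemannianEDist 𝓘(ℝ, E) z q < r := by
  obtain ⟨σ, h0, h1, hσ, hlen, -⟩ := exists_lt_locally_constant_of_riemannianEDist_lt hr zero_lt_one
  obtain ⟨t, ht, htV⟩ := exists_mem_frontier hV hσ.continuous (by rwa [h0]) (by rwa [h1])
  refine ⟨σ t, htV, lt_of_le_of_lt ?_ hlen⟩
  rw [← pathELength_add ht.1 ht.2]
  exact add_le_add (riemannianEDist_le_pathELength hσ.contMDiffOn h0 rfl ht.1)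
    (riemannianEDist_le_pathELength hσ.contMDiffOn rfl h1 ht.2)

/-- The distance to `C` is realized through the boundary of a relatively compact neighborhood. -/
lemma exists_frontier_rho_eq (hne : C.Nonempty) {V : Set S} (hV : IsOpen V)
    (hcomp : IsCompact (frontier V)) {p : S} (hp : p ∈ V) (hCV : Disjoint C V) :
    ∃ z ∈ frontier V, rho E C p = (riemannianEDist 𝓘(ℝ, E) p z).toReal + rho E C z := by
  have hqV : ∀ q ∈ C, q ∉ V := fun q hq hqV ↦ hCV.le_bot ⟨hq, hqV⟩
  have hF : (frontier V).Nonempty := by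
    obtain ⟨q, hq⟩ := hne
    obtain ⟨z, hz, -⟩ := exists_frontier_dist_add_lt hV hp (hqV q hq) (dist_ne_top E p q).lt_top
    exact ⟨z, hz⟩
  -- The sum d(p, z) + ρ(z) is minimized over the compact frontier. No nearest point of C is needed,
  -- hence no completeness.
  obtain ⟨z, hz, hmin⟩ := hcomp.exists_isMinOn hF
    ((continuous_toReal_dist (E := E) p).add (continuous_rho (E := E) hne)).continuousOn
  refine ⟨z, hz, le_antisymm (rho_le_dist_add hne p z) (le_of_forall_pos_le_add fun ε hε ↦ ?_)⟩
  have hlt : (⨅ q ∈ C, riemannianEDist 𝓘(ℝ, E) p q) < ENNReal.ofReal (rho E C p + ε) := by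
    rw [← ofReal_rho hne]
    exact (ENNReal.ofReal_lt_ofReal_iff (by linarith [rho_nonneg (E := E) (C := C) p])).2 (by
        linarith)
  simp only [iInf_lt_iff] at hlt
  obtain ⟨q, hq, hlt⟩ := hlt
  obtain ⟨z', hz', hlt'⟩ := exists_frontier_dist_add_lt hV hp (hqV q hq) hlt
  have h1 : (riemannianEDist 𝓘(ℝ, E) p z').toReal + rho E C z' ≤ rho E C p + ε := by
    rw [← ENNReal.toReal_ofReal (show 0 ≤ rho E C p + ε by
      linarith [rho_nonneg (E := E) (C := C) p]), rho,
      ← ENNReal.toReal_add (dist_ne_top E p z') (iInf_dist_ne_top hne z')]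
    refine ENNReal.toReal_mono ENNReal.ofReal_ne_top (le_trans ?_ hlt'.le)
    gcongr
    exact iInf₂_le q hq
  exact (hmin hz').trans h1

end Distance

/-! ### Lengths of curves in charts -/

section ChartLength

set_option linter.unusedSectionVars false

variable {E : Type*} [NormedAddCommGroup E] [NormedSpace ℝ E] [FiniteDimensional ℝ E]
  {S : Type*} [TopologicalSpace S] [ChartedSpace E S]
  [RiemannianBundle (fun x : S ↦ TangentSpace 𝓘(ℝ, E) x)] [IsManifold 𝓘(ℝ, E) ∞ S]
  [IsContMDiffRiemannianBundle 𝓘(ℝ, E) ∞ E (fun x : S ↦ TangentSpace 𝓘(ℝ, E) x)]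

lemma norm_velocity_eq_sqrt {γ : ℝ → S} {J : Set ℝ} {s : ℝ} {x₀ : S} {u : E}
    (hs : UniqueDiffWithinAt ℝ J s) (hsJ : s ∈ J)
    (hsrc : ∀ᶠ τ in 𝓝[J] s, γ τ ∈ (chartAt E x₀).source)
    (hc : HasDerivWithinAt (fun τ ↦ extChartAt 𝓘(ℝ, E) x₀ (γ τ)) u J s) :
    ‖velocity 𝓘(ℝ, E) γ J s‖ = √(chartMetric E x₀ (extChartAt 𝓘(ℝ, E) x₀ (γ s)) u u) := by
  rw [← sq_norm_velocity hs hsJ hsrc hc, Real.sqrt_sq (norm_nonneg _)]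

/-- The length of a curve in a chart. -/
lemma pathELength_eq_lintegral_chart {γ : ℝ → S} {c₁ : ℝ → E} {a b : ℝ} {x₀ : S}
    (hsrc : ∀ t ∈ Ioo a b, ∀ᶠ τ in 𝓝 t, γ τ ∈ (chartAt E x₀).source)
    (hc : ∀ t ∈ Ioo a b, HasDerivAt (fun τ ↦ extChartAt 𝓘(ℝ, E) x₀ (γ τ)) (c₁ t) t) :
    pathELength 𝓘(ℝ, E) γ a b = ∫⁻ t in Ioo a b,
      ENNReal.ofReal √(chartMetric E x₀ (extChartAt 𝓘(ℝ, E) x₀ (γ t)) (c₁ t) (c₁ t)) := by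
  rw [pathELength_eq_lintegral_mfderiv_Ioo]
  refine MeasureTheory.setLIntegral_congr_fun measurableSet_Ioo fun t ht ↦ ?_
  have h := norm_velocity_eq_sqrt (J := univ) uniqueDiffWithinAt_univ (mem_univ t)
    (by rw [nhdsWithin_univ]; exact hsrc t ht) (hc t ht).hasDerivWithinAt
  rw [← h, velocity, mfderivWithin_univ, ofReal_norm]
  rfl

/-- A curve in a chart with speed at most `K` bounds the distance of its end points. -/
lemma dist_le_of_chart_curve {x₀ : S} {c c₁ : ℝ → E} {a b K : ℝ} (hab : a ≤ b)
    (hT : ∀ t ∈ Icc a b, c t ∈ (extChartAt 𝓘(ℝ, E) x₀).target)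
    (hc : ∀ t ∈ Icc a b, HasDerivAt c (c₁ t) t) (hc₁ : ContinuousOn c₁ (Icc a b))
    (hK : ∀ t ∈ Icc a b, √(chartMetric E x₀ (c t) (c₁ t) (c₁ t)) ≤ K) :
    riemannianEDist 𝓘(ℝ, E) ((extChartAt 𝓘(ℝ, E) x₀).symm (c a))
      ((extChartAt 𝓘(ℝ, E) x₀).symm (c b)) ≤ ENNReal.ofReal (K * (b - a)) := by
  rcases hab.eq_or_lt with rfl | hlt
  · simp [riemannianEDist_self]
  have hCD : ContDiffOn ℝ 1 c (Icc a b) := by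
    rw [contDiffOn_one_iff_derivWithin (uniqueDiffOn_Icc hlt)]
    exact ⟨fun t ht ↦ (hc t ht).differentiableAt.differentiableWithinAt, hc₁.congr fun t ht ↦
      (hc t ht).hasDerivWithinAt.derivWithin (uniqueDiffOn_Icc hlt t ht)⟩
  have hCM : ContMDiffOn 𝓘(ℝ, ℝ) 𝓘(ℝ, E) 1 (fun t ↦ (extChartAt 𝓘(ℝ, E) x₀).symm (c t)) (Icc a b) :=
    ((contMDiffOn_extChartAt_symm x₀).of_le (n := ∞) (by exact ENat.LEInfty.out)).comp
        hCD.contMDiffOn hT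
  refine (riemannianEDist_le_pathELength hCM rfl rfl hab).trans ?_
  have hnear : ∀ t ∈ Icc a b, ∀ᶠ τ in 𝓝 t, c τ ∈ (extChartAt 𝓘(ℝ, E) x₀).target := fun t ht ↦
    (hc t ht).continuousAt.eventually_mem ((isOpen_extChartAt_target x₀).mem_nhds (hT t ht))
  rw [pathELength_eq_lintegral_chart (x₀ := x₀) (c₁ := c₁)]
  · calc _ ≤ ∫⁻ _ in Ioo a b, ENNReal.ofReal K := by
          refine MeasureTheory.setLIntegral_mono' measurableSet_Ioo fun t ht ↦ ?_
          have ht' := Ioo_subset_Icc_self ht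
          rw [(extChartAt 𝓘(ℝ, E) x₀).right_inv (hT t ht')]
          exact ENNReal.ofReal_le_ofReal (hK t ht')
      _ = ENNReal.ofReal (K * (b - a)) := by
          rw [MeasureTheory.setLIntegral_const, Real.volume_Ioo, ENNReal.ofReal_mul]
          exact (Real.sqrt_nonneg _).trans (hK a ⟨le_rfl, hab⟩)
  · intro t ht
    filter_upwards [hnear t (Ioo_subset_Icc_self ht)] with τ hτ
    rw [← extChartAt_source 𝓘(ℝ, E)]
    exact (extChartAt 𝓘(ℝ, E) x₀).map_target hτ
  · intro t ht
    refine (hc t (Ioo_subset_Icc_self ht)).congr_of_eventuallyEq ?_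
    filter_upwards [hnear t (Ioo_subset_Icc_self ht)] with τ hτ
    exact (extChartAt 𝓘(ℝ, E) x₀).right_inv hτ

end ChartLength

/-! ### Comparison of coordinate geodesics and curves with the distance -/

section LocalMinimizers

set_option linter.unusedSectionVars false

variable {E : Type*} [NormedAddCommGroup E] [NormedSpace ℝ E] [FiniteDimensional ℝ E]
  {S : Type*} [TopologicalSpace S] [ChartedSpace E S]
  [RiemannianBundle (fun x : S ↦ TangentSpace 𝓘(ℝ, E) x)] [IsManifold 𝓘(ℝ, E) ∞ S]
  [IsContMDiffRiemannianBundle 𝓘(ℝ, E) ∞ E (fun x : S ↦ TangentSpace 𝓘(ℝ, E) x)]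

lemma nontrivial_Icc {a b : ℝ} (h : a < b) : (Icc a b).Nontrivial :=
  ⟨a, left_mem_Icc.2 h.le, b, right_mem_Icc.2 h.le, h.ne⟩

lemma IsGeodesicWithSpeed.dist_le {k : ℝ} {γ : ℝ → S} {J : Set ℝ} (h : IsGeodesicWithSpeed E k γ J)
    {s t : ℝ} (hs : s ∈ J) (ht : t ∈ J) (hst : s ≤ t) :
    riemannianEDist 𝓘(ℝ, E) (γ s) (γ t) ≤ ENNReal.ofReal (√k * (t - s)) := by
  rcases hst.eq_or_lt with rfl | hlt
  · simp [riemannianEDist_self]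
  have hI : IsGeodesicWithSpeed E k γ (Icc s t) := h.mono (h.ordConnected.out hs ht)
    ordConnected_Icc (nontrivial_Icc hlt) fun _ _ ↦ rfl
  refine (riemannianEDist_le_pathELength (hI.contMDiffOn.of_le (by norm_num)) rfl rfl hst).trans ?_
  rw [pathELength_eq_lintegral_mfderivWithin_Icc]
  have hk := (isGeodesicWithSpeed_iff.1 hI).2
  calc _ = ∫⁻ _ in Icc s t, ENNReal.ofReal √k := by
        refine MeasureTheory.setLIntegral_congr_fun measurableSet_Icc fun τ hτ ↦ ?_
        rw [← hk τ hτ, Real.sqrt_sq (norm_nonneg _), ofReal_norm]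
        rfl
    _ ≤ ENNReal.ofReal (√k * (t - s)) := by
        rw [MeasureTheory.setLIntegral_const, Real.volume_Icc, ENNReal.ofReal_mul (Real.sqrt_nonneg
            _)]

lemma IsFlatGeodesic.isGeodesicWithSpeed {x₀ : S} {c c₁ : ℝ → E}
    (hc : IsFlatGeodesic (chartMetric E x₀) c c₁)
    (hT : ∀ t ∈ Icc (0 : ℝ) 1, c t ∈ (extChartAt 𝓘(ℝ, E) x₀).target) :
    IsGeodesicWithSpeed E (chartMetric E x₀ (c 0) (c₁ 0) (c₁ 0))
      (fun t ↦ (extChartAt 𝓘(ℝ, E) x₀).symm (c t)) (Icc 0 1) := by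
  refine isGeodesicWithSpeed_of_exists ordConnected_Icc (nontrivial_Icc one_pos)
    fun s hs ↦ ⟨x₀, c₁, ?_⟩
  filter_upwards [self_mem_nhdsWithin] with τ hτ
  have hr : ∀ t ∈ Icc (0 : ℝ) 1,
      extChartAt 𝓘(ℝ, E) x₀ ((extChartAt 𝓘(ℝ, E) x₀).symm (c t)) = c t :=
    fun t ht ↦ (extChartAt 𝓘(ℝ, E) x₀).right_inv (hT t ht)
  refine ⟨?_, (hc.hasDerivAt τ hτ).hasDerivWithinAt.congr hr (hr τ hτ), ?_, ?_⟩
  · rw [← extChartAt_source 𝓘(ℝ, E)]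
    exact (extChartAt 𝓘(ℝ, E) x₀).map_target (hT τ hτ)
  · rw [hr τ hτ]
    exact (hc.hasDerivAt_velocity τ hτ).hasDerivWithinAt
  · rw [hr τ hτ]
    exact hc.speed_const (isMetricOn_chartMetric x₀) hT τ hτ

/-- The length of a `C¹` curve inside a chart, as an interval integral. -/
lemma exists_chart_length {σ : ℝ → S} (hσ : ContMDiff 𝓘(ℝ, ℝ) 𝓘(ℝ, E) 1 σ) {x₀ : S}
    (hsrc : ∀ t ∈ Icc (0 : ℝ) 1, σ t ∈ (chartAt E x₀).source) :
    ∃ σ₁ : ℝ → E, (∀ t ∈ Icc (0 : ℝ) 1,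
        HasDerivAt (fun τ ↦ extChartAt 𝓘(ℝ, E) x₀ (σ τ)) (σ₁ t) t) ∧ ContinuousOn σ₁ (Icc 0 1) ∧
      pathELength 𝓘(ℝ, E) σ 0 1 = ENNReal.ofReal (∫ t in (0 : ℝ)..1,
        √(chartMetric E x₀ (extChartAt 𝓘(ℝ, E) x₀ (σ t)) (σ₁ t) (σ₁ t))) := by
  set f : ℝ → E := fun τ ↦ extChartAt 𝓘(ℝ, E) x₀ (σ τ)
  have hO : IsOpen (σ ⁻¹' (chartAt E x₀).source) :=
    (chartAt E x₀).open_source.preimage hσ.continuous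
  have hf : ContDiffOn ℝ 1 f (σ ⁻¹' (chartAt E x₀).source) := by
    rw [← contMDiffOn_iff_contDiffOn]
    exact ((contMDiffOn_extChartAt (n := ∞)).of_le (by exact ENat.LEInfty.out)).comp hσ.contMDiffOn
      fun t ht ↦ ht
  have hd : ∀ t ∈ Icc (0 : ℝ) 1, HasDerivAt f (deriv f t) t := fun t ht ↦
    ((hf.differentiableOn one_ne_zero).differentiableAt (hO.mem_nhds (hsrc t ht))).hasDerivAt
  have hcont : ContinuousOn (deriv f) (Icc 0 1) :=
    (hf.continuousOn_deriv_of_isOpen hO le_rfl).mono hsrc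
  have hG := isMetricOn_chartMetric (E := E) x₀
  have hint : ContinuousOn (fun t ↦ √(chartMetric E x₀ (f t) (deriv f t) (deriv f t)))
      (Icc 0 1) := by
    have h1 : ContinuousOn (fun t ↦ chartMetric E x₀ (f t)) (Icc 0 1) :=
      hG.contDiffOn.continuousOn.comp (fun t ht ↦ (hd t ht).continuousAt.continuousWithinAt)
        fun t ht ↦ extChartAt_mem_target (hsrc t ht)
    exact ((h1.clm_apply hcont).clm_apply hcont).sqrt
  refine ⟨deriv f, hd, hcont, ?_⟩
  rw [pathELength_eq_lintegral_chart (x₀ := x₀) (c₁ := deriv f)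
    (fun t ht ↦ hO.mem_nhds (hsrc t (Ioo_subset_Icc_self ht)))
    (fun t ht ↦ hd t (Ioo_subset_Icc_self ht)), intervalIntegral.integral_of_le zero_le_one,
    MeasureTheory.integral_Ioc_eq_integral_Ioo, MeasureTheory.ofReal_integral_eq_lintegral_ofReal]
  · exact (hint.integrableOn_Icc).mono_set Ioo_subset_Icc_self
  · exact Eventually.of_forall fun _ ↦ Real.sqrt_nonneg _

end LocalMinimizers

/-! ### Existence of minimizing segments -/

section Segments

set_option linter.unusedSectionVars false

variable {E : Type*} [NormedAddCommGroup E] [NormedSpace ℝ E] [FiniteDimensional ℝ E]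
  {S : Type*} [TopologicalSpace S] [T2Space S] [ConnectedSpace S] [ChartedSpace E S]
  [RiemannianBundle (fun x : S ↦ TangentSpace 𝓘(ℝ, E) x)] [IsManifold 𝓘(ℝ, E) ∞ S]
  [IsContMDiffRiemannianBundle 𝓘(ℝ, E) ∞ E (fun x : S ↦ TangentSpace 𝓘(ℝ, E) x)]

variable (E) in
/-- Nearby points are joined to `p` by geodesics whose length is the distance. -/
theorem eventually_exists_minimizing_geodesic (p : S) :
    ∀ᶠ z in 𝓝 p, ∃ γ : ℝ → S, γ 0 = p ∧ γ 1 = z ∧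
      IsGeodesicWithSpeed E ((riemannianEDist 𝓘(ℝ, E) p z).toReal ^ 2) γ (Icc 0 1) := by
  set φ := extChartAt 𝓘(ℝ, E) p
  have hG := isMetricOn_chartMetric (E := E) p
  have hp : φ p ∈ φ.target := mem_extChartAt_target p
  obtain ⟨R, hR, hRT, hmain⟩ := hG.exists_minimizing_geodesic hp
  have hnear : φ.source ∩ φ ⁻¹' Metric.ball (φ p) R ∈ 𝓝 p :=
    inter_mem (extChartAt_source_mem_nhds p)
      ((continuousAt_extChartAt p).preimage_mem_nhds (Metric.ball_mem_nhds _ hR))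
  obtain ⟨r, hr, hsub⟩ := exists_dist_ball_subset (E := E) hnear
  -- A competitor shorter than a geodesic of length less than ε ≤ r cannot leave the coordinate ball
  -- on which the minimality of that geodesic is known.
  obtain ⟨ε, hε, hεr⟩ : ∃ ε > (0 : ℝ), ENNReal.ofReal ε ≤ r := by
    rcases eq_or_ne r ⊤ with rfl | hr'
    · exact ⟨1, one_pos, le_top⟩
    · exact ⟨r.toReal, ENNReal.toReal_pos hr.ne' hr', ENNReal.ofReal_toReal_le⟩
  filter_upwards [(continuousAt_extChartAt p).eventually (hmain ε hε),
    extChartAt_source_mem_nhds (I := 𝓘(ℝ, E)) p] with z ⟨c, c₁, hc, h0, h1, hball, hlt, hmin⟩ hz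
  have hT : ∀ t ∈ Icc (0 : ℝ) 1, c t ∈ φ.target := fun t ht ↦ hRT (hball t ht)
  have hgeo := hc.isGeodesicWithSpeed hT
  have e0 : φ.symm (c 0) = p := by rw [h0]; exact extChartAt_to_inv p
  have e1 : φ.symm (c 1) = z := by rw [h1]; exact φ.left_inv hz
  rw [h0] at hgeo
  set κ := √(chartMetric E p (φ p) (c₁ 0) (c₁ 0))
  have hκ : 0 ≤ κ := Real.sqrt_nonneg _
  have hle : riemannianEDist 𝓘(ℝ, E) p z ≤ ENNReal.ofReal κ := by
    have := hgeo.dist_le (left_mem_Icc.2 zero_le_one) (right_mem_Icc.2 zero_le_one) zero_le_one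
    change riemannianEDist 𝓘(ℝ, E) (φ.symm (c 0)) (φ.symm (c 1)) ≤ _ at this
    simpa only [e0, e1, sub_zero, mul_one] using this
  have hge : ENNReal.ofReal κ ≤ riemannianEDist 𝓘(ℝ, E) p z := by
    by_contra! hcon
    obtain ⟨σ, s0, s1, hσ, hlen, -⟩ :=
      exists_lt_locally_constant_of_riemannianEDist_lt hcon zero_lt_one
    have hin : ∀ t ∈ Icc (0 : ℝ) 1, σ t ∈ φ.source ∩ φ ⁻¹' Metric.ball (φ p) R := by
      intro t ht
      refine hsub ?_
      calc riemannianEDist 𝓘(ℝ, E) p (σ t) ≤ pathELength 𝓘(ℝ, E) σ 0 t :=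
            riemannianEDist_le_pathELength hσ.contMDiffOn s0 rfl ht.1
        _ ≤ pathELength 𝓘(ℝ, E) σ 0 1 := pathELength_mono le_rfl ht.2
        _ < ENNReal.ofReal κ := hlen
        _ ≤ r := (ENNReal.ofReal_le_ofReal hlt.le).trans hεr
    obtain ⟨σ₁, d1, d2, d3⟩ := exists_chart_length hσ (x₀ := p) fun t ht ↦ by
      simpa [φ] using (hin t ht).1
    have := hmin _ σ₁ d1 d2 (fun t ht ↦ (hin t ht).2) (by rw [s0]) (by rw [s1])
    rw [d3] at hlen
    exact hlen.not_ge (ENNReal.ofReal_le_ofReal this)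
  have heq : (riemannianEDist 𝓘(ℝ, E) p z).toReal = κ := by
    rw [le_antisymm hle hge, ENNReal.toReal_ofReal hκ]
  refine ⟨fun t ↦ φ.symm (c t), e0, e1, ?_⟩
  rw [heq, Real.sq_sqrt (hG.nonneg hp _)]
  exact hgeo

variable {C : Set S}

lemma isMinimizingSegment_iff {γ : ℝ → S} {J : Set ℝ} : IsMinimizingSegment E C γ J ↔
    IsGeodesicWithSpeed E 1 γ J ∧ ∀ s ∈ J, rho E C (γ s) = s := by
  rw [isGeodesicWithSpeed_iff]
  constructor
  · exact fun h ↦ ⟨⟨h.geodesic, fun s hs ↦ by rw [h.unitSpeed s hs, one_pow]⟩, h.rho_eq⟩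
  · exact fun h ↦ ⟨h.1.1, fun s hs ↦ (pow_eq_one_iff_of_nonneg (norm_nonneg _) two_ne_zero).1
      (h.1.2 s hs), h.2⟩

/-- Each point outside `C` is the end point of a minimizing segment. -/
theorem exists_isMinimizingSegment (hC : IsClosed C) (hne : C.Nonempty) {p : S} (hp : p ∉ C) :
    ∃ (γ : ℝ → S) (ε : ℝ), 0 < ε ∧
      IsMinimizingSegment E C γ (Icc (rho E C p - ε) (rho E C p)) ∧ γ (rho E C p) = p := by
  set φ := extChartAt 𝓘(ℝ, E) p
  have hp' : φ p ∈ φ.target := mem_extChartAt_target p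
  have hgood := inter_mem (eventually_exists_minimizing_geodesic E p) (hC.isOpen_compl.mem_nhds hp)
  have hpre : φ.target ∩ φ.symm ⁻¹' ({z | ∃ γ : ℝ → S, γ 0 = p ∧ γ 1 = z ∧
      IsGeodesicWithSpeed E ((riemannianEDist 𝓘(ℝ, E) p z).toReal ^ 2) γ (Icc 0 1)} ∩ Cᶜ)
      ∈ 𝓝 (φ p) := by
    refine inter_mem (extChartAt_target_mem_nhds p) ?_
    refine (continuousAt_extChartAt_symm p).preimage_mem_nhds ?_
    rw [extChartAt_to_inv p]
    exact hgood
  obtain ⟨ε, hε, hsub⟩ := Metric.nhds_basis_closedBall.mem_iff.1 hpre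
  -- The frontier of V lies in the compact set K, which misses C and all of whose points are joined
  -- to p by geodesics of length equal to the distance.
  set V : Set S := φ.source ∩ φ ⁻¹' Metric.ball (φ p) ε
  have hV : IsOpen V := isOpen_extChartAt_preimage' p Metric.isOpen_ball
  set K : Set S := φ.symm '' Metric.closedBall (φ p) ε
  have hK : IsCompact K := (isCompact_closedBall _ _).image_of_continuousOn
    ((continuousOn_extChartAt_symm p).mono fun y hy ↦ (hsub hy).1)
  have hVK : V ⊆ K := fun z hz ↦ ⟨φ z, Metric.ball_subset_closedBall hz.2, φ.left_inv hz.1⟩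
  have hfK : frontier V ⊆ K := frontier_subset_closure.trans (closure_minimal hVK hK.isClosed)
  have hKC : ∀ z ∈ K, z ∉ C := by
    rintro _ ⟨y, hy, rfl⟩
    exact (hsub hy).2.2
  have hpV : p ∈ V := ⟨mem_extChartAt_source p, Metric.mem_ball_self hε⟩
  obtain ⟨z, hz, hrho⟩ := exists_frontier_rho_eq (E := E) hne hV
    (hK.of_isClosed_subset isClosed_frontier hfK) hpV
    (disjoint_left.2 fun z hz hzV ↦ hKC z (hVK hzV) hz)
  have hzp : z ≠ p := by
    rintro rfl
    rw [hV.frontier_eq] at hz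
    exact hz.2 hpV
  obtain ⟨γ, g0, g1, hγ⟩ : ∃ γ : ℝ → S, γ 0 = p ∧ γ 1 = z ∧
      IsGeodesicWithSpeed E ((riemannianEDist 𝓘(ℝ, E) p z).toReal ^ 2) γ (Icc 0 1) := by
    obtain ⟨y, hy, rfl⟩ := hfK hz
    exact (hsub hy).2.1
  set κ := (riemannianEDist 𝓘(ℝ, E) p z).toReal
  have hκ : 0 < κ := by
    obtain ⟨c, hc, hcs⟩ := exists_dist_ball_subset (E := E) (isOpen_ne.mem_nhds hzp.symm :
      {w | w ≠ z} ∈ 𝓝 p)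
    refine ENNReal.toReal_pos (fun h0 ↦ ?_) (dist_ne_top E p z)
    exact hcs (show z ∈ {y | riemannianEDist 𝓘(ℝ, E) p y < c} by simpa [h0] using hc) rfl
  have hdist : ∀ s ∈ Icc (0 : ℝ) 1, ∀ t ∈ Icc (0 : ℝ) 1, s ≤ t →
      (riemannianEDist 𝓘(ℝ, E) (γ s) (γ t)).toReal ≤ κ * (t - s) := by
    intro s hs t ht hst
    have := hγ.dist_le hs ht hst
    rw [Real.sqrt_sq hκ.le] at this
    exact ENNReal.toReal_le_of_le_ofReal (mul_nonneg hκ.le (sub_nonneg.2 hst)) this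
  -- ρ drops by exactly κ along a curve of length κ; being 1-Lipschitz, it must drop at the full
  -- rate throughout.
  have hrho' : ∀ t ∈ Icc (0 : ℝ) 1, rho E C (γ t) = rho E C p - κ * t := by
    intro t ht
    have h1 := (rho_le_dist_add (E := E) hne (γ 0) (γ t)).trans (add_le_add_left
      (hdist 0 (by simp) t ht ht.1) _)
    have h2 := (rho_le_dist_add (E := E) hne (γ t) (γ 1)).trans (add_le_add_left
      (hdist t ht 1 (by simp) ht.2) _)
    rw [g0] at h1
    rw [g1] at h2
    linarith
  have hb : -κ⁻¹ ≠ 0 := by simpa using hκ.ne'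
  -- The new parameter is the value of ρ: it reverses the direction and normalizes the speed κ to 1.
  have haff := hγ.comp_affine (rho E C p / κ) hb
  have hset : {τ | rho E C p / κ + -κ⁻¹ * τ ∈ Icc (0 : ℝ) 1} =
      Icc (rho E C p - κ) (rho E C p) := by
    ext τ
    have : rho E C p / κ + -κ⁻¹ * τ = (rho E C p - τ) / κ := by ring
    rw [mem_ofPred_eq, this, mem_Icc, mem_Icc, le_div_iff₀ hκ, div_le_iff₀ hκ]
    constructor <;> rintro ⟨h1, h2⟩ <;> constructor <;> linarith
  rw [hset, show (-κ⁻¹) ^ 2 * κ ^ 2 = 1 by field_simp] at haff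
  refine ⟨_, κ, hκ, isMinimizingSegment_iff.2 ⟨haff, fun s hs ↦ ?_⟩, ?_⟩
  · rw [← hset] at hs
    rw [hrho' _ hs]
    field_simp
    ring
  · rw [show rho E C p / κ + -κ⁻¹ * rho E C p = 0 by ring, g0]

end Segments

/-! ### Minimizing segments have no corners -/

section Join

set_option linter.unusedSectionVars false

variable {E : Type*} [NormedAddCommGroup E] [NormedSpace ℝ E] [FiniteDimensional ℝ E]
  {S : Type*} [TopologicalSpace S] [T2Space S] [ConnectedSpace S] [ChartedSpace E S]
  [RiemannianBundle (fun x : S ↦ TangentSpace 𝓘(ℝ, E) x)] [IsManifold 𝓘(ℝ, E) ∞ S]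
  [IsContMDiffRiemannianBundle 𝓘(ℝ, E) ∞ E (fun x : S ↦ TangentSpace 𝓘(ℝ, E) x)]

/-- Near `x₀` the distance is bounded by that of the metric frozen at `x₀`. -/
lemma exists_dist_le_frozen (x₀ : S) {b : ℝ} (hb : 1 < b) :
    ∃ r > (0 : ℝ), ∀ y ∈ Metric.ball (extChartAt 𝓘(ℝ, E) x₀ x₀) r,
      ∀ z ∈ Metric.ball (extChartAt 𝓘(ℝ, E) x₀ x₀) r,
      (riemannianEDist 𝓘(ℝ, E) ((extChartAt 𝓘(ℝ, E) x₀).symm y)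
        ((extChartAt 𝓘(ℝ, E) x₀).symm z)).toReal ≤
      √(b * chartMetric E x₀ (extChartAt 𝓘(ℝ, E) x₀ x₀) (z - y) (z - y)) := by
  have hx : extChartAt 𝓘(ℝ, E) x₀ x₀ ∈ (extChartAt 𝓘(ℝ, E) x₀).target := mem_extChartAt_target x₀
  obtain ⟨r, hr, hsub⟩ := Metric.mem_nhds_iff.1 (inter_mem (extChartAt_target_mem_nhds x₀)
    ((isMetricOn_chartMetric (E := E) x₀).eventually_apply_le hx hb))
  refine ⟨r, hr, fun y hy z hz ↦ ?_⟩
  -- The competitor for the distance is the straight line in coordinates.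
  have hline : ∀ t ∈ Icc (0 : ℝ) 1, y + t • (z - y) ∈ Metric.ball (extChartAt 𝓘(ℝ, E) x₀ x₀) r :=
    fun t ht ↦ (convex_ball _ r).add_smul_sub_mem hy hz ht
  have hd : ∀ t ∈ Icc (0 : ℝ) 1, HasDerivAt (fun t : ℝ ↦ y + t • (z - y)) (z - y) t := fun t _ ↦ by
    simpa using ((hasDerivAt_id t).smul_const (z - y)).const_add y
  have := dist_le_of_chart_curve (E := E) (S := S) (x₀ := x₀) (c₁ := fun _ ↦ z - y) zero_le_one
    (fun t ht ↦ (hsub (hline t ht)).1) hd continuousOn_const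
    (fun t ht ↦ Real.sqrt_le_sqrt ((hsub (hline t ht)).2 (z - y)))
  simp only [zero_smul, add_zero, one_smul, add_sub_cancel, sub_zero, mul_one] at this
  exact ENNReal.toReal_le_of_le_ofReal (Real.sqrt_nonneg _) this

variable {C : Set S} {γ : ℝ → S} {J : Set ℝ} {m : ℝ}

/-- The points with parameters m ± ε have ρ-values differing by 2ε, so their distance is at least
2ε. The coordinate chord between them divided by ε tends to u + v, and its length bounds the
distance up to a factor √b with b arbitrarily close to 1. -/
lemma four_le_of_one_sided_derivatives (hne : C.Nonempty) {x₀ : S} {δ : ℝ} (hδ : 0 < δ)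
    (hrho : ∀ s ∈ Icc (m - δ) (m + δ), rho E C (γ s) = s) (hx₀ : γ m = x₀)
    (hsrc : ∀ s ∈ Icc (m - δ) (m + δ), γ s ∈ (chartAt E x₀).source) {u v : E}
    (hu : HasDerivWithinAt (fun τ ↦ extChartAt 𝓘(ℝ, E) x₀ (γ τ)) u (Icc (m - δ) m) m)
    (hv : HasDerivWithinAt (fun τ ↦ extChartAt 𝓘(ℝ, E) x₀ (γ τ)) v (Icc m (m + δ)) m) :
    4 ≤ chartMetric E x₀ (extChartAt 𝓘(ℝ, E) x₀ x₀) (u + v) (u + v) := by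
  set x := extChartAt 𝓘(ℝ, E) x₀ x₀
  set G := chartMetric E x₀ x
  set f : ℝ → E := fun τ ↦ extChartAt 𝓘(ℝ, E) x₀ (γ τ)
  have hR : HasDerivWithinAt (fun ε : ℝ ↦ f (m + ε)) v (Icc 0 δ) 0 := by
    have h : HasDerivWithinAt (fun ε : ℝ ↦ m + ε) 1 (Icc 0 δ) 0 :=
      ((hasDerivAt_id (0 : ℝ)).const_add m).hasDerivWithinAt
    have hv' : HasDerivWithinAt f v (Icc m (m + δ)) (m + 0) := by simpa using hv
    have := HasDerivWithinAt.scomp (0 : ℝ) hv' h fun ε hε ↦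
      ⟨by linarith [hε.1], by linarith [hε.2]⟩
    rwa [one_smul] at this
  have hL : HasDerivWithinAt (fun ε : ℝ ↦ f (m - ε)) (-u) (Icc 0 δ) 0 := by
    have h : HasDerivWithinAt (fun ε : ℝ ↦ m - ε) (-1) (Icc 0 δ) 0 :=
      ((hasDerivAt_id (0 : ℝ)).const_sub m).hasDerivWithinAt
    have hu' : HasDerivWithinAt f u (Icc (m - δ) m) (m - 0) := by simpa using hu
    have := HasDerivWithinAt.scomp (0 : ℝ) hu' h fun ε hε ↦
      ⟨by linarith [hε.2], by linarith [hε.1]⟩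
    rwa [neg_one_smul] at this
  have hmono : 𝓝[>] (0 : ℝ) ≤ 𝓝[Icc 0 δ] 0 := by
    refine le_inf nhdsWithin_le_nhds ?_
    rw [le_principal_iff]
    exact mem_of_superset (Ioo_mem_nhdsGT hδ) Ioo_subset_Icc_self
  have hlim : Tendsto (fun ε : ℝ ↦ ε⁻¹ • (f (m + ε) - f (m - ε))) (𝓝[>] 0) (𝓝 (u + v)) := by
    have h := (hR.sub hL).mono_of_mem_nhdsWithin (hmono self_mem_nhdsWithin : Icc 0 δ ∈ 𝓝[Ioi (0 :
        ℝ)] 0)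
    rw [hasDerivWithinAt_iff_tendsto_slope' (by simp)] at h
    have e : v - -u = u + v := by abel
    rw [e] at h
    refine h.congr fun ε ↦ ?_
    simp [slope_def_module]
  have hx : f m = x := by simp only [f, hx₀, x]
  have hfR : Tendsto (fun ε ↦ f (m + ε)) (𝓝[>] 0) (𝓝 x) := by
    have := hR.continuousWithinAt.mono_left hmono
    simpa [hx] using this
  have hfL : Tendsto (fun ε ↦ f (m - ε)) (𝓝[>] 0) (𝓝 x) := by
    have := hL.continuousWithinAt.mono_left hmono
    simpa [hx] using this
  have hGlim : Tendsto (fun ε : ℝ ↦ G (ε⁻¹ • (f (m + ε) - f (m - ε)))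
      (ε⁻¹ • (f (m + ε) - f (m - ε)))) (𝓝[>] 0) (𝓝 (G (u + v) (u + v))) := by
    have : Continuous fun w : E ↦ G w w := by fun_prop
    exact (this.tendsto _).comp hlim
  have key : ∀ b : ℝ, 1 < b → 4 ≤ b * G (u + v) (u + v) := by
    intro b hb
    refine ge_of_tendsto (hGlim.const_mul b) ?_
    obtain ⟨r, hr, hsub⟩ := exists_dist_le_frozen (E := E) x₀ hb
    filter_upwards [hfR (Metric.ball_mem_nhds _ hr), hfL (Metric.ball_mem_nhds _ hr),
      Ioo_mem_nhdsGT hδ] with ε h1 h2 hε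
    have m1 : m + ε ∈ Icc (m - δ) (m + δ) := by constructor <;> linarith [hε.1, hε.2]
    have m2 : m - ε ∈ Icc (m - δ) (m + δ) := by constructor <;> linarith [hε.1, hε.2]
    have hd := hsub _ h2 _ h1
    simp only [f] at hd
    rw [extChartAt_symm_apply (hsrc _ m1), extChartAt_symm_apply (hsrc _ m2)] at hd
    have hl := (le_abs_self _).trans ((abs_rho_sub_le (E := E) hne _ _).trans (riemannianEDist_comm
      (I := 𝓘(ℝ, E)) (x := γ (m - ε)) ▸ hd))
    rw [hrho _ m1, hrho _ m2] at hl
    have h4 : (2 * ε) ^ 2 ≤ b * G (f (m + ε) - f (m - ε)) (f (m + ε) - f (m - ε)) := by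
      refine (Real.le_sqrt' (by linarith [hε.1])).1 (le_trans (by linarith) hl)
    simp only [map_smul, smul_apply, smul_eq_mul]
    have hε2 : 0 < ε ^ 2 := by have := hε.1; positivity
    have : b * (ε⁻¹ * (ε⁻¹ * G (f (m + ε) - f (m - ε)) (f (m + ε) - f (m - ε)))) =
        b * G (f (m + ε) - f (m - ε)) (f (m + ε) - f (m - ε)) / ε ^ 2 := by
      field_simp
    rw [this, le_div_iff₀ hε2]
    linarith
  refine ge_of_tendsto (f := fun b : ℝ ↦ b * G (u + v) (u + v)) (x := 𝓝[>] 1) ?_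
    (by filter_upwards [self_mem_nhdsWithin] with b hb using key b hb)
  have : Tendsto (fun b : ℝ ↦ b * G (u + v) (u + v)) (𝓝 1) (𝓝 (1 * G (u + v) (u + v))) :=
    (continuous_id.mul continuous_const).tendsto 1
  rw [one_mul] at this
  exact this.mono_left nhdsWithin_le_nhds

/-- Minimizing segments that meet at a point with the right parameters form a geodesic. -/
theorem IsMinimizingSegment.join (hne : C.Nonempty) (hJ : J.OrdConnected) (hm : m ∈ J)
    (hL : IsMinimizingSegment E C γ (J ∩ Iic m)) (hR : IsMinimizingSegment E C γ (J ∩ Ici m)) :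
    IsMinimizingSegment E C γ J := by
  rw [isMinimizingSegment_iff] at hL hR ⊢
  obtain ⟨hLg, hLr⟩ := hL
  obtain ⟨hRg, hRr⟩ := hR
  have hrho : ∀ s ∈ J, rho E C (γ s) = s := fun s hs ↦ (le_total s m).elim
    (fun h ↦ hLr s ⟨hs, h⟩) fun h ↦ hRr s ⟨hs, h⟩
  refine ⟨isGeodesicWithSpeed_of_exists hJ (hLg.nontrivial.mono inter_subset_left) fun s hs ↦ ?_,
    hrho⟩
  rcases lt_trichotomy s m with h | rfl | h
  · obtain h' := (hLg.isSprayCurveAt s ⟨hs, h.le⟩ _ (mem_chart_source E (γ s))).mono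
      (inter_subset_inter_right J Iio_subset_Iic_self)
    exact ⟨_, h'.of_inter isOpen_Iio h⟩
  · refine ⟨γ s, IsSprayCurveAt.join hs (hLg.isSprayCurveAt s ⟨hs, self_mem_Iic⟩ _
      (mem_chart_source E (γ s))) (hRg.isSprayCurveAt s ⟨hs, self_mem_Ici⟩ _
      (mem_chart_source E (γ s))) fun u v hu hv hu1 hv1 ↦ ?_⟩
    obtain ⟨l, hl⟩ : ∃ l, l ∈ J ∧ l < s := by
      obtain ⟨a, ha, b, hb, hab⟩ := hLg.nontrivial.exists_lt
      exact ⟨a, ha.1, hab.trans_le hb.2⟩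
    obtain ⟨r, hr⟩ : ∃ r, r ∈ J ∧ s < r := by
      obtain ⟨a, ha, b, hb, hab⟩ := hRg.nontrivial.exists_lt
      exact ⟨b, hb.1, lt_of_le_of_lt ha.2 hab⟩
    have hcont : ContinuousWithinAt γ J s := by
      have := (hLg.continuousOn s ⟨hs, self_mem_Iic⟩).union (hRg.continuousOn s ⟨hs, self_mem_Ici⟩)
      rwa [← inter_union_distrib_left, Iic_union_Ici, inter_univ] at this
    obtain ⟨δ, hδ, hδs⟩ : ∃ δ > 0, Icc (s - δ) (s + δ) ⊆ J ∩ γ ⁻¹' (chartAt E (γ s)).source := by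
      have hJn : J ∈ 𝓝 s := mem_of_superset (Icc_mem_nhds hl.2 hr.2) (hJ.out hl.1 hr.1)
      have := inter_mem hJn ((hcont.continuousAt hJn).preimage_mem_nhds
        ((chartAt E (γ s)).open_source.mem_nhds (mem_chart_source E (γ s))))
      obtain ⟨δ, hδ, h⟩ := Metric.nhds_basis_closedBall.mem_iff.1 this
      exact ⟨δ, hδ, by rwa [← Real.closedBall_eq_Icc]⟩
    -- The one-sided velocities are unit vectors whose sum has length at least 2, so strict
    -- convexity makes them equal.
    refine (isMetricOn_chartMetric (E := E) (γ s)).eq_of_two_le (mem_extChartAt_target _) hu1 hv1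
      (four_le_of_one_sided_derivatives hne hδ (fun t ht ↦ hrho t (hδs ht).1) rfl
        (fun t ht ↦ (hδs ht).2) (hu.mono fun t ht ↦ ⟨(hδs ⟨ht.1, ht.2.trans (by linarith)⟩).1,
            ht.2⟩)
        (hv.mono fun t ht ↦ ⟨(hδs ⟨le_trans (by linarith) ht.1, ht.2⟩).1, ht.1⟩))
  · obtain h' := (hRg.isSprayCurveAt s ⟨hs, h.le⟩ _ (mem_chart_source E (γ s))).mono
      (inter_subset_inter_right J Ioi_subset_Ici_self)
    exact ⟨_, h'.of_inter isOpen_Ioi h⟩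

end Join

/-! ### Maximal minimizing segments -/

section Maximal

set_option linter.unusedSectionVars false

variable {E : Type*} [NormedAddCommGroup E] [NormedSpace ℝ E] [FiniteDimensional ℝ E]
  {S : Type*} [TopologicalSpace S] [T2Space S] [ConnectedSpace S] [ChartedSpace E S]
  [RiemannianBundle (fun x : S ↦ TangentSpace 𝓘(ℝ, E) x)] [IsManifold 𝓘(ℝ, E) ∞ S]
  [IsContMDiffRiemannianBundle 𝓘(ℝ, E) ∞ E (fun x : S ↦ TangentSpace 𝓘(ℝ, E) x)]
  {C : Set S} {γ γ' : ℝ → S} {J J' : Set ℝ}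

lemma IsSprayCurveAt.of_mem_nhdsWithin {k : ℝ} {x₀ : S} {s : ℝ} (h : IsSprayCurveAt E k x₀ γ J s)
    (hJ : J ∈ 𝓝[J'] s) (hγ : EqOn γ' γ J) : IsSprayCurveAt E k x₀ γ' J' s := by
  obtain ⟨V, hV, hsV, hVJ⟩ := mem_nhdsWithin.1 hJ
  have hsub : J' ∩ V ⊆ J := by rwa [inter_comm]
  exact (h.congr (nhdsWithin_mono _ hsub) hsub (hγ.mono hsub)).of_inter hV hsV

namespace IsMinimizingSegment

lemma isGeodesicWithSpeed (h : IsMinimizingSegment E C γ J) : IsGeodesicWithSpeed E 1 γ J :=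
  (isMinimizingSegment_iff.1 h).1

lemma ordConnected (h : IsMinimizingSegment E C γ J) : J.OrdConnected := h.geodesic.ordConnected

lemma nontrivial (h : IsMinimizingSegment E C γ J) : J.Nontrivial := h.geodesic.nontrivial

lemma continuousOn (h : IsMinimizingSegment E C γ J) : ContinuousOn γ J :=
  h.isGeodesicWithSpeed.continuousOn

lemma nonneg (h : IsMinimizingSegment E C γ J) {s : ℝ} (hs : s ∈ J) : 0 ≤ s :=
  h.rho_eq s hs ▸ rho_nonneg _

lemma mono (h : IsMinimizingSegment E C γ J) (hJ : J' ⊆ J) (hc : J'.OrdConnected)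
    (hn : J'.Nontrivial) (hγ : EqOn γ' γ J') : IsMinimizingSegment E C γ' J' :=
  isMinimizingSegment_iff.2 ⟨h.isGeodesicWithSpeed.mono hJ hc hn hγ, fun s hs ↦ by
    rw [hγ hs, h.rho_eq s (hJ hs)]⟩

lemma rho_image (h : IsMinimizingSegment E C γ J) : rho E C '' (γ '' J) = J := by
  rw [image_image]
  exact (image_congr h.rho_eq).trans (image_id _)

lemma apply_rho (h : IsMinimizingSegment E C γ J) {x : S} (hx : x ∈ γ '' J) :
    γ (rho E C x) = x := by
  obtain ⟨s, hs, rfl⟩ := hx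
  rw [h.rho_eq s hs]

lemma exists_pos (h : IsMinimizingSegment E C γ J) : ∃ s ∈ J, 0 < s := by
  obtain ⟨a, ha, b, hb, hab⟩ := h.nontrivial.exists_lt
  exact ⟨b, hb, (h.nonneg ha).trans_lt hab⟩

end IsMinimizingSegment

/-- On a segment ρ inverts the parametrization, so segments can be handled as subsets of S ordered
by inclusion. The union of a chain is parametrized by the inverse of ρ. -/
lemma isMinimizingSegment_sUnion {c : Set (Set S)}
    (hc : ∀ A ∈ c, ∃ γ J, IsMinimizingSegment E C γ J ∧ A = γ '' J)
    (hchain : IsChain (· ⊆ ·) c) (hne : c.Nonempty) :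
    ∃ γ J, IsMinimizingSegment E C γ J ∧ ⋃₀ c = γ '' J := by
  have : Nonempty S := inferInstance
  have hdir : ∀ x ∈ ⋃₀ c, ∀ y ∈ ⋃₀ c, ∃ A ∈ c, x ∈ A ∧ y ∈ A := by
    rintro x ⟨A, hA, hx⟩ y ⟨B, hB, hy⟩
    obtain ⟨D, hD, hAD, hBD⟩ := hchain.directedOn A hA B hB
    exact ⟨D, hD, hAD hx, hBD hy⟩
  have hdir3 : ∀ x ∈ ⋃₀ c, ∀ y ∈ ⋃₀ c, ∀ z ∈ ⋃₀ c, ∃ A ∈ c, x ∈ A ∧ y ∈ A ∧ z ∈ A := by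
    intro x hx y hy z hz
    obtain ⟨A, hA, hxA, hyA⟩ := hdir x hx y hy
    obtain ⟨B, hB, hxB, hzB⟩ := hdir x hx z hz
    obtain ⟨D, hD, hAD, hBD⟩ := hchain.directedOn A hA B hB
    exact ⟨D, hD, hAD hxA, hAD hyA, hBD hzB⟩
  have hinj : InjOn (rho E C) (⋃₀ c) := by
    intro x hx y hy hxy
    obtain ⟨A, hA, hxA, hyA⟩ := hdir x hx y hy
    obtain ⟨γ, J, hγ, rfl⟩ := hc A hA
    rw [← hγ.apply_rho hxA, hxy, hγ.apply_rho hyA]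
  set γ : ℝ → S := Function.invFunOn (rho E C) (⋃₀ c)
  set J : Set ℝ := rho E C '' ⋃₀ c
  have hγ : ∀ x ∈ ⋃₀ c, γ (rho E C x) = x := fun x hx ↦ hinj.leftInvOn_invFunOn hx
  have himg : ∀ A ∈ c, rho E C '' A ⊆ J := fun A hA ↦ image_mono (subset_sUnion_of_mem hA)
  refine ⟨γ, J, isMinimizingSegment_iff.2 ⟨isGeodesicWithSpeed_of_exists ⟨?_⟩ ?_ ?_, ?_⟩, ?_⟩
  · rintro _ ⟨x, hx, rfl⟩ _ ⟨y, hy, rfl⟩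
    obtain ⟨A, hA, hxA, hyA⟩ := hdir x hx y hy
    obtain ⟨η, K, hη, rfl⟩ := hc A hA
    refine Subset.trans ?_ (himg _ hA)
    rw [hη.rho_image]
    have := hη.rho_image (C := C)
    exact hη.ordConnected.out (this ▸ mem_image_of_mem _ hxA) (this ▸ mem_image_of_mem _ hyA)
  · obtain ⟨A, hA⟩ := hne
    have := himg A hA
    obtain ⟨η, K, hη, rfl⟩ := hc A hA
    rw [hη.rho_image] at this
    exact hη.nontrivial.mono this
  · intro s hs
    -- Parameters l ≤ s ≤ r are chosen that enclose a neighborhood of s in J, with s itself serving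
    -- at an end of J. One member of the chain contains both points, so near s the union coincides
    -- with it.
    obtain ⟨l, hl, hls, hlJ⟩ : ∃ l ∈ J, l ≤ s ∧ Ici l ∈ 𝓝[J] s := by
      by_cases h : ∃ l ∈ J, l < s
      · obtain ⟨l, hl, hls⟩ := h
        exact ⟨l, hl, hls.le, mem_nhdsWithin_of_mem_nhds (Ici_mem_nhds hls)⟩
      · push Not at h
        exact ⟨s, hs, le_rfl, mem_of_superset self_mem_nhdsWithin h⟩
    obtain ⟨r, hr, hsr, hrJ⟩ : ∃ r ∈ J, s ≤ r ∧ Iic r ∈ 𝓝[J] s := by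
      by_cases h : ∃ r ∈ J, s < r
      · obtain ⟨r, hr, hsr⟩ := h
        exact ⟨r, hr, hsr.le, mem_nhdsWithin_of_mem_nhds (Iic_mem_nhds hsr)⟩
      · push Not at h
        exact ⟨s, hs, le_rfl, mem_of_superset self_mem_nhdsWithin h⟩
    obtain ⟨x, hx, rfl⟩ := hl
    obtain ⟨y, hy, rfl⟩ := hr
    obtain ⟨A, hA, hxA, hyA⟩ := hdir x hx y hy
    obtain ⟨η, K, hη, rfl⟩ := hc A hA
    have hK := hη.rho_image
    have hsub : Icc (rho E C x) (rho E C y) ⊆ K :=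
      hη.ordConnected.out (hK ▸ mem_image_of_mem _ hxA) (hK ▸ mem_image_of_mem _ hyA)
    refine ⟨η s, (hη.isGeodesicWithSpeed.isSprayCurveAt s (hsub ⟨hls, hsr⟩) _
      (mem_chart_source E (η s))).of_mem_nhdsWithin
      (mem_of_superset (inter_mem hlJ hrJ) hsub) fun t ht ↦ ?_⟩
    have := hγ (η t) ⟨_, hA, mem_image_of_mem _ ht⟩
    rwa [hη.rho_eq t ht] at this
  · rintro _ ⟨x, hx, rfl⟩
    rw [hγ x hx]
  · rw [image_image, image_congr hγ, image_id']

/-- Zorn's lemma is applied to the images; inclusion of images is extension of segments. -/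
theorem IsMinimizingSegment.exists_isMaximalSegment (h : IsMinimizingSegment E C γ J) :
    ∃ γ' J', IsMaximalSegment E C γ' J' ∧ J ⊆ J' ∧ EqOn γ' γ J := by
  obtain ⟨A, hsub, ⟨γ', J', h', rfl⟩, hmax⟩ := zorn_subset_nonempty
    {A : Set S | ∃ γ J, IsMinimizingSegment E C γ J ∧ A = γ '' J}
    (fun c hc hchain hne ↦ ⟨⋃₀ c, isMinimizingSegment_sUnion hc hchain hne,
      fun _ ↦ subset_sUnion_of_mem⟩) (γ '' J) ⟨γ, J, h, rfl⟩
  refine ⟨γ', J', ⟨h', fun η K hη hK hηγ ↦ ?_⟩, ?_, fun s hs ↦ ?_⟩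
  · have h1 : γ' '' J' ⊆ η '' K := by
      rw [← image_congr hηγ]
      exact image_mono hK
    have h2 := hmax ⟨η, K, hη, rfl⟩ h1
    rw [← hη.rho_image, ← h'.rho_image]
    exact (image_mono h2).antisymm (image_mono h1)
  · rw [← h.rho_image, ← h'.rho_image]
    exact image_mono hsub
  · have := h'.apply_rho (hsub (mem_image_of_mem _ hs))
    rwa [h.rho_eq s hs] at this

namespace IsMaximalSegment

/-- A limit point could be added to the segment: the geodesic extends to it, and ρ has the right
value there by continuity. -/
lemma not_tendsto_left (hne : C.Nonempty) (h : IsMaximalSegment E C γ J) {a : ℝ}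
    (ha : ∀ s ∈ J, a < s) (haJ : a ∈ closure J) (x : S) : ¬ Tendsto γ (𝓝[J] a) (𝓝 x) := by
  intro hx
  have hne' : (𝓝[J] a).NeBot := mem_closure_iff_nhdsWithin_neBot.1 haJ
  have hrho : rho E C x = a := by
    refine tendsto_nhds_unique (((continuous_rho (E := E) hne).tendsto x).comp hx) ?_
    exact (tendsto_id.mono_left nhdsWithin_le_nhds).congr'
      (by filter_upwards [self_mem_nhdsWithin] with s hs using (h.segment.rho_eq s hs).symm)
  have heq : EqOn (Function.update γ a x) γ J := fun s hs ↦
    Function.update_of_ne (ha s hs).ne' _ _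
  have hseg : IsMinimizingSegment E C (Function.update γ a x) (insert a J) := by
    refine isMinimizingSegment_iff.2
      ⟨h.segment.isGeodesicWithSpeed.extend_left ha haJ hx, fun s hs ↦ ?_⟩
    rcases hs with rfl | hs
    · simpa using hrho
    · rw [heq hs, h.segment.rho_eq s hs]
  have := h.maximal _ _ hseg (subset_insert a J) heq
  exact (ha a (this ▸ mem_insert a J)).false

lemma not_tendsto_right (hne : C.Nonempty) (h : IsMaximalSegment E C γ J) {b : ℝ}
    (hb : ∀ s ∈ J, s < b) (hbJ : b ∈ closure J) (x : S) : ¬ Tendsto γ (𝓝[J] b) (𝓝 x) := by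
  intro hx
  have hne' : (𝓝[J] b).NeBot := mem_closure_iff_nhdsWithin_neBot.1 hbJ
  have hrho : rho E C x = b := by
    refine tendsto_nhds_unique (((continuous_rho (E := E) hne).tendsto x).comp hx) ?_
    exact (tendsto_id.mono_left nhdsWithin_le_nhds).congr'
      (by filter_upwards [self_mem_nhdsWithin] with s hs using (h.segment.rho_eq s hs).symm)
  have heq : EqOn (Function.update γ b x) γ J := fun s hs ↦
    Function.update_of_ne (hb s hs).ne _ _
  have hseg : IsMinimizingSegment E C (Function.update γ b x) (insert b J) := by
    refine isMinimizingSegment_iff.2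
      ⟨h.segment.isGeodesicWithSpeed.extend_right hb hbJ hx, fun s hs ↦ ?_⟩
    rcases hs with rfl | hs
    · simpa using hrho
    · rw [heq hs, h.segment.rho_eq s hs]
  have := h.maximal _ _ hseg (subset_insert b J) heq
  exact (hb b (this ▸ mem_insert b J)).false

/-- A maximal segment has no first point outside `C`. -/
lemma exists_lt (hC : IsClosed C) (hne : C.Nonempty) (h : IsMaximalSegment E C γ J) {a : ℝ}
    (ha : a ∈ J) (ha0 : 0 < a) : ∃ s ∈ J, 0 < s ∧ s < a := by
  by_contra! hcon
  have hleast : ∀ s ∈ J, a ≤ s := by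
    intro s hs
    by_contra! hsa
    have hmem : (s + a) / 2 ∈ J := h.segment.ordConnected.out hs ha ⟨by linarith, by linarith⟩
    linarith [hcon _ hmem (by linarith [h.segment.nonneg hs])]
  have hrho : rho E C (γ a) = a := h.segment.rho_eq a ha
  have hpC : γ a ∉ C := (rho_pos_iff hC hne).1 (hrho ▸ ha0)
  -- If a were the first parameter, a segment ending at γ a could be put before it, and
  -- `IsMinimizingSegment.join` would give a proper extension.
  obtain ⟨η, ε, hε, hη, hηp⟩ := exists_isMinimizingSegment (E := E) hC hne hpC
  rw [hrho] at hη hηp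
  set γ' : ℝ → S := fun s ↦ if s ≤ a then η s else γ s
  have e1 : EqOn γ' η (Icc (a - ε) a) := fun s hs ↦ if_pos hs.2
  have e2 : EqOn γ' γ J := by
    intro s hs
    rcases (hleast s hs).eq_or_lt with rfl | hlt
    · exact (if_pos le_rfl).trans hηp
    · exact if_neg hlt.not_ge
  have hl : (Icc (a - ε) a ∪ J) ∩ Iic a = Icc (a - ε) a := by
    ext s
    constructor
    · rintro ⟨hs | hs, hsa⟩
      · exact hs
      · exact ⟨by linarith [hleast s hs], hsa⟩
    · exact fun hs ↦ ⟨Or.inl hs, hs.2⟩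
  have hr : (Icc (a - ε) a ∪ J) ∩ Ici a = J := by
    ext s
    constructor
    · rintro ⟨hs | hs, hsa⟩
      · rwa [le_antisymm hs.2 hsa]
      · exact hs
    · exact fun hs ↦ ⟨Or.inr hs, hleast s hs⟩
  have haI : a ∈ Icc (a - ε) a := ⟨by linarith, le_rfl⟩
  have hseg : IsMinimizingSegment E C γ' (Icc (a - ε) a ∪ J) := by
    refine IsMinimizingSegment.join hne ?_ (m := a) (Or.inr ha) ?_ ?_
    · rw [← isPreconnected_iff_ordConnected]
      exact isPreconnected_Icc.union a haI ha
        (isPreconnected_iff_ordConnected.2 h.segment.ordConnected)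
    · rw [hl]
      exact hη.mono Subset.rfl ordConnected_Icc hη.nontrivial e1
    · rw [hr]
      exact h.segment.mono Subset.rfl h.segment.ordConnected h.segment.nontrivial e2
  have := h.maximal γ' _ hseg subset_union_right e2
  have hmem : a - ε ∈ J := this ▸ Or.inl ⟨le_rfl, by linarith⟩
  linarith [hleast _ hmem]

end IsMaximalSegment

end Maximal

/-! ### The half line as a manifold -/

section HalfLine

lemma chartAt_negReal_source (t₀ : NegReal) : (chartAt ℝ t₀).source = univ := by
  rw [TopologicalSpace.Opens.chartAt_eq, OpenPartialHomeomorph.subtypeRestr_source]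
  exact eq_univ_of_forall fun _ ↦ mem_univ _

lemma coe_extChartAt_negReal_symm {t₀ : NegReal} {u : ℝ}
    (hu : u ∈ (extChartAt 𝓘(ℝ, ℝ) t₀).target) : (((extChartAt 𝓘(ℝ, ℝ) t₀).symm u : NegReal) : ℝ) =
        u :=
  (extChartAt 𝓘(ℝ, ℝ) t₀).right_inv hu

lemma contMDiff_coe_negReal {n : WithTop ℕ∞} :
    ContMDiff 𝓘(ℝ, ℝ) 𝓘(ℝ, ℝ) n ((↑) : NegReal → ℝ) := contMDiff_subtype_val

/-- The inclusion is the chart at t, so its derivative is the coordinate change from this chart to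
itself. -/
lemma mfderiv_coe_negReal (t : NegReal) (v : TangentSpace 𝓘(ℝ, ℝ) t) :
    mfderiv 𝓘(ℝ, ℝ) 𝓘(ℝ, ℝ) ((↑) : NegReal → ℝ) t v = v := by
  have h := mfderiv_chartAt_eq_tangentCoordChange (I := 𝓘(ℝ, ℝ)) (x := t) (y := t)
    (mem_chart_source ℝ t)
  have h2 := tangentCoordChange_self (I := 𝓘(ℝ, ℝ)) (x := t) (z := t) (v := v)
      (mem_extChartAt_source t)
  rw [← h] at h2
  exact h2

lemma contMDiffWithinAt_negReal_iff {n : WithTop ℕ∞} {f : ℝ → NegReal} {J : Set ℝ} {s : ℝ} :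
    ContMDiffWithinAt 𝓘(ℝ, ℝ) 𝓘(ℝ, ℝ) n f J s ↔ ContDiffWithinAt ℝ n (fun τ ↦ (f τ : ℝ)) J s := by
  rw [← contMDiffWithinAt_iff_contDiffWithinAt]
  constructor
  · exact fun h ↦ contMDiff_coe_negReal.contMDiffAt.comp_contMDiffWithinAt s h
  · intro h
    rw [contMDiffWithinAt_iff_target]
    exact ⟨Topology.IsInducing.subtypeVal.continuousWithinAt_iff.2 h.continuousWithinAt, h⟩

end HalfLine

/-! ### The Lorentzian product metric in coordinates and on velocities -/

section Cylinder

set_option linter.unusedSectionVars false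

variable {E : Type*} [NormedAddCommGroup E] [NormedSpace ℝ E] [FiniteDimensional ℝ E]
  {S : Type*} [TopologicalSpace S] [ChartedSpace E S]
  [RiemannianBundle (fun x : S ↦ TangentSpace 𝓘(ℝ, E) x)] [IsManifold 𝓘(ℝ, E) ∞ S]
  [IsContMDiffRiemannianBundle 𝓘(ℝ, E) ∞ E (fun x : S ↦ TangentSpace 𝓘(ℝ, E) x)]

lemma extChartAt_cyl (q₀ : Cyl S) : extChartAt (cylModel E) q₀ =
    (extChartAt 𝓘(ℝ, E) q₀.1).prod (extChartAt 𝓘(ℝ, ℝ) q₀.2) := extChartAt_prod q₀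

lemma mdifferentiableAt_coe_snd (q : Cyl S) :
    MDifferentiableAt (cylModel E) 𝓘(ℝ, ℝ) (fun z : Cyl S ↦ (z.2 : ℝ)) q :=
  (contMDiff_coe_negReal (n := 1)).mdifferentiableAt one_ne_zero |>.comp q mdifferentiableAt_snd

lemma lorentzMetric_apply {q : Cyl S} {v w : TangentSpace (cylModel E) q}
    {x y : TangentSpace 𝓘(ℝ, E) q.1} {a b : ℝ}
    (hx : mfderiv (cylModel E) 𝓘(ℝ, E) (fun z : Cyl S ↦ z.1) q v = x)
    (hy : mfderiv (cylModel E) 𝓘(ℝ, E) (fun z : Cyl S ↦ z.1) q w = y)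
    (ha : mfderiv (cylModel E) 𝓘(ℝ, ℝ) (fun z : Cyl S ↦ (z.2 : ℝ)) q v = a)
    (hb : mfderiv (cylModel E) 𝓘(ℝ, ℝ) (fun z : Cyl S ↦ (z.2 : ℝ)) q w = b) :
    lorentzMetric E S q v w = riemMetric E S q.1 x y - a * b := by
  subst hx hy ha hb
  rfl

/-- The chart of the cylinder is a product: after its inverse, the two projections are the inverse
chart of S and the second coordinate, and the chain rule applies. -/
lemma coordMetric_lorentzMetric (q₀ : Cyl S) {z : E × ℝ}
    (hz : z ∈ (extChartAt (cylModel E) q₀).target) (v w : E × ℝ) :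
    coordMetric (lorentzMetric E S) q₀ z v w =
      coordMetric (riemMetric E S) q₀.1 z.1 v.1 w.1 - v.2 * w.2 := by
  have hT : IsOpen (extChartAt (cylModel E) q₀).target := isOpen_extChartAt_target q₀
  have hΦ : MDifferentiableAt 𝓘(ℝ, E × ℝ) (cylModel E) (extChartAt (cylModel E) q₀).symm z :=
    ((contMDiffOn_extChartAt_symm (n := 1) q₀).contMDiffAt (hT.mem_nhds hz)).mdifferentiableAt
      one_ne_zero
  have hz1 : z.1 ∈ (extChartAt 𝓘(ℝ, E) q₀.1).target := by
    rw [extChartAt_cyl] at hz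
    exact hz.1
  have hπ : ∀ v : E × ℝ, mfderiv (cylModel E) 𝓘(ℝ, E) (fun z : Cyl S ↦ z.1)
      ((extChartAt (cylModel E) q₀).symm z)
      (mfderiv 𝓘(ℝ, E × ℝ) (cylModel E) (extChartAt (cylModel E) q₀).symm z v) =
      mfderiv 𝓘(ℝ, E) 𝓘(ℝ, E) (extChartAt 𝓘(ℝ, E) q₀.1).symm z.1 v.1 := by
    intro v
    have h1 := mfderiv_comp z (mdifferentiableAt_fst
      (x := (extChartAt (cylModel E) q₀).symm z)) hΦ
    have h2 : MDifferentiableAt 𝓘(ℝ, E) 𝓘(ℝ, E) (extChartAt 𝓘(ℝ, E) q₀.1).symm z.1 :=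
      (contMDiffAt_extChartAt_symm q₀.1 hz1).mdifferentiableAt (by simp)
    have h3 : MDifferentiableAt 𝓘(ℝ, E × ℝ) 𝓘(ℝ, E) (Prod.fst : E × ℝ → E) z :=
      differentiableAt_fst.mdifferentiableAt
    have h4 := mfderiv_comp z h2 h3
    rw [mfderiv_eq_fderiv, fderiv_fst] at h4
    have h5 := congrArg (fun L ↦ L v) h1
    have h6 := congrArg (fun L ↦ L v) h4
    exact h5.symm.trans h6
  have ht : ∀ v : E × ℝ, mfderiv (cylModel E) 𝓘(ℝ, ℝ) (fun z : Cyl S ↦ (z.2 : ℝ))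
      ((extChartAt (cylModel E) q₀).symm z)
      (mfderiv 𝓘(ℝ, E × ℝ) (cylModel E) (extChartAt (cylModel E) q₀).symm z v) = v.2 := by
    intro v
    have h1 := mfderiv_comp z (mdifferentiableAt_coe_snd
      ((extChartAt (cylModel E) q₀).symm z)) hΦ
    have h2 : ((fun z : Cyl S ↦ (z.2 : ℝ)) ∘ (extChartAt (cylModel E) q₀).symm) =ᶠ[𝓝 z]
        Prod.snd := by
      filter_upwards [hT.mem_nhds hz] with y hy
      rw [extChartAt_cyl] at hy
      exact coe_extChartAt_negReal_symm hy.2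
    rw [h2.mfderiv_eq, mfderiv_eq_fderiv, fderiv_snd] at h1
    exact (congrArg (fun L ↦ L v) h1).symm
  exact lorentzMetric_apply (hπ v) (hπ w) (ht v) (ht w)

/-- The time part of the metric has constant coefficients and drops out of all derivatives. -/
lemma christoffel_lorentzMetric (q₀ : Cyl S) {z : E × ℝ}
    (hz : z ∈ (extChartAt (cylModel E) q₀).target) (u w : E × ℝ) :
    christoffel (lorentzMetric E S) q₀ z u u w =
      christoffel (riemMetric E S) q₀.1 z.1 u.1 u.1 w.1 := by
  have hT : IsOpen (extChartAt (cylModel E) q₀).target := isOpen_extChartAt_target q₀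
  have hz1 : z.1 ∈ (extChartAt 𝓘(ℝ, E) q₀.1).target := by
    rw [extChartAt_cyl] at hz
    exact hz.1
  have key : ∀ v w a : E × ℝ, fderiv ℝ (fun z ↦ coordMetric (lorentzMetric E S) q₀ z v w) z a =
      fderiv ℝ (fun y ↦ coordMetric (riemMetric E S) q₀.1 y v.1 w.1) z.1 a.1 := by
    intro v w a
    have h1 : (fun z ↦ coordMetric (lorentzMetric E S) q₀ z v w) =ᶠ[𝓝 z]
        fun z ↦ coordMetric (riemMetric E S) q₀.1 z.1 v.1 w.1 - v.2 * w.2 := by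
      filter_upwards [hT.mem_nhds hz] with y hy
      exact coordMetric_lorentzMetric q₀ hy v w
    have h2 : DifferentiableAt ℝ (fun y ↦ coordMetric (riemMetric E S) q₀.1 y v.1 w.1) z.1 :=
      (((isMetricOn_chartMetric q₀.1).differentiableAt hz1).clm_apply
        (differentiableAt_const v.1)).clm_apply (differentiableAt_const w.1)
    have h3 := (h2.hasFDerivAt.comp z hasFDerivAt_fst).sub_const (v.2 * w.2)
    rw [h1.fderiv_eq]
    exact congrArg (fun L ↦ L a) h3.fderiv
  simp only [christoffel, key]

section Velocity

variable {Γ : ℝ → Cyl S} {J : Set ℝ} {s : ℝ}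

lemma mfderiv_fst_velocity (hs : UniqueDiffWithinAt ℝ J s)
    (h : MDifferentiableWithinAt 𝓘(ℝ, ℝ) (cylModel E) Γ J s) :
    mfderiv (cylModel E) 𝓘(ℝ, E) (fun z : Cyl S ↦ z.1) (Γ s) (velocity (cylModel E) Γ J s) =
      velocity 𝓘(ℝ, E) (fun τ ↦ (Γ τ).1) J s := by
  have h1 := mfderiv_comp_mfderivWithin s (mdifferentiableAt_fst (x := Γ s)) h
    hs.uniqueMDiffWithinAt
  exact (congrArg (fun L ↦ L (1 : ℝ)) h1).symm

lemma mfderiv_snd_velocity (hs : UniqueDiffWithinAt ℝ J s)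
    (h : MDifferentiableWithinAt 𝓘(ℝ, ℝ) (cylModel E) Γ J s) :
    mfderiv (cylModel E) 𝓘(ℝ, ℝ) (fun z : Cyl S ↦ (z.2 : ℝ)) (Γ s) (velocity (cylModel E) Γ J s) =
      derivWithin (fun τ ↦ ((Γ τ).2 : ℝ)) J s := by
  have h1 := mfderiv_comp_mfderivWithin s (mdifferentiableAt_coe_snd (Γ s)) h
    hs.uniqueMDiffWithinAt
  rw [mfderivWithin_eq_fderivWithin] at h1
  exact (congrArg (fun L ↦ L (1 : ℝ)) h1).symm

lemma mfderiv_fst_timeField (q : Cyl S) :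
    mfderiv (cylModel E) 𝓘(ℝ, E) (fun z : Cyl S ↦ z.1) q (timeField E S q) = (0 : E) := by
  have h : mfderiv (cylModel E) 𝓘(ℝ, E) (fun z : Cyl S ↦ z.1) q = _ := mfderiv_fst (x := q)
  rw [h]
  rfl

lemma mfderiv_snd_timeField (q : Cyl S) :
    mfderiv (cylModel E) 𝓘(ℝ, ℝ) (fun z : Cyl S ↦ (z.2 : ℝ)) q (timeField E S q) = (1 : ℝ) := by
  have h1 := mfderiv_comp q (contMDiff_coe_negReal (n := 1) |>.mdifferentiableAt one_ne_zero
    (x := q.2)) (mdifferentiableAt_snd (I := 𝓘(ℝ, E)) (I' := 𝓘(ℝ, ℝ)) (x := q))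
  rw [mfderiv_snd] at h1
  have h2 := congrArg (fun L ↦ L (timeField E S q)) h1
  exact h2.trans (mfderiv_coe_negReal q.2 _)

lemma lorentzMetric_velocity (hs : UniqueDiffWithinAt ℝ J s)
    (h : MDifferentiableWithinAt 𝓘(ℝ, ℝ) (cylModel E) Γ J s) :
    lorentzMetric E S (Γ s) (velocity (cylModel E) Γ J s) (velocity (cylModel E) Γ J s) =
      ‖velocity 𝓘(ℝ, E) (fun τ ↦ (Γ τ).1) J s‖ ^ 2 -
        derivWithin (fun τ ↦ ((Γ τ).2 : ℝ)) J s ^ 2 := by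
  rw [lorentzMetric_apply (mfderiv_fst_velocity hs h) (mfderiv_fst_velocity hs h)
    (mfderiv_snd_velocity hs h) (mfderiv_snd_velocity hs h), ← real_inner_self_eq_norm_sq,
    sq (derivWithin _ _ _)]
  rfl

lemma lorentzMetric_velocity_timeField (hs : UniqueDiffWithinAt ℝ J s)
    (h : MDifferentiableWithinAt 𝓘(ℝ, ℝ) (cylModel E) Γ J s) :
    lorentzMetric E S (Γ s) (velocity (cylModel E) Γ J s) (timeField E S (Γ s)) =
      - derivWithin (fun τ ↦ ((Γ τ).2 : ℝ)) J s := by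
  rw [lorentzMetric_apply (mfderiv_fst_velocity hs h) (mfderiv_fst_timeField _)
    (mfderiv_snd_velocity hs h) (mfderiv_snd_timeField _), mul_one]
  exact (congrArg (· - _) (map_zero _)).trans (zero_sub _)

/-- The product with ∂/∂t is -t', so time orientation fixes the sign of t', and squares may be
dropped. -/
lemma isFutureTimelike_velocity_iff (hs : UniqueDiffWithinAt ℝ J s)
    (h : MDifferentiableWithinAt 𝓘(ℝ, ℝ) (cylModel E) Γ J s) :
    IsFutureTimelike (lorentzMetric E S) (timeField E S) (velocity (cylModel E) Γ J s) ↔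
      ‖velocity 𝓘(ℝ, E) (fun τ ↦ (Γ τ).1) J s‖ < derivWithin (fun τ ↦ ((Γ τ).2 : ℝ)) J s := by
  rw [IsFutureTimelike, lorentzMetric_velocity hs h, lorentzMetric_velocity_timeField hs h,
    sub_neg, neg_lt_zero]
  constructor
  · exact fun h ↦ (sq_lt_sq₀ (norm_nonneg _) h.2.le).1 h.1
  · exact fun h ↦ ⟨(sq_lt_sq₀ (norm_nonneg _) ((norm_nonneg _).trans h.le)).2 h,
      (norm_nonneg _).trans_lt h⟩

lemma isFutureNull_velocity_iff (hs : UniqueDiffWithinAt ℝ J s)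
    (h : MDifferentiableWithinAt 𝓘(ℝ, ℝ) (cylModel E) Γ J s) :
    IsFutureNull (lorentzMetric E S) (timeField E S) (velocity (cylModel E) Γ J s) ↔
      ‖velocity 𝓘(ℝ, E) (fun τ ↦ (Γ τ).1) J s‖ ^ 2 =
        derivWithin (fun τ ↦ ((Γ τ).2 : ℝ)) J s ^ 2 ∧
      0 < derivWithin (fun τ ↦ ((Γ τ).2 : ℝ)) J s := by
  rw [IsFutureNull, lorentzMetric_velocity hs h, lorentzMetric_velocity_timeField hs h,
    sub_eq_zero, neg_lt_zero]

end Velocity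

end Cylinder

/-! ### Geodesics of the product metric -/

section CylinderGeodesics

set_option linter.unusedSectionVars false

variable {E : Type*} [NormedAddCommGroup E] [NormedSpace ℝ E] [FiniteDimensional ℝ E]
  {S : Type*} [TopologicalSpace S] [ChartedSpace E S]
  [RiemannianBundle (fun x : S ↦ TangentSpace 𝓘(ℝ, E) x)] [IsManifold 𝓘(ℝ, E) ∞ S]
  [IsContMDiffRiemannianBundle 𝓘(ℝ, E) ∞ E (fun x : S ↦ TangentSpace 𝓘(ℝ, E) x)]
  {Γ : ℝ → Cyl S} {J : Set ℝ} {s : ℝ}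

lemma contMDiffOn_cyl_iff {n : WithTop ℕ∞} : ContMDiffOn 𝓘(ℝ, ℝ) (cylModel E) n Γ J ↔
    ContMDiffOn 𝓘(ℝ, ℝ) 𝓘(ℝ, E) n (fun τ ↦ (Γ τ).1) J ∧
      ContDiffOn ℝ n (fun τ ↦ ((Γ τ).2 : ℝ)) J := by
  constructor
  · exact fun h ↦ ⟨fun s hs ↦ (contMDiffWithinAt_prod_iff Γ |>.1 (h s hs)).1,
      fun s hs ↦ contMDiffWithinAt_negReal_iff.1 (contMDiffWithinAt_prod_iff Γ |>.1 (h s hs)).2⟩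
  · exact fun h s hs ↦ contMDiffWithinAt_prod_iff Γ |>.2
      ⟨h.1 s hs, contMDiffWithinAt_negReal_iff.2 (h.2 s hs)⟩

/-- The geodesic equation of `h - dt²` in a product chart. -/
lemma lorentz_geodesic_equation (hJ : UniqueDiffOn ℝ J)
    (hx : ContMDiffOn 𝓘(ℝ, ℝ) 𝓘(ℝ, E) 2 (fun τ ↦ (Γ τ).1) J)
    (ht : ContDiffOn ℝ 2 (fun τ ↦ ((Γ τ).2 : ℝ)) J) (hs : s ∈ J) {q₀ : Cyl S}
    (hq₀ : (Γ s).1 ∈ (chartAt E q₀.1).source) (w : E × ℝ) :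
    let c : ℝ → E × ℝ := fun τ ↦ extChartAt (cylModel E) q₀ (Γ τ)
    let y : ℝ → E := fun τ ↦ extChartAt 𝓘(ℝ, E) q₀.1 (Γ τ).1
    coordMetric (lorentzMetric E S) q₀ (c s) (derivWithin (derivWithin c J) J s) w +
        christoffel (lorentzMetric E S) q₀ (c s) (derivWithin c J s) (derivWithin c J s) w =
      coordMetric (riemMetric E S) q₀.1 (y s) (derivWithin (derivWithin y J) J s) w.1 +
        christoffel (riemMetric E S) q₀.1 (y s) (derivWithin y J s) (derivWithin y J s) w.1 -
        derivWithin (derivWithin (fun τ ↦ ((Γ τ).2 : ℝ)) J) J s * w.2 := by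
  intro c y
  set t : ℝ → ℝ := fun τ ↦ ((Γ τ).2 : ℝ)
  have hsrc : ∀ᶠ τ in 𝓝[J] s, (Γ τ).1 ∈ (chartAt E q₀.1).source :=
    (hx.continuousOn s hs).eventually_mem ((chartAt E q₀.1).open_source.mem_nhds hq₀)
  have hy2 : ∀ τ ∈ J, (Γ τ).1 ∈ (chartAt E q₀.1).source → ContDiffWithinAt ℝ 2 y J τ := by
    intro τ hτJ hτ
    rw [← contMDiffWithinAt_iff_contDiffWithinAt]
    exact (((contMDiffWithinAt_iff_target_of_mem_source (n := 2)
      (f := fun τ ↦ (Γ τ).1) hτ).1 (hx τ hτJ))).2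
  have hpair : ∀ τ ∈ J, (Γ τ).1 ∈ (chartAt E q₀.1).source →
      derivWithin c J τ = (derivWithin y J τ, derivWithin t J τ) := fun τ hτJ hτ ↦
    (((hy2 τ hτJ hτ).differentiableWithinAt (by norm_num)).hasDerivWithinAt.prodMk
      ((ht τ hτJ).differentiableWithinAt (by norm_num)).hasDerivWithinAt).derivWithin (hJ τ hτJ)
  have hpair' : derivWithin c J =ᶠ[𝓝[J] s] fun τ ↦ (derivWithin y J τ, derivWithin t J τ) := by
    filter_upwards [hsrc, self_mem_nhdsWithin] with τ hτ hτJ using hpair τ hτJ hτ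
  have hy3 : ContDiffWithinAt ℝ 1 (derivWithin y J) J s :=
    (hy2 s hs hq₀).derivWithin hJ (by norm_num) hs
  have ht3 : ContDiffWithinAt ℝ 1 (derivWithin t J) J s :=
    (ht s hs).derivWithin hJ (by norm_num) hs
  have h2 : derivWithin (derivWithin c J) J s =
      (derivWithin (derivWithin y J) J s, derivWithin (derivWithin t J) J s) := by
    rw [hpair'.derivWithin_eq (hpair s hs hq₀)]
    exact ((hy3.differentiableWithinAt (by norm_num)).hasDerivWithinAt.prodMk
      (ht3.differentiableWithinAt (by norm_num)).hasDerivWithinAt).derivWithin (hJ s hs)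
  have hz : c s ∈ (extChartAt (cylModel E) q₀).target := by
    refine (extChartAt (cylModel E) q₀).map_source ?_
    rw [extChartAt_source]
    exact ⟨hq₀, by rw [chartAt_negReal_source]; trivial⟩
  rw [coordMetric_lorentzMetric q₀ hz, christoffel_lorentzMetric q₀ hz, h2, hpair s hs hq₀]
  simp only [c, y, extChartAt_cyl, PartialEquiv.prod_coe]
  ring

/-- Testing the split geodesic equation with (w, 0) and with (0, 1) separates the space part from
t'' = 0. -/
theorem isGeodesicOn_lorentzMetric_iff : IsGeodesicOn (lorentzMetric E S) Γ J ↔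
    IsGeodesicOn (riemMetric E S) (fun τ ↦ (Γ τ).1) J ∧
      ContDiffOn ℝ 2 (fun τ ↦ ((Γ τ).2 : ℝ)) J ∧
      ∀ s ∈ J, derivWithin (derivWithin (fun τ ↦ ((Γ τ).2 : ℝ)) J) J s = 0 := by
  constructor
  · intro h
    obtain ⟨hx, ht⟩ := contMDiffOn_cyl_iff.1 h.contMDiffOn
    have hJ := uniqueDiffOn_of_ordConnected h.ordConnected h.nontrivial
    have key : ∀ s ∈ J, ∀ q₀ : Cyl S, (Γ s).1 ∈ (chartAt E q₀.1).source → ∀ w : E × ℝ, _ :=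
      fun s hs q₀ hq₀ w ↦ (lorentz_geodesic_equation hJ hx ht hs hq₀ w).symm.trans
        (h.equation s hs q₀ ⟨hq₀, by rw [chartAt_negReal_source]; trivial⟩ w)
    refine ⟨⟨h.ordConnected, h.nontrivial, hx, fun s hs x₀ hx₀ w ↦ ?_⟩, ht, fun s hs ↦ ?_⟩
    · have := key s hs (x₀, (Γ s).2) hx₀ (w, 0)
      rw [mul_zero, sub_zero] at this
      exact this
    · have h1 := key s hs (Γ s) (mem_chart_source E _) (0, 0)
      have h2 := key s hs (Γ s) (mem_chart_source E _) (0, 1)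
      simp only [mul_zero, mul_one, sub_zero] at h1 h2
      linarith
  · rintro ⟨h, ht, ht2⟩
    have hJ := uniqueDiffOn_of_ordConnected h.ordConnected h.nontrivial
    refine ⟨h.ordConnected, h.nontrivial, contMDiffOn_cyl_iff.2 ⟨h.contMDiffOn, ht⟩,
      fun s hs q₀ hq₀ w ↦ ?_⟩
    have hq₀' : (Γ s).1 ∈ (chartAt E q₀.1).source := hq₀.1
    refine (lorentz_geodesic_equation hJ h.contMDiffOn ht hs hq₀' w).trans ?_
    rw [ht2 s hs, zero_mul, sub_zero]
    exact h.equation s hs q₀.1 hq₀' w.1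

lemma derivWithin_affine {f : ℝ → ℝ} {k a : ℝ} (hJ : UniqueDiffOn ℝ J)
    (hf : ∀ τ ∈ J, f τ = k * τ - a) : EqOn (derivWithin f J) (fun _ ↦ k) J := by
  intro s hs
  have : HasDerivWithinAt (fun τ : ℝ ↦ k * τ - a) k J s := by
    simpa using (((hasDerivAt_id s).const_mul k).sub_const a).hasDerivWithinAt
  exact (this.congr hf (hf s hs)).derivWithin (hJ s hs)

lemma exists_affine_of_derivWithin_eq_zero {f : ℝ → ℝ} (hJ : J.OrdConnected) (hn : J.Nontrivial)
    (hf : ContDiffOn ℝ 2 f J) (h : ∀ s ∈ J, derivWithin (derivWithin f J) J s = 0) :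
    ∃ k a : ℝ, ∀ τ ∈ J, f τ = k * τ - a := by
  have hU := uniqueDiffOn_of_ordConnected hJ hn
  have hconst : ∀ g : ℝ → ℝ, DifferentiableOn ℝ g J → (∀ s ∈ J, derivWithin g J s = 0) →
      ∀ s ∈ J, ∀ s' ∈ J, g s = g s' := by
    intro g hg h0 s hs s' hs'
    refine hJ.convex.is_const_of_fderivWithin_eq_zero hg (fun x hx ↦ ?_) hs hs'
    ext
    exact h0 x hx
  obtain ⟨s₀, hs₀⟩ := hn.nonempty
  set k := derivWithin f J s₀
  have hk : ∀ s ∈ J, derivWithin f J s = k := fun s hs ↦ hconst (derivWithin f J)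
    ((hf.derivWithin hU (m := 1) (by norm_num)).differentiableOn (by norm_num)) h s hs s₀ hs₀
  have hfd : DifferentiableOn ℝ f J := hf.differentiableOn (by norm_num)
  have hd : ∀ s ∈ J, HasDerivWithinAt (fun τ ↦ f τ - k * τ) 0 J s := fun s hs ↦ by
    have h1 := (hfd s hs).hasDerivWithinAt
    rw [hk s hs] at h1
    have h2 := h1.sub (((hasDerivAt_id s).const_mul k).hasDerivWithinAt)
    rw [mul_one, sub_self] at h2
    exact h2
  refine ⟨k, k * s₀ - f s₀, fun τ hτ ↦ ?_⟩
  have := hconst _ (fun s hs ↦ (hd s hs).differentiableWithinAt)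
    (fun s hs ↦ (hd s hs).derivWithin (hU s hs)) τ hτ s₀ hs₀
  linarith

end CylinderGeodesics

/-! ### The graph: null geodesics, achronality, closedness, hypersurface -/

section Graph

set_option linter.unusedSectionVars false

variable {E : Type*} [NormedAddCommGroup E] [NormedSpace ℝ E] [FiniteDimensional ℝ E]
  {S : Type*} [TopologicalSpace S] [T2Space S] [ConnectedSpace S] [ChartedSpace E S]
  [RiemannianBundle (fun x : S ↦ TangentSpace 𝓘(ℝ, E) x)] [IsManifold 𝓘(ℝ, E) ∞ S]
  [IsContMDiffRiemannianBundle 𝓘(ℝ, E) ∞ E (fun x : S ↦ TangentSpace 𝓘(ℝ, E) x)]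
  {C : Set S} {Γ : ℝ → Cyl S} {J : Set ℝ}

/-- The exclusion of C is automatic, since ρ = 0 on C while t < 0 in the cylinder. -/
lemma mem_graphSet_iff {q : Cyl S} : q ∈ graphSet E C ↔ (q.2 : ℝ) = - rho E C q.1 := by
  refine ⟨fun h ↦ h.2, fun h ↦ ⟨fun hq ↦ ?_, h⟩⟩
  have := q.2.2
  rw [rho_eq_zero hq, neg_zero] at h
  exact this.ne h

/-- Time is affine with some slope k > 0 by future directedness, nullness makes the spatial speed
equal to k, and lying in the graph prescribes ρ. In the parameter s = a - kτ the space part is a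
minimizing segment. -/
theorem isNullGeodesicIn_graphSet_iff :
    IsNullGeodesicIn (lorentzMetric E S) (timeField E S) (graphSet E C) Γ J ↔
      ∃ a k : ℝ, 0 < k ∧ IsGeodesicWithSpeed E (k ^ 2) (fun τ ↦ (Γ τ).1) J ∧
        ∀ τ ∈ J, ((Γ τ).2 : ℝ) = k * τ - a ∧ rho E C (Γ τ).1 = a - k * τ := by
  constructor
  · intro h
    have hg := isGeodesicOn_lorentzMetric_iff.1 h.geodesic
    have hJ := uniqueDiffOn_of_ordConnected h.geodesic.ordConnected h.geodesic.nontrivial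
    obtain ⟨k, a, hka⟩ := exists_affine_of_derivWithin_eq_zero h.geodesic.ordConnected
      h.geodesic.nontrivial hg.2.1 hg.2.2
    have hd := derivWithin_affine hJ hka
    have hnull : ∀ s ∈ J, _ := fun s hs ↦ (isFutureNull_velocity_iff (hJ s hs)
      ((h.geodesic.contMDiffOn s hs).mdifferentiableWithinAt two_ne_zero)).1 (h.futureNull s hs)
    obtain ⟨s₀, hs₀⟩ := h.geodesic.nontrivial.nonempty
    refine ⟨a, k, (hnull s₀ hs₀).2.trans_eq (hd hs₀), isGeodesicWithSpeed_iff.2 ⟨hg.1, fun s hs ↦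
        ?_⟩,
      fun τ hτ ↦ ⟨hka τ hτ, ?_⟩⟩
    · rw [(hnull s hs).1, hd hs]
    · have h1 := (h.subset (mem_image_of_mem Γ hτ)).2
      have h2 := hka τ hτ
      linarith
  · rintro ⟨a, k, hk, hgeo, hΓ⟩
    have hJ := hgeo.uniqueDiffOn
    have hg := isGeodesicWithSpeed_iff.1 hgeo
    have haff : ∀ τ ∈ J, ((Γ τ).2 : ℝ) = k * τ - a := fun τ hτ ↦ (hΓ τ hτ).1
    have hd := derivWithin_affine hJ haff
    have ht : ContDiffOn ℝ 2 (fun τ ↦ ((Γ τ).2 : ℝ)) J := by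
      have : ContDiff ℝ 2 fun τ : ℝ ↦ k * τ - a := by fun_prop
      exact this.contDiffOn.congr haff
    have hL : IsGeodesicOn (lorentzMetric E S) Γ J := by
      refine isGeodesicOn_lorentzMetric_iff.2 ⟨hg.1, ht, fun s hs ↦ ?_⟩
      rw [derivWithin_congr hd (hd hs)]
      simp
    refine ⟨hL, fun s hs ↦ ?_, ?_⟩
    · rw [isFutureNull_velocity_iff (hJ s hs)
        ((hL.contMDiffOn s hs).mdifferentiableWithinAt two_ne_zero), hg.2 s hs, hd hs]
      exact ⟨rfl, hk⟩
    · rintro _ ⟨τ, hτ, rfl⟩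
      rw [mem_graphSet_iff, (hΓ τ hτ).1, (hΓ τ hτ).2]
      ring

/-- The spatial length of a timelike curve is less than its gain in time, here ρ(p) - ρ(q), which is
at most the distance of the projections. -/
theorem isAchronal_graphSet (hne : C.Nonempty) :
    IsAchronal (lorentzMetric E S) (timeField E S) (graphSet E C) := by
  rintro p hp q hq ⟨Γ, hΓ, h0, h1, htl⟩
  set t : ℝ → ℝ := fun τ ↦ ((Γ τ).2 : ℝ)
  have hU := uniqueDiffOn_Icc (zero_lt_one (α := ℝ))
  obtain ⟨hx, ht⟩ := contMDiffOn_cyl_iff.1 hΓ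
  have hlt : ∀ s ∈ Icc (0 : ℝ) 1, _ := fun s hs ↦ (isFutureTimelike_velocity_iff (hU s hs)
    ((hΓ s hs).mdifferentiableWithinAt one_ne_zero)).1 (htl s hs)
  have hcont : ContinuousOn (derivWithin t (Icc 0 1)) (Icc 0 1) :=
    ht.continuousOn_derivWithin hU le_rfl
  have hint : ∫⁻ s in Icc (0 : ℝ) 1, ENNReal.ofReal (derivWithin t (Icc 0 1) s) =
      ENNReal.ofReal (t 1 - t 0) := by
    rw [← intervalIntegral.integral_derivWithin_Icc_of_contDiffOn_Icc ht zero_le_one,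
      intervalIntegral.integral_of_le zero_le_one, ← MeasureTheory.integral_Icc_eq_integral_Ioc,
      MeasureTheory.ofReal_integral_eq_lintegral_ofReal hcont.integrableOn_Icc]
    exact (MeasureTheory.ae_restrict_iff' measurableSet_Icc).2 (Eventually.of_forall
      fun s hs ↦ (norm_nonneg _).trans (hlt s hs).le)
  have hlen : pathELength 𝓘(ℝ, E) (fun τ ↦ (Γ τ).1) 0 1 < ENNReal.ofReal (t 1 - t 0) := by
    rw [pathELength_eq_lintegral_mfderivWithin_Icc, ← hint]
    have hlt' : ∀ s ∈ Icc (0 : ℝ) 1,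
        ‖mfderivWithin 𝓘(ℝ, ℝ) 𝓘(ℝ, E) (fun τ ↦ (Γ τ).1) (Icc 0 1) s (1 : ℝ)‖ₑ <
          ENNReal.ofReal (derivWithin t (Icc 0 1) s) := by
      intro s hs
      rw [← ofReal_norm]
      exact (ENNReal.ofReal_lt_ofReal_iff ((norm_nonneg _).trans_lt (hlt s hs))).2 (hlt s hs)
    refine MeasureTheory.lintegral_strict_mono ?_ ?_ ?_ ?_
    · simp [MeasureTheory.Measure.restrict_eq_zero]
    · exact (hcont.aemeasurable measurableSet_Icc).ennreal_ofReal
    · refine ((MeasureTheory.setLIntegral_mono' measurableSet_Icc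
        fun s hs ↦ (hlt' s hs).le).trans_lt ?_).ne
      rw [hint]
      exact ENNReal.ofReal_lt_top
    · exact (MeasureTheory.ae_restrict_iff' measurableSet_Icc).2 (Eventually.of_forall hlt')
  have hdist := (riemannianEDist_le_pathELength hx rfl rfl zero_le_one).trans_lt hlen
  simp only [h0, h1] at hdist
  have h01 : t 1 - t 0 = rho E C p.1 - rho E C q.1 := by
    simp only [t, h0, h1, mem_graphSet_iff.1 hp, mem_graphSet_iff.1 hq]
    ring
  rw [h01] at hdist
  have h2 := ENNReal.toReal_lt_of_lt_ofReal hdist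
  linarith [rho_le_dist_add (E := E) hne p.1 q.1]

lemma isClosed_graphSet (hne : C.Nonempty) : IsClosed (graphSet E C) := by
  have : graphSet E C = {q : Cyl S | (q.2 : ℝ) = - rho E C q.1} := ext fun _ ↦ mem_graphSet_iff
  rw [this]
  exact isClosed_eq (continuous_subtype_val.comp continuous_snd)
    ((continuous_rho (E := E) hne).comp continuous_fst).neg

/-- The shear (x, t) ↦ (x, t + ρ(x)) flattens the graph; it is a homeomorphism because ρ is
continuous. -/
theorem isTopologicalHypersurface_graphSet (hne : C.Nonempty) :
    IsTopologicalHypersurface (E × ℝ) (graphSet E C) := by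
  intro p hp
  have hemb : IsOpenEmbedding (Prod.map id (↑) : Cyl S → S × ℝ) :=
    IsOpenEmbedding.id.prodMap isOpen_Iio.isOpenEmbedding_subtypeVal
  have hρ := continuous_rho (E := E) hne
  let shear : S × ℝ ≃ₜ S × ℝ :=
    { toFun := fun z ↦ (z.1, z.2 + rho E C z.1)
      invFun := fun z ↦ (z.1, z.2 - rho E C z.1)
      left_inv := fun z ↦ by simp
      right_inv := fun z ↦ by simp
      continuous_toFun := by fun_prop
      continuous_invFun := by fun_prop }
  have : Nonempty (Cyl S) := ⟨p⟩
  refine ⟨(hemb.toOpenPartialHomeomorph _).trans (shear.toOpenPartialHomeomorph.trans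
    ((chartAt E p.1).prod (OpenPartialHomeomorph.refl ℝ))), ContinuousLinearMap.snd ℝ E ℝ, ?_, ?_,
    fun q hq ↦ ?_⟩
  · intro h
    have := congrArg (fun L ↦ L ((0 : E), (1 : ℝ))) h
    simp at this
  · simp [shear]
  · rw [mem_graphSet_iff, eq_neg_iff_add_eq_zero]
    rfl

end Graph

/-! ### Lifts of minimizing segments -/

section Generators

set_option linter.unusedSectionVars false

variable {E : Type*} [NormedAddCommGroup E] [NormedSpace ℝ E] [FiniteDimensional ℝ E]
  {S : Type*} [TopologicalSpace S] [T2Space S] [ConnectedSpace S] [ChartedSpace E S]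
  [RiemannianBundle (fun x : S ↦ TangentSpace 𝓘(ℝ, E) x)] [IsManifold 𝓘(ℝ, E) ∞ S]
  [IsContMDiffRiemannianBundle 𝓘(ℝ, E) ∞ E (fun x : S ↦ TangentSpace 𝓘(ℝ, E) x)]
  {C : Set S} {Γ : ℝ → Cyl S} {γ γ' : ℝ → S} {J K K' : Set ℝ} {a k : ℝ}

/-- `Γ` is, after the change of parameter `s = a - k τ`, the lift of `γ` restricted to the positive
parameters. -/
structure IsLift (Γ : ℝ → Cyl S) (J : Set ℝ) (γ : ℝ → S) (K : Set ℝ) (a k : ℝ) : Prop where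
  pos : 0 < k
  mem_iff : ∀ τ, τ ∈ J ↔ a - k * τ ∈ K ∧ 0 < a - k * τ
  fst_eq : ∀ τ ∈ J, (Γ τ).1 = γ (a - k * τ)
  snd_eq : ∀ τ ∈ J, ((Γ τ).2 : ℝ) = k * τ - a

variable (γ K) in
lemma exists_isLift [Nonempty S] (a : ℝ) {k : ℝ} (hk : 0 < k) :
    ∃ Γ : ℝ → Cyl S, IsLift Γ {τ | a - k * τ ∈ K ∧ 0 < a - k * τ} γ K a k := by
  -- The value -1 off the domain only serves to stay in the negative half line.
  refine ⟨fun τ ↦ (γ (a - k * τ), if h : 0 < a - k * τ then ⟨k * τ - a, by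
    change k * τ - a < 0
    linarith⟩ else ⟨-1, by change (-1 : ℝ) < 0; norm_num⟩), hk, fun _ ↦ Iff.rfl, fun _ _ ↦ rfl,
    fun τ hτ ↦ ?_⟩
  simp only
  rw [dif_pos hτ.2]

namespace IsLift

lemma sub_mul_div (hk : k ≠ 0) (a s : ℝ) : a - k * ((a - s) / k) = s := by
  field_simp
  ring

lemma div_mem (h : IsLift Γ J γ K a k) {s : ℝ} (hs : s ∈ K) (h0 : 0 < s) : (a - s) / k ∈ J := by
  rw [h.mem_iff, sub_mul_div h.pos.ne']
  exact ⟨hs, h0⟩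

lemma apply_div (h : IsLift Γ J γ K a k) {s : ℝ} (hs : s ∈ K) (h0 : 0 < s) :
    (Γ ((a - s) / k)).1 = γ s ∧ ((Γ ((a - s) / k)).2 : ℝ) = -s := by
  have hτ := h.div_mem hs h0
  have e := sub_mul_div h.pos.ne' a s
  refine ⟨by rw [h.fst_eq _ hτ, e], ?_⟩
  rw [h.snd_eq _ hτ]
  linarith

lemma ordConnected (h : IsLift Γ J γ K a k) (hK : K.OrdConnected) : J.OrdConnected := by
  refine ⟨fun τ hτ τ' hτ' σ hσ ↦ ?_⟩
  rw [h.mem_iff] at *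
  have h1 := mul_le_mul_of_nonneg_left hσ.1 h.pos.le
  have h2 := mul_le_mul_of_nonneg_left hσ.2 h.pos.le
  exact ⟨hK.out hτ'.1 hτ.1 ⟨by linarith, by linarith⟩, by linarith [hτ'.2]⟩

lemma nontrivial (h : IsLift Γ J γ K a k) (hseg : IsMinimizingSegment E C γ K) :
    J.Nontrivial := by
  obtain ⟨l, hl, r, hr, hlr⟩ := hseg.nontrivial.exists_lt
  have hl0 := hseg.nonneg hl
  -- The midpoint replaces l, which may be the parameter 0 and then has no lift.
  have hm : (l + r) / 2 ∈ K := hseg.ordConnected.out hl hr ⟨by linarith, by linarith⟩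
  refine ⟨_, h.div_mem hm (by linarith), _, h.div_mem hr (by linarith), fun heq ↦ ?_⟩
  have := (div_left_inj' h.pos.ne').1 heq
  linarith

theorem isNullGeodesicIn (h : IsLift Γ J γ K a k) (hseg : IsMinimizingSegment E C γ K) :
    IsNullGeodesicIn (lorentzMetric E S) (timeField E S) (graphSet E C) Γ J := by
  refine isNullGeodesicIn_graphSet_iff.2 ⟨a, k, h.pos, ?_, fun τ hτ ↦ ⟨h.snd_eq τ hτ, ?_⟩⟩
  · have := hseg.isGeodesicWithSpeed.comp_affine a (b := -k) (neg_ne_zero.2 h.pos.ne')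
    simp only [neg_mul, ← sub_eq_add_neg, neg_sq, mul_one] at this
    exact this.mono (fun τ hτ ↦ ((h.mem_iff τ).1 hτ).1) (h.ordConnected hseg.ordConnected)
      (h.nontrivial hseg) fun τ hτ ↦ h.fst_eq τ hτ
  · rw [h.fst_eq τ hτ, hseg.rho_eq _ ((h.mem_iff τ).1 hτ).1]

/-- The image of the lift depends only on the image of the segment, not on a and k; this is used to
count generators as sets. -/
lemma image_eq (hC : IsClosed C) (hne : C.Nonempty) (h : IsLift Γ J γ K a k)
    (hseg : IsMinimizingSegment E C γ K) :
    Γ '' J = {q | q.1 ∈ γ '' K \ C ∧ (q.2 : ℝ) = - rho E C q.1} := by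
  ext q
  constructor
  · rintro ⟨τ, hτ, rfl⟩
    have hτ' := (h.mem_iff τ).1 hτ
    have hρ := hseg.rho_eq _ hτ'.1
    refine ⟨⟨?_, ?_⟩, ?_⟩
    · rw [h.fst_eq τ hτ]
      exact mem_image_of_mem γ hτ'.1
    · rw [h.fst_eq τ hτ, ← rho_pos_iff (E := E) hC hne, hρ]
      exact hτ'.2
    · rw [h.fst_eq τ hτ, hρ, h.snd_eq τ hτ]
      ring
  · rintro ⟨⟨⟨s, hs, hsq⟩, hq⟩, hq2⟩
    rw [← hsq, hseg.rho_eq s hs] at hq2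
    have h0 : 0 < s := by
      have := q.2.2
      change (q.2 : ℝ) < 0 at this
      linarith
    obtain ⟨e1, e2⟩ := h.apply_div hs h0
    exact ⟨_, h.div_mem hs h0, Prod.ext (e1.trans hsq) (Subtype.ext (e2.trans hq2.symm))⟩

end IsLift

/-- A null geodesic of the graph comes from a minimizing segment. -/
theorem exists_isLift_of_isNullGeodesicIn
    (h : IsNullGeodesicIn (lorentzMetric E S) (timeField E S) (graphSet E C) Γ J) :
    ∃ γ K a k, IsMinimizingSegment E C γ K ∧ (∀ s ∈ K, 0 < s) ∧ IsLift Γ J γ K a k := by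
  obtain ⟨a, k, hk, hgeo, hΓ⟩ := isNullGeodesicIn_graphSet_iff.1 h
  have hk0 : -k⁻¹ ≠ 0 := by simpa using hk.ne'
  have haff := hgeo.comp_affine (a / k) hk0
  have e : ∀ s, a / k + -k⁻¹ * s = (a - s) / k := fun s ↦ by ring
  simp only [e, show (-k⁻¹) ^ 2 * k ^ 2 = 1 by field_simp] at haff
  have e2 : ∀ τ, (a - (a - k * τ)) / k = τ := fun τ ↦ by
    field_simp
    ring
  -- The time coordinate at this parameter is -s, and it is negative.
  have hpos : ∀ s, (a - s) / k ∈ J → 0 < s := fun s hs ↦ by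
    have h1 := (hΓ _ hs).1
    have h2 := (Γ ((a - s) / k)).2.2
    change ((Γ ((a - s) / k)).2 : ℝ) < 0 at h2
    have h3 := IsLift.sub_mul_div hk.ne' a s
    linarith
  refine ⟨_, _, a, k, isMinimizingSegment_iff.2 ⟨haff, fun s hs ↦ ?_⟩, hpos, hk, fun τ ↦ ?_,
    fun τ hτ ↦ ?_, fun τ hτ ↦ (hΓ τ hτ).1⟩
  · rw [(hΓ _ hs).2, IsLift.sub_mul_div hk.ne']
  · simp only [mem_ofPred_eq, e2]
    exact ⟨fun hτ ↦ ⟨hτ, hpos _ (by rwa [e2])⟩, fun hτ ↦ hτ.1⟩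
  · simp only [e2]

/-- Glueing of two minimizing segments which agree for positive parameters. -/
lemma IsMinimizingSegment.exists_union (h : IsMinimizingSegment E C γ K)
    (h' : IsMinimizingSegment E C γ' K') (hpos : ∀ s ∈ K', 0 < s)
    (hsub : ∀ s ∈ K, 0 < s → s ∈ K') (heq : ∀ s ∈ K, 0 < s → γ' s = γ s) :
    ∃ η, IsMinimizingSegment E C η (K ∪ K') ∧ EqOn η γ K ∧ EqOn η γ' K' := by
  set η : ℝ → S := fun s ↦ if s ≤ 0 then γ s else γ' s
  have e1 : EqOn η γ K := fun s hs ↦ by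
    by_cases h0 : s ≤ 0
    · exact if_pos h0
    · exact (if_neg h0).trans (heq s hs (not_le.1 h0))
  have e2 : EqOn η γ' K' := fun s hs ↦ if_neg (hpos s hs).not_ge
  refine ⟨η, isMinimizingSegment_iff.2 ⟨isGeodesicWithSpeed_of_exists ?_
    (h.nontrivial.mono subset_union_left) fun s hs ↦ ?_, fun s hs ↦ ?_⟩, e1, e2⟩
  · obtain ⟨s, hs, h0⟩ := h.exists_pos
    rw [← isPreconnected_iff_ordConnected]
    exact (isPreconnected_iff_ordConnected.2 h.ordConnected).union s hs (hsub s hs h0)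
      (isPreconnected_iff_ordConnected.2 h'.ordConnected)
  · rcases le_or_gt s 0 with h0 | h0
    · have hsK : s ∈ K := hs.resolve_right fun hs ↦ (hpos s hs).not_ge h0
      -- At 0 a neighborhood within the union belongs to K, as [0, r] ⊆ K for some r > 0; at
      -- positive parameters a neighborhood belongs to K'.
      obtain rfl : s = 0 := le_antisymm h0 (h.nonneg hsK)
      obtain ⟨r, hr, hr0⟩ := h.exists_pos
      refine ⟨_, (h.isGeodesicWithSpeed.isSprayCurveAt 0 hsK _
        (mem_chart_source E _)).of_mem_nhdsWithin ?_ e1⟩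
      filter_upwards [self_mem_nhdsWithin, mem_nhdsWithin_of_mem_nhds (Iic_mem_nhds hr0)]
        with t ht htr
      have ht0 : 0 ≤ t := ht.elim (fun ht ↦ h.nonneg ht) fun ht ↦ (hpos t ht).le
      exact h.ordConnected.out hsK hr ⟨ht0, htr⟩
    · have hsK : s ∈ K' := hs.elim (fun hs ↦ hsub s hs h0) id
      refine ⟨_, (h'.isGeodesicWithSpeed.isSprayCurveAt s hsK _
        (mem_chart_source E _)).of_mem_nhdsWithin ?_ e2⟩
      filter_upwards [self_mem_nhdsWithin, mem_nhdsWithin_of_mem_nhds (Ioi_mem_nhds h0)]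
        with t ht ht0
      exact ht.elim (fun ht ↦ hsub t ht ht0) id
  · rcases hs with hs | hs
    · rw [e1 hs, h.rho_eq s hs]
    · rw [e2 hs, h'.rho_eq s hs]

/-- The positive part of a maximal segment cannot be extended within positive parameters. -/
lemma IsMaximalSegment.mem_of_extends (h : IsMaximalSegment E C γ K)
    (h' : IsMinimizingSegment E C γ' K') (hpos : ∀ s ∈ K', 0 < s)
    (hsub : ∀ s ∈ K, 0 < s → s ∈ K') (heq : ∀ s ∈ K, 0 < s → γ' s = γ s) {s : ℝ} (hs : s ∈ K') :
    s ∈ K := by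
  obtain ⟨η, hη, e, -⟩ := h.segment.exists_union h' hpos hsub heq
  have := h.maximal η _ hη subset_union_left e
  exact this ▸ Or.inr hs

/-- A maximal segment is determined by its part outside `C`. -/
lemma IsMaximalSegment.zero_mem_of_eq (h : IsMaximalSegment E C γ K)
    (h' : IsMaximalSegment E C γ' K') (hK : ∀ s, 0 < s → (s ∈ K ↔ s ∈ K'))
    (heq : ∀ s ∈ K, 0 < s → γ' s = γ s) (h0 : 0 ∈ K) : 0 ∈ K' := by
  by_contra h0'
  have hpos : ∀ s ∈ K', 0 < s := fun s hs ↦ (h'.segment.nonneg hs).lt_of_ne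
    (by rintro rfl; exact h0' hs)
  obtain ⟨η, hη, -, e⟩ := h.segment.exists_union h'.segment hpos (fun s hs hs0 ↦ (hK s hs0).1 hs)
      heq
  have := h'.maximal η _ hη subset_union_right e
  exact h0' (this ▸ Or.inl h0)

/-- Maximality decides whether 0 belongs to the domain, and continuity determines the value there;
so distinct maximal segments have distinct lifts. -/
lemma IsMaximalSegment.image_eq (h : IsMaximalSegment E C γ K)
    (h' : IsMaximalSegment E C γ' K') (hK : ∀ s, 0 < s → (s ∈ K ↔ s ∈ K'))
    (heq : ∀ s ∈ K, 0 < s → γ' s = γ s) : γ '' K = γ' '' K' := by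
  have h0 : 0 ∈ K ↔ 0 ∈ K' := ⟨h.zero_mem_of_eq h' hK heq,
    h'.zero_mem_of_eq h (fun s hs ↦ (hK s hs).symm) fun s hs hs0 ↦
      (heq s ((hK s hs0).2 hs) hs0).symm⟩
  have hKK : K = K' := by
    ext s
    rcases lt_trichotomy s 0 with hs | rfl | hs
    · exact ⟨fun hm ↦ absurd (h.segment.nonneg hm) hs.not_ge,
        fun hm ↦ absurd (h'.segment.nonneg hm) hs.not_ge⟩
    · exact h0
    · exact hK s hs
  subst hKK
  refine image_congr fun s hs ↦ ?_
  rcases (h.segment.nonneg hs).eq_or_lt with rfl | hs0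
  · obtain ⟨r, hr, hr0⟩ := h.segment.exists_pos
    have hle : 𝓝[>] (0 : ℝ) ≤ 𝓝[K] 0 := by
      refine le_inf nhdsWithin_le_nhds (le_principal_iff.2 (mem_of_superset (Ioo_mem_nhdsGT hr0)
          ?_))
      exact fun t ht ↦ h.segment.ordConnected.out hs hr ⟨ht.1.le, ht.2.le⟩
    refine tendsto_nhds_unique ((h.segment.continuousOn 0 hs).mono_left hle)
      (((h'.segment.continuousOn 0 hs).mono_left hle).congr' ?_)
    filter_upwards [hle self_mem_nhdsWithin, self_mem_nhdsWithin] with t ht ht0 using heq t ht ht0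
  · exact (heq s hs hs0).symm

end Generators

/-! ### Generators and maximal segments correspond -/

section Correspondence

set_option linter.unusedSectionVars false

variable {E : Type*} [NormedAddCommGroup E] [NormedSpace ℝ E] [FiniteDimensional ℝ E]
  {S : Type*} [TopologicalSpace S] [T2Space S] [ConnectedSpace S] [ChartedSpace E S]
  [RiemannianBundle (fun x : S ↦ TangentSpace 𝓘(ℝ, E) x)] [IsManifold 𝓘(ℝ, E) ∞ S]
  [IsContMDiffRiemannianBundle 𝓘(ℝ, E) ∞ E (fun x : S ↦ TangentSpace 𝓘(ℝ, E) x)]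
  {C : Set S} {Γ : ℝ → Cyl S} {γ : ℝ → S} {J K : Set ℝ} {a k : ℝ}

namespace IsLift

/-- A future end point of the lift is approached by the segment at its lower end. -/
lemma of_isFutureEndpoint (h : IsLift Γ J γ K a k) {q : Cyl S} (hq : IsFutureEndpoint Γ J q) :
    (∀ s ∈ K, 0 < s → -(q.2 : ℝ) ≤ s) ∧
      ∀ U ∈ 𝓝 q.1, ∃ r ∈ K, 0 < r ∧ ∀ s ∈ K, 0 < s → s ≤ r → γ s ∈ U := by
  have key : ∀ U ∈ 𝓝 q, ∃ r ∈ K, 0 < r ∧ ∀ s ∈ K, 0 < s → s ≤ r → Γ ((a - s) / k) ∈ U := by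
    intro U hU
    obtain ⟨τ, hτ, hτU⟩ := hq U hU
    obtain ⟨h1, h2⟩ := (h.mem_iff τ).1 hτ
    refine ⟨_, h1, h2, fun s hs h0 hsr ↦ hτU _ (h.div_mem hs h0) ?_⟩
    rw [le_div_iff₀ h.pos]
    linarith
  refine ⟨fun s hs h0 ↦ le_of_forall_pos_lt_add fun ε hε ↦ ?_, fun U hU ↦ ?_⟩
  · have hcont : Continuous fun z : Cyl S ↦ (z.2 : ℝ) := continuous_subtype_val.comp continuous_snd
    obtain ⟨r, hr, hr0, hrU⟩ := key _ (hcont.continuousAt.preimage_mem_nhds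
      (Iio_mem_nhds (lt_add_of_pos_right (q.2 : ℝ) hε)))
    rcases le_total s r with hsr | hsr
    · have := hrU s hs h0 hsr
      rw [mem_preimage, (h.apply_div hs h0).2, mem_Iio] at this
      linarith
    · have := hrU r hr hr0 le_rfl
      rw [mem_preimage, (h.apply_div hr hr0).2, mem_Iio] at this
      linarith
  · obtain ⟨r, hr, hr0, hrU⟩ := key _ (continuous_fst.continuousAt.preimage_mem_nhds hU)
    refine ⟨r, hr, hr0, fun s hs h0 hsr ↦ ?_⟩
    rw [← (h.apply_div hs h0).1]
    exact hrU s hs h0 hsr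

/-- A past end point of the lift is approached by the segment at its upper end. -/
lemma of_isPastEndpoint (h : IsLift Γ J γ K a k) {q : Cyl S} (hq : IsPastEndpoint Γ J q) :
    (∀ s ∈ K, 0 < s → s ≤ -(q.2 : ℝ)) ∧
      ∀ U ∈ 𝓝 q.1, ∃ r ∈ K, 0 < r ∧ ∀ s ∈ K, 0 < s → r ≤ s → γ s ∈ U := by
  have key : ∀ U ∈ 𝓝 q, ∃ r ∈ K, 0 < r ∧ ∀ s ∈ K, 0 < s → r ≤ s → Γ ((a - s) / k) ∈ U := by
    intro U hU
    obtain ⟨τ, hτ, hτU⟩ := hq U hU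
    obtain ⟨h1, h2⟩ := (h.mem_iff τ).1 hτ
    refine ⟨_, h1, h2, fun s hs h0 hsr ↦ hτU _ (h.div_mem hs h0) ?_⟩
    rw [div_le_iff₀ h.pos]
    linarith
  refine ⟨fun s hs h0 ↦ le_of_forall_pos_lt_add fun ε hε ↦ ?_, fun U hU ↦ ?_⟩
  · have hcont : Continuous fun z : Cyl S ↦ (z.2 : ℝ) := continuous_subtype_val.comp continuous_snd
    obtain ⟨r, hr, hr0, hrU⟩ := key _ (hcont.continuousAt.preimage_mem_nhds
      (Ioi_mem_nhds (sub_lt_self (q.2 : ℝ) hε)))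
    rcases le_total r s with hsr | hsr
    · have := hrU s hs h0 hsr
      rw [mem_preimage, (h.apply_div hs h0).2, mem_Ioi] at this
      linarith
    · have := hrU r hr hr0 le_rfl
      rw [mem_preimage, (h.apply_div hr hr0).2, mem_Ioi] at this
      linarith
  · obtain ⟨r, hr, hr0, hrU⟩ := key _ (continuous_fst.continuousAt.preimage_mem_nhds hU)
    refine ⟨r, hr, hr0, fun s hs h0 hsr ↦ ?_⟩
    rw [← (h.apply_div hs h0).1]
    exact hrU s hs h0 hsr

/-- An end point at height -m < 0 would confine K to parameters at least m. If m is attained,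
`IsMaximalSegment.exists_lt` gives a smaller positive parameter; otherwise the segment converges at
m, against `IsMaximalSegment.not_tendsto_left`. -/
lemma not_isFutureEndpoint (hC : IsClosed C) (hne : C.Nonempty) (h : IsLift Γ J γ K a k)
    (hmax : IsMaximalSegment E C γ K) : ¬ ∃ q, IsFutureEndpoint Γ J q := by
  rintro ⟨q, hq⟩
  obtain ⟨hle, hlim⟩ := h.of_isFutureEndpoint hq
  set m := -(q.2 : ℝ)
  have hm : 0 < m := neg_pos.2 q.2.2
  have hpos : ∀ s ∈ K, 0 < s := by
    intro s hs
    obtain ⟨r, hr, hr0⟩ := hmax.segment.exists_pos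
    by_contra! hs0
    have hρ : 0 < min (m / 2) r := lt_min (by linarith) hr0
    have hmem : min (m / 2) r ∈ K := hmax.segment.ordConnected.out hs hr
      ⟨hs0.trans hρ.le, min_le_right _ _⟩
    linarith [hle _ hmem hρ, min_le_left (m / 2) r]
  have hlt : ∀ s ∈ K, m < s := by
    refine fun s hs ↦ (hle s hs (hpos s hs)).lt_of_ne ?_
    rintro rfl
    obtain ⟨r, hr, hr0, hrm⟩ := hmax.exists_lt hC hne hs hm
    exact (hle r hr hr0).not_gt hrm
  refine hmax.not_tendsto_left hne hlt ?_ q.1 fun U hU ↦ ?_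
  · rw [Metric.mem_closure_iff]
    intro ε hε
    have hcl : ∃ s ∈ K, s < m + ε := by
      by_contra! hcon
      have hcont : Continuous fun z : Cyl S ↦ (z.2 : ℝ) :=
        continuous_subtype_val.comp continuous_snd
      obtain ⟨τ, hτ, hτU⟩ := hq _ (hcont.continuousAt.preimage_mem_nhds
        (Ioi_mem_nhds (sub_lt_self (q.2 : ℝ) hε)))
      have h1 := hτU τ hτ le_rfl
      rw [mem_preimage, h.snd_eq τ hτ, mem_Ioi] at h1
      have h2 := hcon _ ((h.mem_iff τ).1 hτ).1
      linarith
    obtain ⟨s, hs, hsε⟩ := hcl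
    refine ⟨s, hs, ?_⟩
    rw [dist_comm, Real.dist_eq, abs_of_pos (sub_pos.2 (hlt s hs))]
    linarith
  · obtain ⟨r, hr, hr0, hrU⟩ := hlim U hU
    rw [mem_map]
    filter_upwards [self_mem_nhdsWithin, mem_nhdsWithin_of_mem_nhds (Iic_mem_nhds (hlt r hr))]
      with s hs hsr using hrU s hs (hpos s hs) hsr

/-- The segment converges at its upper end, which must then belong to K by maximality; the limit is
the value because S is Hausdorff. -/
lemma snd_mem_of_isPastEndpoint (hne : C.Nonempty) (h : IsLift Γ J γ K a k)
    (hmax : IsMaximalSegment E C γ K) {q : Cyl S} (hq : IsPastEndpoint Γ J q) :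
    IsGreatest K (-(q.2 : ℝ)) ∧ γ (-(q.2 : ℝ)) = q.1 := by
  obtain ⟨hle, hlim⟩ := h.of_isPastEndpoint hq
  set m := -(q.2 : ℝ) with hm_def
  have hm : 0 < m := neg_pos.2 q.2.2
  have hub : ∀ s ∈ K, s ≤ m := fun s hs ↦ (le_or_gt s 0).elim (fun h0 ↦ h0.trans hm.le) (hle s hs)
  have hmK : m ∈ K := by
    by_contra hmK
    have hlt : ∀ s ∈ K, s < m := fun s hs ↦ (hub s hs).lt_of_ne (by rintro rfl; exact hmK hs)
    refine hmax.not_tendsto_right hne hlt ?_ q.1 fun U hU ↦ ?_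
    · rw [Metric.mem_closure_iff]
      intro ε hε
      have hcl : ∃ s ∈ K, m - ε < s := by
        have hcont : Continuous fun z : Cyl S ↦ (z.2 : ℝ) :=
          continuous_subtype_val.comp continuous_snd
        obtain ⟨τ, hτ, hτU⟩ := hq _ (hcont.continuousAt.preimage_mem_nhds
          (Iio_mem_nhds (lt_add_of_pos_right (q.2 : ℝ) hε)))
        have h1 := hτU τ hτ le_rfl
        rw [mem_preimage, h.snd_eq τ hτ, mem_Iio] at h1
        exact ⟨_, ((h.mem_iff τ).1 hτ).1, by linarith⟩
      obtain ⟨s, hs, hsε⟩ := hcl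
      refine ⟨s, hs, ?_⟩
      rw [Real.dist_eq, abs_of_pos (sub_pos.2 (hlt s hs))]
      linarith
    · obtain ⟨r, hr, hr0, hrU⟩ := hlim U hU
      rw [mem_map]
      filter_upwards [self_mem_nhdsWithin, mem_nhdsWithin_of_mem_nhds (Ici_mem_nhds (hlt r hr))]
        with s hs hsr using hrU s hs (hr0.trans_le hsr) hsr
  refine ⟨⟨hmK, hub⟩, ?_⟩
  by_contra hcon
  obtain ⟨r, hr, hr0, hrU⟩ := hlim _ (isOpen_ne.mem_nhds (Ne.symm hcon) : {x | x ≠ γ m} ∈ 𝓝 q.1)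
  exact hrU m hmK hm (hub r hr) rfl

/-- An extension of the lift within the graph is itself the lift of a segment, which would extend
the positive part of a maximal segment. -/
theorem isGenerator (hC : IsClosed C) (hne : C.Nonempty) (h : IsLift Γ J γ K a k)
    (hmax : IsMaximalSegment E C γ K) :
    IsGenerator (lorentzMetric E S) (timeField E S) (graphSet E C) Γ J := by
  refine ⟨h.isNullGeodesicIn hmax.segment, h.not_isFutureEndpoint hC hne hmax,
    fun Γ' J' hΓ' hJ' heq ↦ Subset.antisymm (fun τ hτ ↦ ?_) hJ'⟩
  obtain ⟨γ', K', a', k', hseg, hpos, h'⟩ := exists_isLift_of_isNullGeodesicIn hΓ'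
  obtain ⟨τ₁, h₁, τ₂, h₂, hne12⟩ := h.nontrivial hmax.segment
  -- Both sides are the time coordinate; as J has two points, the constants of the two lifts
  -- coincide.
  have haff : ∀ τ ∈ J, k' * τ - a' = k * τ - a := fun τ hτ ↦ by
    rw [← h.snd_eq τ hτ, ← h'.snd_eq τ (hJ' hτ), heq hτ]
  have hkk : k' = k := by
    have h3 := haff τ₁ h₁
    have h4 := haff τ₂ h₂
    refine sub_eq_zero.1 ((mul_eq_zero.1 (?_ : (k' - k) * (τ₁ - τ₂) = 0)).resolve_right
      (sub_ne_zero.2 hne12))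
    linarith
  subst hkk
  obtain rfl : a' = a := by linarith [haff τ₁ h₁]
  have hsub : ∀ s ∈ K, 0 < s → s ∈ K' := fun s hs h0 ↦ by
    have := ((h'.mem_iff _).1 (hJ' (h.div_mem hs h0))).1
    rwa [sub_mul_div h.pos.ne'] at this
  have hγ : ∀ s ∈ K, 0 < s → γ' s = γ s := fun s hs h0 ↦ by
    rw [← (h.apply_div hs h0).1, ← (h'.apply_div (hsub s hs h0) h0).1, heq (h.div_mem hs h0)]
  have hτ' := (h'.mem_iff τ).1 hτ
  exact (h.mem_iff τ).2 ⟨hmax.mem_of_extends hseg hpos hsub hγ hτ'.1, hτ'.2⟩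

end IsLift

/-- The segment under a generator is extended to a maximal one, whose lift extends the generator;
maximality of the generator makes the domains equal. -/
theorem exists_isLift_of_isGenerator
    (h : IsGenerator (lorentzMetric E S) (timeField E S) (graphSet E C) Γ J) :
    ∃ γ K a k, IsMaximalSegment E C γ K ∧ IsLift Γ J γ K a k := by
  obtain ⟨γ₀, K₀, a, k, hseg, hpos, hlift⟩ := exists_isLift_of_isNullGeodesicIn h.nullGeodesic
  obtain ⟨γ, K, hmax, hsub, heq⟩ := hseg.exists_isMaximalSegment
  obtain ⟨Γ', hΓ'⟩ := exists_isLift γ K a hlift.pos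
  have hJ : J ⊆ {τ | a - k * τ ∈ K ∧ 0 < a - k * τ} := fun τ hτ ↦
    ⟨hsub ((hlift.mem_iff τ).1 hτ).1, ((hlift.mem_iff τ).1 hτ).2⟩
  have hfst : ∀ τ ∈ J, (Γ τ).1 = γ (a - k * τ) := fun τ hτ ↦ by
    rw [hlift.fst_eq τ hτ, heq ((hlift.mem_iff τ).1 hτ).1]
  have hJ' := h.maximal Γ' _ (hΓ'.isNullGeodesicIn hmax.segment) hJ fun τ hτ ↦
    Prod.ext ((hΓ'.fst_eq τ (hJ hτ)).trans (hfst τ hτ).symm)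
      (Subtype.ext ((hΓ'.snd_eq τ (hJ hτ)).trans (hlift.snd_eq τ hτ).symm))
  exact ⟨γ, K, a, k, hmax, hlift.pos, fun τ ↦ by rw [← hJ']; rfl, hfst, hlift.snd_eq⟩

/-- Each point outside `C` lies on a maximal segment. -/
lemma exists_isMaximalSegment (hC : IsClosed C) (hne : C.Nonempty) {p : S} (hp : p ∉ C) :
    ∃ γ K, IsMaximalSegment E C γ K ∧ rho E C p ∈ K ∧ γ (rho E C p) = p := by
  obtain ⟨γ, ε, hε, hseg, hγ⟩ := exists_isMinimizingSegment (E := E) hC hne hp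
  obtain ⟨γ', K, hmax, hsub, heq⟩ := hseg.exists_isMaximalSegment
  have hmem : rho E C p ∈ Icc (rho E C p - ε) (rho E C p) := ⟨by linarith, le_rfl⟩
  exact ⟨γ', K, hmax, hsub hmem, by rw [heq hmem, hγ]⟩

theorem isFutureHorizon_graphSet (hC : IsClosed C) (hne : C.Nonempty) :
    IsFutureHorizon (lorentzMetric E S) (timeField E S) (graphSet E C) where
  achronal := isAchronal_graphSet hne
  closed := isClosed_graphSet hne
  hypersurface := isTopologicalHypersurface_graphSet hne
  ruled := by
    intro q hq
    obtain ⟨γ, K, hmax, hK, hγ⟩ := exists_isMaximalSegment (E := E) hC hne hq.1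
    obtain ⟨Γ, hΓ⟩ := exists_isLift γ K 0 one_pos
    have hgen := hΓ.isGenerator hC hne hmax
    refine ⟨Γ, _, hgen.nullGeodesic, hgen.inextensible, ?_⟩
    rw [hΓ.image_eq hC hne hmax.segment]
    exact ⟨⟨⟨_, hK, hγ⟩, hq.1⟩, hq.2⟩

/-- Taking the graph over A \ C maps the images of maximal segments onto the images of generators.
It is injective because a maximal segment is determined by its part outside C. -/
theorem genMultiplicity_eq_numSegments (hC : IsClosed C) (hne : C.Nonempty) {q : Cyl S}
    (hq : q ∈ graphSet E C) :
    genMultiplicity (lorentzMetric E S) (timeField E S) (graphSet E C) q =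
      numSegments E C q.1 := by
  set L : Set S → Set (Cyl S) := fun A ↦ {z | z.1 ∈ A \ C ∧ (z.2 : ℝ) = - rho E C z.1}
  have hLmem : ∀ (A : Set S) (x : S), x ∉ C → (x ∈ A ↔ ∃ z ∈ L A, z.1 = x) := by
    intro A x hx
    constructor
    · intro hxA
      exact ⟨(x, ⟨- rho E C x, neg_lt_zero.2 (rho_pos hC hne hx)⟩), ⟨⟨hxA, hx⟩, rfl⟩, rfl⟩
    · rintro ⟨z, hz, rfl⟩
      exact hz.1.1
  have hset : {G : Set (Cyl S) | q ∈ G ∧ ∃ (Γ : ℝ → Cyl S) (J : Set ℝ),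
      IsGenerator (lorentzMetric E S) (timeField E S) (graphSet E C) Γ J ∧ G = Γ '' J} =
      L '' {A : Set S | q.1 ∈ A ∧ ∃ (γ : ℝ → S) (K : Set ℝ),
        IsMaximalSegment E C γ K ∧ A = γ '' K} := by
    ext G
    constructor
    · rintro ⟨hqG, Γ, J, hgen, rfl⟩
      obtain ⟨γ, K, a, k, hmax, hlift⟩ := exists_isLift_of_isGenerator hgen
      have himg := hlift.image_eq hC hne hmax.segment
      refine ⟨γ '' K, ⟨?_, γ, K, hmax, rfl⟩, himg.symm⟩
      rw [himg] at hqG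
      exact hqG.1.1
    · rintro ⟨A, ⟨hqA, γ, K, hmax, rfl⟩, rfl⟩
      obtain ⟨Γ, hΓ⟩ := exists_isLift γ K 0 one_pos
      exact ⟨⟨⟨hqA, hq.1⟩, hq.2⟩, Γ, _, hΓ.isGenerator hC hne hmax,
        (hΓ.image_eq hC hne hmax.segment).symm⟩
  rw [genMultiplicity, numSegments, hset]
  refine InjOn.encard_image ?_
  rintro _ ⟨-, γ, K, h, rfl⟩ _ ⟨-, γ', K', h', rfl⟩ hL
  have hiff : ∀ x ∉ C, x ∈ γ '' K ↔ x ∈ γ' '' K' := fun x hx ↦ by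
    rw [hLmem _ x hx, hLmem _ x hx, hL]
  have key : ∀ {γ γ' : ℝ → S} {K K' : Set ℝ}, IsMaximalSegment E C γ K →
      IsMaximalSegment E C γ' K' → (∀ x ∉ C, x ∈ γ '' K → x ∈ γ' '' K') →
      ∀ s ∈ K, 0 < s → s ∈ K' ∧ γ' s = γ s := by
    intro γ γ' K K' h h' hsub s hs h0
    have hρ := h.segment.rho_eq s hs
    have hmem := hsub (γ s) ((rho_pos_iff hC hne).1 (hρ ▸ h0)) (mem_image_of_mem γ hs)
    have h1 := h'.segment.apply_rho hmem
    have h2 := mem_image_of_mem (rho E C) hmem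
    rw [h'.segment.rho_image, hρ] at h2
    rw [hρ] at h1
    exact ⟨h2, h1⟩
  exact h.image_eq h' (fun s h0 ↦ ⟨fun hs ↦ (key h h' (fun x hx ↦ (hiff x hx).1) s hs h0).1,
    fun hs ↦ (key h' h (fun x hx ↦ (hiff x hx).2) s hs h0).1⟩)
    fun s hs h0 ↦ (key h h' (fun x hx ↦ (hiff x hx).1) s hs h0).2

theorem image_endpoints_graphSet (hC : IsClosed C) (hne : C.Nonempty) :
    (fun q : Cyl S ↦ (q.1, (q.2 : ℝ))) ''
        endpoints (lorentzMetric E S) (timeField E S) (graphSet E C) =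
      (fun p : S ↦ (p, - rho E C p)) '' cutLocus E C := by
  apply Subset.antisymm
  · rintro _ ⟨q, ⟨Γ, J, hgen, hq⟩, rfl⟩
    obtain ⟨γ, K, a, k, hmax, hlift⟩ := exists_isLift_of_isGenerator hgen
    obtain ⟨hgr, hγ⟩ := hlift.snd_mem_of_isPastEndpoint hne hmax hq
    refine ⟨q.1, ⟨γ, K, _, hmax, hgr, hγ⟩, ?_⟩
    have := hmax.segment.rho_eq _ hgr.1
    rw [hγ] at this
    simp only [this, neg_neg]
  · rintro _ ⟨_, ⟨γ, K, b, hmax, hgr, rfl⟩, rfl⟩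
    obtain ⟨Γ, hΓ⟩ := exists_isLift γ K 0 one_pos
    obtain ⟨s, hs, hs0⟩ := hmax.segment.exists_pos
    have hb : 0 < b := hs0.trans_le (hgr.2 hs)
    obtain ⟨e1, e2⟩ := hΓ.apply_div hgr.1 hb
    refine ⟨Γ ((0 - b) / 1), ⟨Γ, _, hΓ.isGenerator hC hne hmax, fun U hU ↦
      ⟨_, hΓ.div_mem hgr.1 hb, fun τ hτ hle ↦ ?_⟩⟩, ?_⟩
    · have h1 := hgr.2 ((hΓ.mem_iff τ).1 hτ).1
      -- As b is the largest parameter of the segment, -b is the smallest one of the lift, so only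
      -- this point has to lie in U.
      obtain rfl : τ = (0 - b) / 1 := le_antisymm hle (by linarith)
      exact mem_of_mem_nhds hU
    · simp only
      rw [e1, e2, hmax.segment.rho_eq b hgr.1]

end Correspondence

end Horizon

end

theorem proposition4p2
    {E : Type*} [NormedAddCommGroup E] [NormedSpace ℝ E] [FiniteDimensional ℝ E]
    {S : Type*} [TopologicalSpace S] [T2Space S] [ConnectedSpace S]
    [ChartedSpace E S] [IsManifold 𝓘(ℝ, E) ∞ S]
    [RiemannianBundle (fun x : S ↦ TangentSpace 𝓘(ℝ, E) x)]
    [IsContMDiffRiemannianBundle 𝓘(ℝ, E) ∞ E (fun x : S ↦ TangentSpace 𝓘(ℝ, E) x)]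
    (C : Set S) (hC : IsClosed C) (hne : C.Nonempty) :
    IsFutureHorizon (lorentzMetric E S) (timeField E S) (graphSet E C) ∧
    -- every generator is, up to reparametrization, the lift of a segment
    (∀ (Γ : ℝ → Cyl S) (J : Set ℝ),
      IsGenerator (lorentzMetric E S) (timeField E S) (graphSet E C) Γ J →
      ∃ (γ : ℝ → S) (K : Set ℝ) (a k : ℝ), IsMaximalSegment E C γ K ∧ 0 < k ∧
        (fun τ ↦ a - k * τ) '' J = {s ∈ K | 0 < s} ∧
        ∀ τ ∈ J, (Γ τ).1 = γ (a - k * τ) ∧ ((Γ τ).2 : ℝ) = - rho E C (γ (a - k * τ))) ∧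
    -- the lift of every segment is, up to reparametrization, a generator
    (∀ (γ : ℝ → S) (K : Set ℝ), IsMaximalSegment E C γ K →
      ∃ Γ : ℝ → Cyl S,
        (∀ s ∈ K, 0 < s → (Γ (-s)).1 = γ s ∧ ((Γ (-s)).2 : ℝ) = - rho E C (γ s)) ∧
        IsGenerator (lorentzMetric E S) (timeField E S) (graphSet E C) Γ
          {τ | -τ ∈ K ∧ 0 < -τ}) ∧
    (∀ p : S, p ∉ C → ∃ hp : - rho E C p < 0,
      genMultiplicity (lorentzMetric E S) (timeField E S) (graphSet E C)
        (p, ⟨- rho E C p, hp⟩) = numSegments E C p) ∧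
    (fun q : Cyl S ↦ (q.1, (q.2 : ℝ))) ''
        endpoints (lorentzMetric E S) (timeField E S) (graphSet E C) =
      (fun p : S ↦ (p, - rho E C p)) '' cutLocus E C := by
  refine ⟨isFutureHorizon_graphSet hC hne, fun Γ J hgen ↦ ?_, fun γ K hmax ↦ ?_, fun p hp ↦ ?_,
    image_endpoints_graphSet hC hne⟩
  · obtain ⟨γ, K, a, k, hmax, hlift⟩ := exists_isLift_of_isGenerator hgen
    refine ⟨γ, K, a, k, hmax, hlift.pos, ?_, fun τ hτ ↦ ⟨hlift.fst_eq τ hτ, ?_⟩⟩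
    · ext s
      constructor
      · rintro ⟨τ, hτ, rfl⟩
        exact (hlift.mem_iff τ).1 hτ
      · rintro ⟨hs, h0⟩
        exact ⟨_, hlift.div_mem hs h0, IsLift.sub_mul_div hlift.pos.ne' a s⟩
    · rw [hlift.snd_eq τ hτ, hmax.segment.rho_eq _ ((hlift.mem_iff τ).1 hτ).1]
      ring
  -- With a = 0 and k = 1 the change of parameter is s = -τ.
  · obtain ⟨Γ, hΓ⟩ := exists_isLift γ K 0 one_pos
    have hJ : {τ : ℝ | 0 - 1 * τ ∈ K ∧ 0 < 0 - 1 * τ} = {τ | -τ ∈ K ∧ 0 < -τ} := by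
      simp only [one_mul, zero_sub]
    refine ⟨Γ, fun s hs h0 ↦ ?_, hJ ▸ hΓ.isGenerator hC hne hmax⟩
    have h := hΓ.apply_div hs h0
    rw [zero_sub, div_one] at h
    exact ⟨h.1, by rw [h.2, hmax.segment.rho_eq s hs]⟩
  · have hlt : - rho E C p < 0 := neg_lt_zero.2 (rho_pos hC hne hp)
    exact ⟨hlt, genMultiplicity_eq_numSegments hC hne (q := (p, ⟨- rho E C p, hlt⟩)) ⟨hp, rfl⟩⟩
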